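/- **Proposition 4.4.** Let $(M,g)$ be a complete connected $6$-dimensional Riemannian manifold with Levi-Civita connection $\nabla$. The assignment $$J\;\longmapsto\;\Big(\text{orientation of } M \text{ induced by } J,\ \ \bar\nabla:=\nabla-\tfrac12\,J\circ\nabla J\Big)$$ is a well-defined bijection between 1. the almost Hermitian structures $J$ on $(M,g)$ (smooth, orthogonal, $J^2=-\mathrm{id}$) for which $(M,g,J)$ is a naturally reductive strict nearly Kähler manifold, i.e. $(\nabla_XJ)Y=-(\nabla_YJ)X$ for all vector fields $X,Y$, $\nabla J\neq0$, and $\nabla-\frac12 J\circ\nabla J$ is an Ambrose–Singer connection; and 2. the pairs consisting of an orientation of $M$ and a connection $\bar\nabla$ on $TM$ such that $(M,g,\bar\nabla)$ is a naturally reductive space whose torsion form $\tau$ is a generalized vector cross product at every point. Here an Ambrose–Singer connection is a metric connection with parallel torsion and parallel curvature. The triple $(M,g,\bar\nabla)$ is naturally reductive with torsion form $\tau$ if $\bar\nabla$ is an Ambrose–Singer connection and $\bar\nabla=\nabla+\frac12\tau$ for an alternating $3$-form $\tau$, that is $g(\bar\nabla_XY,Z)=g(\nabla_XY,Z)+\frac12\tau(X,Y,Z)$.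 An alternating $3$-form $\tau$ on a Euclidean vector space $T$ is a generalized vector cross product if $\tau\neq0$ and the endomorphisms $\tau_X$, $\tau_Y$ given by $g(\tau_XU,V)=\tau(X,U,V)$ (similarly for $Y$) are conjugate in $\mathrm O(T)$ for all unit vectors $X,Y\in T$. The orientation induced by $J$ is the one for which every tangent basis of the form $(u,Ju,v,Jv,w,Jw)$ is positive. -/

import Mathlib

open Bundle Manifold VectorField
open scoped ContDiff Topology

set_option linter.unusedSectionVars false

noncomputable section

namespace RiemGeom

section
variable (n : ℕ) (M : Type*) [TopologicalSpace M] [ChartedSpace (EuclideanSpace ℝ (Fin n)) M]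
  [IsManifold (𝓡 n) ∞ M]

/-- Smooth vector fields on the `n`-manifold `M`. -/
abbrev VField : Type _ :=
  ContMDiffSection (𝓡 n) (EuclideanSpace ℝ (Fin n)) ∞ (TangentSpace (𝓡 n) : M → Type _)
end

section

variable {n : ℕ} {M : Type*} [TopologicalSpace M] [ChartedSpace (EuclideanSpace ℝ (Fin n)) M]
  [IsManifold (𝓡 n) ∞ M]

/-- Smoothness at `x` of a vector field. -/
def SmoothAt (X : Π x : M, TangentSpace (𝓡 n) x) (x : M) : Prop :=
  ContMDiffAt (𝓡 n) ((𝓡 n).prod 𝓘(ℝ, EuclideanSpace ℝ (Fin n))) ∞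
    (fun y => TotalSpace.mk' (EuclideanSpace ℝ (Fin n)) y (X y)) x

lemma VField.smoothAt (X : VField n M) (x : M) : SmoothAt X x := X.contMDiff x

lemma SmoothAt.bracket {X Y : Π x : M, TangentSpace (𝓡 n) x} {x : M} (hX : SmoothAt X x)
    (hY : SmoothAt Y x) : SmoothAt (mlieBracket (𝓡 n) X Y) x := by
  have : IsManifold (𝓡 n) (minSmoothness ℝ 2) M := by
    simp only [minSmoothness_of_isRCLikeNormedField]; infer_instance
  have : IsManifold (𝓡 n) (minSmoothness ℝ 3) M := by
    simp only [minSmoothness_of_isRCLikeNormedField]; infer_instance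
  have : IsManifold (𝓡 n) (((⊤ : ℕ∞) : WithTop ℕ∞) + 1) M := by
    simpa using (inferInstance : IsManifold (𝓡 n) ∞ M)
  exact ContMDiffAt.mlieBracket_vectorField (m := ⊤) (n := ⊤) hX hY (by simp)

/-- The Lie bracket of two smooth vector fields. -/
def bracket (X Y : VField n M) : VField n M :=
  ⟨mlieBracket (𝓡 n) X Y, fun x => (X.smoothAt x).bracket (Y.smoothAt x)⟩

/-- The product of a smooth function and a smooth vector field. -/
def fmul (f : C^∞⟮𝓡 n, M; ℝ⟯) (X : VField n M) : VField n M :=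
  ⟨fun x => f x • X x, f.contMDiff.smul_section X.contMDiff⟩

/-- The directional derivative `X f`, at the point `x`. -/
def dirDeriv (X : VField n M) (f : M → ℝ) (x : M) : ℝ := mvfderiv (𝓡 n) f x (X x)

variable (n M) in
/-- An affine connection `∇` on `M`: an operator `(X, Y) ↦ ∇_X Y` on smooth vector fields which is
`C^∞(M)`-linear in `X` and additive in `Y` and satisfies the Leibniz rule.
(Mathlib's `CovariantDerivative` also records arbitrary values on non-differentiable vector fields,
so that it is not determined by the geometric connection; this is why it is not used here.) -/
structure AffineConnection where
  /-- `toFun X Y` is the covariant derivative `∇_X Y`. -/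
  toFun : VField n M → VField n M → VField n M
  add_left : ∀ X X' Y, toFun (X + X') Y = toFun X Y + toFun X' Y
  smul_left : ∀ f X Y, toFun (fmul f X) Y = fmul f (toFun X Y)
  add_right : ∀ X Y Y', toFun X (Y + Y') = toFun X Y + toFun X Y'
  leibniz : ∀ X (f : C^∞⟮𝓡 n, M; ℝ⟯) Y x,
    toFun X (fmul f Y) x = f x • toFun X Y x + dirDeriv X f x • Y x

instance : CoeFun (AffineConnection n M) fun _ => VField n M → VField n M → VField n M :=
  ⟨AffineConnection.toFun⟩

/-- The derivative of a smooth function along a smooth vector field is smooth. -/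
lemma contMDiffAt_dirDeriv {f : M → ℝ} {X : Π x : M, TangentSpace (𝓡 n) x} {x : M}
    (hf : ContMDiffAt (𝓡 n) 𝓘(ℝ, ℝ) ∞ f x) (hX : SmoothAt X x) :
    ContMDiffAt (𝓡 n) 𝓘(ℝ, ℝ) ∞ (fun y => mvfderiv (𝓡 n) f y (X y)) x := by
  have h1 := hf.mfderiv_const (m := ∞) (by simp)
  have h2 := ContMDiffAt.clm_apply_of_inCoordinates (b₁ := id) (b₂ := f)
    (ϕ := fun y => mfderiv (𝓡 n) 𝓘(ℝ, ℝ) f y) h1 hX hf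
  rw [contMDiffAt_totalSpace] at h2
  simpa using! h2.2

lemma SmoothAt.mdiff {X : Π x : M, TangentSpace (𝓡 n) x} {x : M} (hX : SmoothAt X x) :
    MDifferentiableAt (𝓡 n) ((𝓡 n).prod 𝓘(ℝ, EuclideanSpace ℝ (Fin n)))
    (fun y => TotalSpace.mk' (EuclideanSpace ℝ (Fin n)) y (X y)) x :=
  ContMDiffAt.mdifferentiableAt hX (by simp)

variable [RiemannianBundle (fun x : M => TangentSpace (𝓡 n) x)]
  [IsContMDiffRiemannianBundle (𝓡 n) ∞ (EuclideanSpace ℝ (Fin n))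
    (fun x : M => TangentSpace (𝓡 n) x)]

instance (x : M) : FiniteDimensional ℝ (TangentSpace (𝓡 n) x) :=
  VectorBundle.finiteDimensional ℝ (EuclideanSpace ℝ (Fin n)) (TangentSpace (𝓡 n) : M → Type _) x

instance (x : M) : CompleteSpace (TangentSpace (𝓡 n) x) := FiniteDimensional.complete ℝ _

lemma mdiff_inner {X Y : Π x : M, TangentSpace (𝓡 n) x} {x : M}
    (hX : MDifferentiableAt (𝓡 n) ((𝓡 n).prod 𝓘(ℝ, EuclideanSpace ℝ (Fin n)))
      (fun y => TotalSpace.mk' (EuclideanSpace ℝ (Fin n)) y (X y)) x)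
    (hY : MDifferentiableAt (𝓡 n) ((𝓡 n).prod 𝓘(ℝ, EuclideanSpace ℝ (Fin n)))
      (fun y => TotalSpace.mk' (EuclideanSpace ℝ (Fin n)) y (Y y)) x) :
    MDifferentiableAt (𝓡 n) 𝓘(ℝ, ℝ) (fun y => (inner ℝ (X y) (Y y) : ℝ)) x := by
  have : IsContMDiffRiemannianBundle (𝓡 n) 1 (EuclideanSpace ℝ (Fin n))
    (fun x : M => TangentSpace (𝓡 n) x) := IsContMDiffRiemannianBundle.of_le (n := ∞) (by simp)
  exact hX.inner_bundle hY

lemma SmoothAt.inner {X Y : Π x : M, TangentSpace (𝓡 n) x} {x : M} (hX : SmoothAt X x)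
    (hY : SmoothAt Y x) :
    ContMDiffAt (𝓡 n) 𝓘(ℝ, ℝ) ∞ (fun y => inner ℝ (X y) (Y y)) x :=
  ContMDiffAt.inner_bundle hX hY

/-- The Koszul expression, which equals `2 g(∇_X Y, Z)` for the Levi-Civita connection `∇`. -/
def koszulAux (X Y Z : Π x : M, TangentSpace (𝓡 n) x) (x : M) : ℝ :=
  mvfderiv (𝓡 n) (fun y => inner ℝ (Y y) (Z y)) x (X x)
    + mvfderiv (𝓡 n) (fun y => inner ℝ (X y) (Z y)) x (Y x)
    - mvfderiv (𝓡 n) (fun y => inner ℝ (X y) (Y y)) x (Z x)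
    + inner ℝ (mlieBracket (𝓡 n) X Y x) (Z x)
    - inner ℝ (mlieBracket (𝓡 n) X Z x) (Y x)
    - inner ℝ (mlieBracket (𝓡 n) Y Z x) (X x)

lemma contMDiffAt_koszulAux {X Y Z : Π x : M, TangentSpace (𝓡 n) x} {x : M} (hX : SmoothAt X x)
    (hY : SmoothAt Y x) (hZ : SmoothAt Z x) :
    ContMDiffAt (𝓡 n) 𝓘(ℝ, ℝ) ∞ (koszulAux X Y Z) x := by
  unfold koszulAux
  exact (((((contMDiffAt_dirDeriv (hY.inner hZ) hX).add
    (contMDiffAt_dirDeriv (hX.inner hZ) hY)).sub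
    (contMDiffAt_dirDeriv (hX.inner hY) hZ)).add ((hX.bracket hY).inner hZ)).sub
    ((hX.bracket hZ).inner hY)).sub ((hY.bracket hZ).inner hX)

lemma koszul_tensorial (X Y : VField n M) (x : M) :
    TensorialAt (𝓡 n) (EuclideanSpace ℝ (Fin n)) (fun Z => koszulAux X Y Z x) x where
  smul {f Z} hf hZ := by
    have hX := (X.smoothAt x).mdiff
    have hY := (Y.smoothAt x).mdiff
    have e1 := mvfderiv_fun_mul hf (mdiff_inner hY hZ)
    have e2 := mvfderiv_fun_mul hf (mdiff_inner hX hZ)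
    simp only [koszulAux, Pi.smul_apply', inner_smul_right, e1, e2,
      mlieBracket_smul_right hf hZ]
    simp [inner_add_left, inner_smul_left, real_inner_comm]
    ring
  add {Z Z'} hZ hZ' := by
    have hX := (X.smoothAt x).mdiff
    have hY := (Y.smoothAt x).mdiff
    have e1 := mvfderiv_fun_add (mdiff_inner hY hZ) (mdiff_inner hY hZ')
    have e2 := mvfderiv_fun_add (mdiff_inner hX hZ) (mdiff_inner hX hZ')
    simp only [koszulAux, Pi.add_apply, inner_add_right, e1, e2,
      mlieBracket_add_right hZ hZ']
    simp [inner_add_left]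
    ring

/-- The vector `∇_X Y` at `x`, dual to half the Koszul expression. -/
def lcVec (X Y : VField n M) (x : M) : TangentSpace (𝓡 n) x :=
  (1 / 2 : ℝ) • (InnerProductSpace.toDual ℝ (TangentSpace (𝓡 n) x)).symm
    (TensorialAt.mkHom (fun Z => koszulAux X Y Z x) x (koszul_tensorial X Y x))

lemma inner_lcVec (X Y : VField n M) {Z : Π x : M, TangentSpace (𝓡 n) x} {x : M}
    (hZ : SmoothAt Z x) : inner ℝ (lcVec X Y x) (Z x) = (1 / 2 : ℝ) * koszulAux X Y Z x := by
  rw [lcVec, inner_smul_left, InnerProductSpace.toDual_symm_apply,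
    TensorialAt.mkHom_apply (koszul_tensorial X Y x) hZ.mdiff]
  simp

/-- A tangent vector extends to a vector field that is smooth near the base point. -/
lemma exists_smoothAt (x : M) (v : TangentSpace (𝓡 n) x) :
    ∃ Z : Π x : M, TangentSpace (𝓡 n) x, SmoothAt Z x ∧ Z x = v :=
  ⟨FiberBundle.extend (EuclideanSpace ℝ (Fin n)) v, FiberBundle.contMDiffAt_extend _ _ v, by simp⟩

lemma eq_of_inner {x : M} {v w : TangentSpace (𝓡 n) x}
    (h : ∀ Z : Π x : M, TangentSpace (𝓡 n) x, SmoothAt Z x →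
      inner ℝ v (Z x) = inner ℝ w (Z x)) : v = w := by
  refine ext_inner_right ℝ fun u => ?_
  obtain ⟨Z, hZ, rfl⟩ := exists_smoothAt x u
  exact h Z hZ

lemma contMDiffAt_det {m : ℕ} {A : M → Matrix (Fin m) (Fin m) ℝ} {x : M}
    (hA : ∀ i j, ContMDiffAt (𝓡 n) 𝓘(ℝ, ℝ) ∞ (fun y => A y i j) x) :
    ContMDiffAt (𝓡 n) 𝓘(ℝ, ℝ) ∞ (fun y => (A y).det) x := by
  simp only [Matrix.det_apply']
  refine contMDiffAt_finsetSum fun σ _ => ?_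
  exact contMDiffAt_const.mul (contMDiffAt_finsetProd fun i _ => hA _ _)

lemma contMDiffAt_matrix_inv {m : ℕ} {A : M → Matrix (Fin m) (Fin m) ℝ} {x : M}
    (hA : ∀ i j, ContMDiffAt (𝓡 n) 𝓘(ℝ, ℝ) ∞ (fun y => A y i j) x) (h0 : (A x).det ≠ 0)
    (i j : Fin m) : ContMDiffAt (𝓡 n) 𝓘(ℝ, ℝ) ∞ (fun y => (A y)⁻¹ i j) x := by
  simp only [Matrix.inv_def, Matrix.smul_apply, Ring.inverse_eq_inv', smul_eq_mul,
    Matrix.adjugate_apply]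
  refine ((contMDiffAt_det hA).inv₀ h0).mul (contMDiffAt_det fun k l => ?_)
  by_cases hk : k = j
  · subst hk
    simpa using contMDiffAt_const
  · simpa [Matrix.updateRow_ne hk] using hA k l

/-- A vector field is smooth if its inner products with smooth local fields are. -/
lemma smoothAt_of_inner {V : Π x : M, TangentSpace (𝓡 n) x} {x : M}
    (h : ∀ Z : Π x : M, TangentSpace (𝓡 n) x, (∀ᶠ y in 𝓝 x, SmoothAt Z y) →
      ContMDiffAt (𝓡 n) 𝓘(ℝ, ℝ) ∞ (fun y => (inner ℝ (V y) (Z y) : ℝ)) x) : SmoothAt V x := by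
  let t := trivializationAt (EuclideanSpace ℝ (Fin n)) (TangentSpace (𝓡 n) : M → Type _) x
  let b := (EuclideanSpace.basisFun (Fin n) ℝ).toBasis
  have hx : x ∈ t.baseSet := FiberBundle.mem_baseSet_trivializationAt' x
  have hnhds : t.baseSet ∈ 𝓝 x := t.open_baseSet.mem_nhds hx
  let s : Fin n → Π x : M, TangentSpace (𝓡 n) x := fun i => t.localFrame b i
  have hs : ∀ i, ∀ y ∈ t.baseSet, SmoothAt (s i) y := fun i y hy =>
    contMDiffAt_localFrame_of_mem ∞ t b i hy
  let G : M → Matrix (Fin n) (Fin n) ℝ := fun y => Matrix.gram ℝ fun i => s i y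
  have hGdet : ∀ y ∈ t.baseSet, (G y).det ≠ 0 := fun y hy =>
    Matrix.det_gram_ne_zero_iff_linearIndependent.2
      ((t.isLocalFrameOn_localFrame_baseSet (𝓡 n) ∞ b).linearIndependent hy)
  have hG : ∀ i j, ContMDiffAt (𝓡 n) 𝓘(ℝ, ℝ) ∞ (fun y => G y i j) x := fun i j =>
    (hs i x hx).inner (hs j x hx)
  refine (contMDiffAt_iff_localFrameCoeff (e := t) b hx).2 fun i => ?_
  have key : (fun y => ∑ j, (inner ℝ (V y) (s j y) : ℝ) * (G y)⁻¹ j i) =ᶠ[𝓝 x]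
      LinearMap.piApply (t.localFrameCoeff (𝓡 n) b i) V := by
    filter_upwards [hnhds] with y hy
    let c : Fin n → ℝ := fun k => t.localFrameCoeff (𝓡 n) b k y (V y)
    have hV : V y = ∑ k, c k • s k y := t.eq_sum_localFrameCoeff_smul hy
    have h1 : ∀ j, (inner ℝ (V y) (s j y) : ℝ) = (Matrix.vecMul c (G y)) j := by
      intro j
      rw [hV, sum_inner]
      simp [Matrix.vecMul, dotProduct, G, Matrix.gram, inner_smul_left]
    have h2 : Matrix.vecMul (Matrix.vecMul c (G y)) (G y)⁻¹ = c := by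
      rw [Matrix.vecMul_vecMul, Matrix.mul_nonsing_inv _ (hGdet y hy).isUnit, Matrix.vecMul_one]
    simp only [h1]
    exact congrFun h2 i
  refine ContMDiffAt.congr_of_eventuallyEq ?_ key.symm
  exact contMDiffAt_finsetSum fun j _ => (h (s j) (by
    filter_upwards [hnhds] with y hy using hs j y hy)).mul
    (contMDiffAt_matrix_inv hG (hGdet x hx) j i)

lemma smoothAt_lcVec (X Y : VField n M) (x : M) : SmoothAt (lcVec X Y) x := by
  refine smoothAt_of_inner fun Z hZ => ?_
  have : (fun y => (1 / 2 : ℝ) * koszulAux X Y Z y) =ᶠ[𝓝 x]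
      fun y => (inner ℝ (lcVec X Y y) (Z y) : ℝ) := by
    filter_upwards [hZ] with y hy using (inner_lcVec X Y hy).symm
  refine ContMDiffAt.congr_of_eventuallyEq ?_ this.symm
  exact contMDiffAt_const.mul
    (contMDiffAt_koszulAux (X.smoothAt x) (Y.smoothAt x) hZ.self_of_nhds)

variable (n M) in
/-- The Levi-Civita connection, given by the Koszul formula. -/
def leviCivita : AffineConnection n M where
  toFun X Y := ⟨lcVec X Y, smoothAt_lcVec X Y⟩
  add_left X X' Y := by
    ext1 x
    refine eq_of_inner fun Z hZ => ?_
    have hX := (X.smoothAt x).mdiff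
    have hX' := (X'.smoothAt x).mdiff
    have hY := (Y.smoothAt x).mdiff
    have e1 := mvfderiv_fun_add (mdiff_inner hX hZ.mdiff) (mdiff_inner hX' hZ.mdiff)
    have e2 := mvfderiv_fun_add (mdiff_inner hX hY) (mdiff_inner hX' hY)
    have b1 := mlieBracket_add_left hX hX' (W := Y)
    have b2 := mlieBracket_add_left hX hX' (W := Z)
    change inner ℝ (lcVec (X + X') Y x) (Z x) = inner ℝ (lcVec X Y x + lcVec X' Y x) (Z x)
    rw [inner_add_left, inner_lcVec _ _ hZ, inner_lcVec _ _ hZ, inner_lcVec _ _ hZ]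
    simp only [koszulAux, ContMDiffSection.coe_add, Pi.add_apply, inner_add_left, inner_add_right,
      e1, e2, b1, b2, map_add, add_apply]
    ring
  smul_left f X Y := by
    ext1 x
    refine eq_of_inner fun Z hZ => ?_
    have hf : MDifferentiableAt (𝓡 n) 𝓘(ℝ, ℝ) f x := f.contMDiff.mdifferentiableAt (by simp)
    have hX := (X.smoothAt x).mdiff
    have hY := (Y.smoothAt x).mdiff
    have e1 := mvfderiv_fun_mul hf (mdiff_inner hX hZ.mdiff)
    have e2 := mvfderiv_fun_mul hf (mdiff_inner hX hY)
    have b1 := mlieBracket_smul_left hf hX (W := Y)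
    have b2 := mlieBracket_smul_left hf hX (W := Z)
    have hfm : (fmul f X : Π x : M, TangentSpace (𝓡 n) x) = fun y => f y • X y := rfl
    change inner ℝ (lcVec (fmul f X) Y x) (Z x) = inner ℝ (f x • lcVec X Y x) (Z x)
    rw [inner_smul_left, inner_lcVec _ _ hZ, inner_lcVec _ _ hZ]
    simp only [koszulAux, hfm, inner_smul_left, inner_smul_right, conj_trivial,
      e1, e2, map_smul, smul_eq_mul]
    erw [b1, b2]
    simp [inner_add_left, inner_smul_left, real_inner_comm]
    ring
  add_right X Y Y' := by
    ext1 x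
    refine eq_of_inner fun Z hZ => ?_
    have hX := (X.smoothAt x).mdiff
    have hY := (Y.smoothAt x).mdiff
    have hY' := (Y'.smoothAt x).mdiff
    have e1 := mvfderiv_fun_add (mdiff_inner hY hZ.mdiff) (mdiff_inner hY' hZ.mdiff)
    have e2 := mvfderiv_fun_add (mdiff_inner hX hY) (mdiff_inner hX hY')
    have b1 := mlieBracket_add_right hY hY' (V := X)
    have b2 := mlieBracket_add_left hY hY' (W := Z)
    change inner ℝ (lcVec X (Y + Y') x) (Z x) = inner ℝ (lcVec X Y x + lcVec X Y' x) (Z x)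
    rw [inner_add_left, inner_lcVec _ _ hZ, inner_lcVec _ _ hZ, inner_lcVec _ _ hZ]
    simp only [koszulAux, ContMDiffSection.coe_add, Pi.add_apply, inner_add_left, inner_add_right,
      e1, e2, b1, b2, map_add, add_apply]
    ring
  leibniz X f Y x := by
    refine eq_of_inner fun Z hZ => ?_
    have hf : MDifferentiableAt (𝓡 n) 𝓘(ℝ, ℝ) f x := f.contMDiff.mdifferentiableAt (by simp)
    have hX := (X.smoothAt x).mdiff
    have hY := (Y.smoothAt x).mdiff
    have e1 := mvfderiv_fun_mul hf (mdiff_inner hY hZ.mdiff)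
    have e2 := mvfderiv_fun_mul hf (mdiff_inner hX hY)
    have b1 := mlieBracket_smul_right hf hY (V := X)
    have b2 := mlieBracket_smul_left hf hY (W := Z)
    have hfm : (fmul f Y : Π x : M, TangentSpace (𝓡 n) x) = fun y => f y • Y y := rfl
    change inner ℝ (lcVec X (fmul f Y) x) (Z x) =
      inner ℝ (f x • lcVec X Y x + dirDeriv X f x • Y x) (Z x)
    rw [inner_add_left, inner_smul_left, inner_smul_left, inner_lcVec _ _ hZ, inner_lcVec _ _ hZ]
    simp only [koszulAux, hfm, inner_smul_left, inner_smul_right, conj_trivial,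
      e1, e2, map_smul, smul_eq_mul, dirDeriv]
    erw [b1, b2]
    simp [inner_add_left, inner_smul_left, real_inner_comm]
    ring

namespace AffineConnection

/-- `∇ g = 0`. -/
def IsMetric (D : AffineConnection n M) : Prop :=
  ∀ (X Y Z : VField n M) (x : M), dirDeriv X (fun y => inner ℝ (Y y) (Z y)) x =
    inner ℝ (D X Y x) (Z x) + inner ℝ (Y x) (D X Z x)

/-- The torsion tensor `T(X, Y) = ∇_X Y - ∇_Y X - [X, Y]`. -/
def torsion (D : AffineConnection n M) (X Y : VField n M) : VField n M :=
  D X Y - D Y X - bracket X Y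

/-- The curvature tensor `R(X, Y) Z = ∇_X ∇_Y Z - ∇_Y ∇_X Z - ∇_[X, Y] Z`. -/
def curvature (D : AffineConnection n M) (X Y Z : VField n M) : VField n M :=
  D X (D Y Z) - D Y (D X Z) - D (bracket X Y) Z

/-- `∇ T = 0` for the torsion tensor `T` of `∇`. -/
def HasParallelTorsion (D : AffineConnection n M) : Prop :=
  ∀ W X Y : VField n M,
    D W (D.torsion X Y) - D.torsion (D W X) Y - D.torsion X (D W Y) = 0

/-- `∇ R = 0` for the curvature tensor `R` of `∇`. -/
def HasParallelCurvature (D : AffineConnection n M) : Prop :=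
  ∀ W X Y Z : VField n M,
    D W (D.curvature X Y Z) - D.curvature (D W X) Y Z - D.curvature X (D W Y) Z
      - D.curvature X Y (D W Z) = 0

/-- An Ambrose-Singer connection on a (complete) Riemannian manifold: a metric connection with
parallel torsion and parallel curvature. -/
structure IsAmbroseSinger (D : AffineConnection n M) : Prop where
  isMetric : D.IsMetric
  parallel_torsion : D.HasParallelTorsion
  parallel_curvature : D.HasParallelCurvature

/-- `D = ∇ + τ / 2` for the alternating 3-form `τ`, where `∇` is the Levi-Civita connection. -/
def IsTorsionForm (D : AffineConnection n M)
    (τ : Π x : M, TangentSpace (𝓡 n) x [⋀^Fin 3]→ₗ[ℝ] ℝ) : Prop :=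
  ∀ (X Y Z : VField n M) (x : M), (inner ℝ (D X Y x) (Z x) : ℝ) =
    inner ℝ (leviCivita n M X Y x) (Z x) + τ x ![X x, Y x, Z x] / 2

end AffineConnection

/-- The Koszul connection is metric. -/
theorem leviCivita_isMetric : (leviCivita n M).IsMetric := by
  intro X Y Z x
  change _ = inner ℝ (lcVec X Y x) (Z x) + inner ℝ (Y x) (lcVec X Z x)
  rw [real_inner_comm (lcVec X Z x) (Y x), inner_lcVec _ _ (Z.smoothAt x),
    inner_lcVec _ _ (Y.smoothAt x)]
  have h1 := mlieBracket_swap_apply (I := 𝓡 n) (V := Z) (W := Y) (x := x)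
  simp only [koszulAux, dirDeriv, h1, inner_neg_left, real_inner_comm]
  ring

/-- The Koszul connection is torsion-free. -/
theorem leviCivita_torsion (X Y : VField n M) : (leviCivita n M).torsion X Y = 0 := by
  ext1 x
  refine eq_of_inner fun Z hZ => ?_
  change inner ℝ (lcVec X Y x - lcVec Y X x - mlieBracket (𝓡 n) X Y x) (Z x) = inner ℝ 0 (Z x)
  rw [inner_sub_left, inner_sub_left, inner_lcVec _ _ hZ, inner_lcVec _ _ hZ]
  have h1 := mlieBracket_swap_apply (I := 𝓡 n) (V := Y) (W := X) (x := x)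
  simp only [koszulAux, h1, inner_neg_left, real_inner_comm, inner_zero_left]
  ring

section VectorCrossProduct

variable {T : Type*} [NormedAddCommGroup T] [InnerProductSpace ℝ T] [FiniteDimensional ℝ T]

/-- The linear form `Z ↦ σ(X, Y, Z)`. -/
def lastForm (σ : T [⋀^Fin 3]→ₗ[ℝ] ℝ) (X Y : T) : T →ₗ[ℝ] ℝ where
  toFun Z := σ ![X, Y, Z]
  map_add' Z Z' := by
    have e : ∀ W : T, Function.update ![X, Y, 0] 2 W = ![X, Y, W] := fun W => by
      funext i; fin_cases i <;> rfl
    simpa only [e] using σ.map_update_add ![X, Y, 0] 2 Z Z'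
  map_smul' c Z := by
    have e : ∀ W : T, Function.update ![X, Y, 0] 2 W = ![X, Y, W] := fun W => by
      funext i; fin_cases i <;> rfl
    simpa only [e, RingHom.id_apply] using σ.map_update_smul ![X, Y, 0] 2 c Z

/-- The vector `σ_X Y`, determined by `g(σ_X Y, Z) = σ(X, Y, Z)`. -/
def contractVec (σ : T [⋀^Fin 3]→ₗ[ℝ] ℝ) (X Y : T) : T :=
  haveI : CompleteSpace T := FiniteDimensional.complete ℝ T
  (InnerProductSpace.toDual ℝ T).symm (lastForm σ X Y).toContinuousLinearMap

/-- The defining property of `σ_X Y`. -/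
theorem inner_contractVec (σ : T [⋀^Fin 3]→ₗ[ℝ] ℝ) (X Y Z : T) :
    (inner ℝ (contractVec σ X Y) Z : ℝ) = σ ![X, Y, Z] := by
  have : CompleteSpace T := FiniteDimensional.complete ℝ T
  rw [contractVec, InnerProductSpace.toDual_symm_apply]
  rfl

/-- The skew-symmetric endomorphism `σ_X` of the Euclidean space `T`. -/
def contract (σ : T [⋀^Fin 3]→ₗ[ℝ] ℝ) (X : T) : T →ₗ[ℝ] T where
  toFun Y := contractVec σ X Y
  map_add' Y Y' := by
    refine ext_inner_right ℝ fun Z => ?_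
    have e : ∀ W : T, Function.update ![X, 0, Z] 1 W = ![X, W, Z] := fun W => by
      funext i; fin_cases i <;> rfl
    rw [inner_add_left, inner_contractVec, inner_contractVec, inner_contractVec]
    simpa only [e] using σ.map_update_add ![X, 0, Z] 1 Y Y'
  map_smul' c Y := by
    refine ext_inner_right ℝ fun Z => ?_
    have e : ∀ W : T, Function.update ![X, 0, Z] 1 W = ![X, W, Z] := fun W => by
      funext i; fin_cases i <;> rfl
    rw [RingHom.id_apply, real_inner_smul_left, inner_contractVec, inner_contractVec]
    simpa only [e, smul_eq_mul] using σ.map_update_smul ![X, 0, Z] 1 c Y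

/-- A nonzero alternating 3-form `σ` on a Euclidean space `T` is a generalized vector cross product
if `σ_X` and `σ_Y` are conjugate in `O(T)` for all unit vectors `X` and `Y`. -/
def IsGeneralizedVectorCrossProduct (σ : T [⋀^Fin 3]→ₗ[ℝ] ℝ) : Prop :=
  σ ≠ 0 ∧ ∀ X Y : T, ‖X‖ = 1 → ‖Y‖ = 1 →
    ∃ A : T ≃ₗᵢ[ℝ] T, ∀ v : T, contract σ Y v = A (contract σ X (A.symm v))

end VectorCrossProduct

/-- `(M, g, D)` is a naturally reductive space (for a complete Riemannian manifold `(M, g)`) with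
torsion form `τ`: `D` is an Ambrose-Singer connection of the form `∇ + τ / 2`. -/
def IsNaturallyReductive (D : AffineConnection n M)
    (τ : Π x : M, TangentSpace (𝓡 n) x [⋀^Fin 3]→ₗ[ℝ] ℝ) : Prop :=
  D.IsAmbroseSinger ∧ D.IsTorsionForm τ

/-- `(M, g, D)` is a naturally reductive space whose torsion form is a generalized vector cross
product (on every tangent space). -/
def IsNaturallyReductiveGVCP (D : AffineConnection n M) : Prop :=
  ∃ τ : Π x : M, TangentSpace (𝓡 n) x [⋀^Fin 3]→ₗ[ℝ] ℝ,
    IsNaturallyReductive D τ ∧ ∀ x, IsGeneralizedVectorCrossProduct (τ x)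

variable (n M) in
/-- An almost Hermitian structure on `(M, g)`: a smooth field `J` of orthogonal endomorphisms of the
tangent spaces with `J ^ 2 = -1`. -/
structure AlmostHermitian where
  /-- The smooth endomorphism field `J`. -/
  J : ContMDiffSection (𝓡 n) (EuclideanSpace ℝ (Fin n) →L[ℝ] EuclideanSpace ℝ (Fin n)) ∞
    (fun x : M => TangentSpace (𝓡 n) x →L[ℝ] TangentSpace (𝓡 n) x)
  sq : ∀ (x : M) (v : TangentSpace (𝓡 n) x), J x (J x v) = -v
  isometry : ∀ (x : M) (v w : TangentSpace (𝓡 n) x),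
    (inner ℝ (J x v) (J x w) : ℝ) = inner ℝ v w

namespace AlmostHermitian

/-- The vector field `J X`. -/
def app (h : AlmostHermitian n M) (X : VField n M) : VField n M :=
  ⟨fun x => h.J x (X x), h.J.contMDiff.clm_bundle_apply X.contMDiff⟩

lemma app_add (h : AlmostHermitian n M) (X Y : VField n M) :
    h.app (X + Y) = h.app X + h.app Y := by
  ext1 x
  exact map_add (h.J x) (X x) (Y x)

lemma app_sub (h : AlmostHermitian n M) (X Y : VField n M) :
    h.app (X - Y) = h.app X - h.app Y := by
  ext1 x
  exact map_sub (h.J x) (X x) (Y x)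

lemma app_fmul (h : AlmostHermitian n M) (f : C^∞⟮𝓡 n, M; ℝ⟯) (X : VField n M) :
    h.app (fmul f X) = fmul f (h.app X) := by
  ext1 x
  exact map_smul (h.J x) (f x) (X x)

/-- `(∇_X J) Y = ∇_X (J Y) - J (∇_X Y)` for the Levi-Civita connection `∇`. -/
def nablaJ (h : AlmostHermitian n M) (X Y : VField n M) : VField n M :=
  leviCivita n M X (h.app Y) - h.app (leviCivita n M X Y)

/-- `(∇_X J) Y = -(∇_Y J) X` for all `X` and `Y`. -/
def IsNearlyKaehler (h : AlmostHermitian n M) : Prop :=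
  ∀ X Y : VField n M, h.nablaJ X Y = -h.nablaJ Y X

/-- `∇ J ≠ 0`. -/
def IsStrict (h : AlmostHermitian n M) : Prop :=
  ∃ X Y : VField n M, h.nablaJ X Y ≠ 0

/-- The canonical Hermitian connection `∇ - (1/2) J ∘ ∇ J`. -/
def canonicalConnection (h : AlmostHermitian n M) : AffineConnection n M where
  toFun X Y := leviCivita n M X Y - (1 / 2 : ℝ) • h.app (h.nablaJ X Y)
  add_left X X' Y := by
    simp only [nablaJ, AffineConnection.add_left, app_add, app_sub]
    module
  smul_left f X Y := by
    simp only [nablaJ, AffineConnection.smul_left, app_fmul, app_sub]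
    ext1 x
    simp only [fmul, ContMDiffSection.coe_sub, ContMDiffSection.coe_smul, Pi.sub_apply,
      Pi.smul_apply, ContMDiffSection.coeFn_mk]
    module
  add_right X Y Y' := by
    simp only [nablaJ, AffineConnection.add_right, app_add, app_sub]
    module
  leibniz X f Y x := by
    have h1 := (leviCivita n M).leibniz X f Y x
    have h2 := (leviCivita n M).leibniz X f (h.app Y) x
    have h3 : h.nablaJ X (fmul f Y) = fmul f (h.nablaJ X Y) := by
      ext1 y
      have h1 := (leviCivita n M).leibniz X f Y y
      have h2 := (leviCivita n M).leibniz X f (h.app Y) y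
      rw [nablaJ, app_fmul]
      change leviCivita n M X (fmul f (h.app Y)) y - h.J y (leviCivita n M X (fmul f Y) y)
        = f y • (leviCivita n M X (h.app Y) y - h.J y (leviCivita n M X Y y))
      rw [h1, h2, map_add, map_smul, map_smul]
      change f y • leviCivita n M X (h.app Y) y + dirDeriv X f y • h.J y (Y y) - _ = _
      module
    rw [h3, app_fmul]
    change leviCivita n M X (fmul f Y) x - (1 / 2 : ℝ) • (f x • h.app (h.nablaJ X Y) x)
      = f x • (leviCivita n M X Y x - (1 / 2 : ℝ) • h.app (h.nablaJ X Y) x) + dirDeriv X f x • Y x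
    rw [h1]
    module

/-- `(M, g, J)` is a naturally reductive strict nearly Kähler manifold (for a complete Riemannian
manifold `(M, g)`). -/
structure IsNaturallyReductiveStrictNK (h : AlmostHermitian n M) : Prop where
  nearlyKaehler : h.IsNearlyKaehler
  strict : h.IsStrict
  ambroseSinger : h.canonicalConnection.IsAmbroseSinger

end AlmostHermitian

variable (n M) in
/-- An orientation of the manifold `M`: an orientation of every tangent space such that every point
has a neighbourhood with a positively oriented frame of smooth vector fields. -/
structure ManifoldOrientation where
  /-- The orientation of the tangent space at a point. -/
  orientation : Π x : M, Orientation ℝ (TangentSpace (𝓡 n) x) (Fin n)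
  exists_frame : ∀ x₀ : M, ∃ X : Fin n → VField n M, ∀ᶠ x in 𝓝 x₀,
    ∃ b : Module.Basis (Fin n) ℝ (TangentSpace (𝓡 n) x),
      (∀ i, b i = X i x) ∧ b.orientation = orientation x

end

section

variable {M : Type*} [TopologicalSpace M] [ChartedSpace (EuclideanSpace ℝ (Fin 6)) M]
  [IsManifold (𝓡 6) ∞ M] [RiemannianBundle (fun x : M => TangentSpace (𝓡 6) x)]

/-- The orientation `o` is the one induced by the almost complex structure `J`: every basis of the
form `(u, J u, v, J v, w, J w)` of a tangent space is positively oriented. -/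
def AlmostHermitian.InducesOrientation (h : AlmostHermitian 6 M) (o : ManifoldOrientation 6 M) :
    Prop :=
  ∀ (x : M) (b : Module.Basis (Fin 6) ℝ (TangentSpace (𝓡 6) x)),
    b 1 = h.J x (b 0) → b 3 = h.J x (b 2) → b 5 = h.J x (b 4) → b.orientation = o.orientation x

end

end RiemGeom

end

set_option linter.unusedSimpArgs false

noncomputable section

namespace RiemGeom

/-! ### Three-forms compatible with an orthogonal complex structure. -/

section LinearAlgebra

variable {T : Type*} [NormedAddCommGroup T] [InnerProductSpace ℝ T] [FiniteDimensional ℝ T]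

/-! The point is that `J` is encoded in the torsion form. Say that an orthogonal complex structure
`J` is compatible with a 3-form `σ` if every `σ_X` is `J`-antilinear. In dimension six `σ` is then a
multiple of the real part of a complex volume form, so `|σ_X Y|² = p (|X|²|Y|² - ⟨X,Y⟩² - ⟨JX,Y⟩²)`
with a single constant `p`, called `scale`. If `σ ≠ 0`, the kernel of `σ_X` is spanned by `X` and
`JX` for `X ≠ 0`. Hence `σ` determines `J` up to sign (`IsCompatible.eq_or_eq_neg`), and the sign is
fixed by an orientation because the complex dimension three is odd. All `σ_X` with `X` a unit vector
look alike in adapted bases, so `σ` is a generalized vector cross product.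

The algebraic core is the converse, `exists_isCompatible`. Maximising `σ` over triples of unit
vectors gives a 3-dimensional subspace on which `σ` is a positive multiple `a` of the volume form.
For a generalized vector cross product the traces of `σ_X²` and `σ_X⁴` depend only on `|X|`. The
first, for `X` in this subspace, brings `σ` into a normal form with two further parameters; both
together then force the parameters of a complex volume form.

On the manifold, a nearly Kähler `J` gives the form `τ = -J∘∇J`, which is alternating and compatible
with `J` because `∇_X J` is skew and anticommutes with `J`. Parallel torsion makes the scale
constant (`IsNaturallyReductive.scale_eq`), so `∇J ≠ 0` somewhere implies `τ ≠ 0` everywhere.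
Conversely, given an orientation and a connection `D`, take at each point the compatible `J`
inducing the orientation. It is smooth (`smoothAt_of_oriented`), since it is locally, up to sign,
given by algebraic formulas in the torsion. It is `D`-parallel
(`IsNaturallyReductive.app_parallel`), since differentiating `T(X, JX) = 0` keeps it in the kernel
line. Then `∇J = J∘τ`, so `D` is the canonical connection of `J`. -/

lemma inner_contract (σ : T [⋀^Fin 3]→ₗ[ℝ] ℝ) (X Y Z : T) :
    (inner ℝ (contract σ X Y) Z : ℝ) = σ ![X, Y, Z] := inner_contractVec σ X Y Z

lemma alternating_swap_left (σ : T [⋀^Fin 3]→ₗ[ℝ] ℝ) (X Y Z : T) :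
    σ ![Y, X, Z] = -σ ![X, Y, Z] := by
  have h := σ.map_swap ![X, Y, Z] (i := 0) (j := 1) (by decide)
  rw [← h]
  congr 1
  funext i
  fin_cases i <;> rfl

lemma alternating_swap_right (σ : T [⋀^Fin 3]→ₗ[ℝ] ℝ) (X Y Z : T) :
    σ ![X, Z, Y] = -σ ![X, Y, Z] := by
  have h := σ.map_swap ![X, Y, Z] (i := 1) (j := 2) (by decide)
  rw [← h]
  congr 1
  funext i
  fin_cases i <;> rfl

lemma alternating_rotate (σ : T [⋀^Fin 3]→ₗ[ℝ] ℝ) (X Y Z : T) :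
    σ ![Y, Z, X] = σ ![X, Y, Z] := by
  rw [alternating_swap_right, alternating_swap_left, neg_neg]

lemma contract_swap (σ : T [⋀^Fin 3]→ₗ[ℝ] ℝ) (X Y : T) :
    contract σ Y X = -contract σ X Y := by
  refine ext_inner_right ℝ fun Z => ?_
  rw [inner_neg_left, inner_contract, inner_contract, alternating_swap_left]

lemma contract_self (σ : T [⋀^Fin 3]→ₗ[ℝ] ℝ) (X : T) : contract σ X X = 0 := by
  have h : (2 : ℝ) • contract σ X X = 0 := by
    rw [two_smul]
    exact add_eq_zero_iff_eq_neg.2 (contract_swap σ X X)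
  exact (smul_eq_zero.1 h).resolve_left two_ne_zero

lemma inner_contract' (σ : T [⋀^Fin 3]→ₗ[ℝ] ℝ) (X Y Z : T) :
    (inner ℝ Z (contract σ X Y) : ℝ) = σ ![X, Y, Z] := by
  rw [real_inner_comm, inner_contract]

lemma alternating_self_left (σ : T [⋀^Fin 3]→ₗ[ℝ] ℝ) (X Y : T) : σ ![X, X, Y] = 0 := by
  rw [← inner_contract, contract_self, inner_zero_left]

lemma alternating_self_outer (σ : T [⋀^Fin 3]→ₗ[ℝ] ℝ) (X Y : T) : σ ![X, Y, X] = 0 := by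
  rw [alternating_rotate, alternating_self_left]

lemma alternating_self_right (σ : T [⋀^Fin 3]→ₗ[ℝ] ℝ) (X Y : T) : σ ![X, Y, Y] = 0 := by
  rw [alternating_rotate, alternating_self_outer]

lemma contract_add_left (σ : T [⋀^Fin 3]→ₗ[ℝ] ℝ) (X X' Y : T) :
    contract σ (X + X') Y = contract σ X Y + contract σ X' Y := by
  rw [contract_swap σ Y, map_add, neg_add, contract_swap σ Y X, contract_swap σ Y X']

lemma contract_smul_left (σ : T [⋀^Fin 3]→ₗ[ℝ] ℝ) (c : ℝ) (X Y : T) :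
    contract σ (c • X) Y = c • contract σ X Y := by
  rw [contract_swap σ Y, map_smul, contract_swap σ X Y, smul_neg, neg_neg]

lemma contract_zero_left (σ : T [⋀^Fin 3]→ₗ[ℝ] ℝ) (Y : T) : contract σ 0 Y = 0 := by
  simpa using contract_smul_left σ 0 0 Y

lemma inner_contract_skew (σ : T [⋀^Fin 3]→ₗ[ℝ] ℝ) (X Y Z : T) :
    (inner ℝ (contract σ X Y) Z : ℝ) = -inner ℝ Y (contract σ X Z) := by
  rw [real_inner_comm _ Y, inner_contract, inner_contract, alternating_swap_right]

lemma eq_zero_of_contract (σ : T [⋀^Fin 3]→ₗ[ℝ] ℝ) (h : ∀ X Y, contract σ X Y = 0) : σ = 0 := by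
  ext v
  have e : v = ![v 0, v 1, v 2] := by
    funext i
    fin_cases i <;> rfl
  rw [e, ← inner_contract, h, inner_zero_left]
  rfl

lemma exists_contract_ne_zero {σ : T [⋀^Fin 3]→ₗ[ℝ] ℝ} (h : σ ≠ 0) :
    ∃ X Y, contract σ X Y ≠ 0 := by
  by_contra! hc
  exact h (eq_zero_of_contract σ hc)

lemma inner_fin_six {b : Fin 6 → T} (hb : Orthonormal ℝ b) (c d : Fin 6 → ℝ) :
    (inner ℝ (∑ i, c i • b i) (∑ i, d i • b i) : ℝ) = ∑ i, c i * d i := by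
  simpa [mul_comm] using hb.inner_sum c d Finset.univ

/-- Orthogonal complex structures on a Euclidean space. -/
structure IsOrthComplex (J : T →ₗ[ℝ] T) : Prop where
  sq : ∀ v, J (J v) = -v
  isometry : ∀ v w, (inner ℝ (J v) (J w) : ℝ) = inner ℝ v w

namespace IsOrthComplex

variable {J : T →ₗ[ℝ] T}

lemma inner_left (h : IsOrthComplex J) (v w : T) :
    (inner ℝ (J v) w : ℝ) = -inner ℝ v (J w) := by
  rw [← h.isometry v (J w), h.sq, inner_neg_right, neg_neg]

lemma inner_self (h : IsOrthComplex J) (v : T) : (inner ℝ (J v) v : ℝ) = 0 := by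
  have := h.inner_left v v
  rw [real_inner_comm] at this
  rw [real_inner_comm]
  linarith

lemma norm_eq (h : IsOrthComplex J) (v : T) : ‖J v‖ = ‖v‖ := by
  have := h.isometry v v
  rw [real_inner_self_eq_norm_sq, real_inner_self_eq_norm_sq] at this
  exact (sq_eq_sq₀ (norm_nonneg _) (norm_nonneg _)).1 this

end IsOrthComplex

/-- The six vectors `u, J u, v, J v, w, J w`. -/
def adaptedVec (J : T →ₗ[ℝ] T) (u v w : T) : Fin 6 → T := ![u, J u, v, J v, w, J w]

lemma orthonormal_adaptedVec {J : T →ₗ[ℝ] T} (h : IsOrthComplex J) {u v w : T} (hu : ‖u‖ = 1)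
    (hv : ‖v‖ = 1) (hw : ‖w‖ = 1) (huv : (inner ℝ u v : ℝ) = 0) (hJuv : (inner ℝ (J u) v : ℝ) = 0)
    (huw : (inner ℝ u w : ℝ) = 0) (hJuw : (inner ℝ (J u) w : ℝ) = 0)
    (hvw : (inner ℝ v w : ℝ) = 0) (hJvw : (inner ℝ (J v) w : ℝ) = 0) :
    Orthonormal ℝ (adaptedVec J u v w) := by
  have e1 := h.inner_left u v
  have e2 := h.inner_left u w
  have e3 := h.inner_left v w
  have s : ∀ x, (inner ℝ x (J x) : ℝ) = 0 := fun x => by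
    rw [real_inner_comm, h.inner_self]
  have c : ∀ x y : T, (inner ℝ x y : ℝ) = 0 → (inner ℝ y x : ℝ) = 0 := fun x y hxy => by
    rw [real_inner_comm, hxy]
  refine ⟨fun i => ?_, fun i j hij => ?_⟩
  · fin_cases i <;> simp [adaptedVec, h.norm_eq, hu, hv, hw]
  · have e1' : (inner ℝ u (J v) : ℝ) = 0 := by linarith
    have e2' : (inner ℝ u (J w) : ℝ) = 0 := by linarith
    have e3' : (inner ℝ v (J w) : ℝ) = 0 := by linarith
    fin_cases i <;> fin_cases j <;>
      first
      | exact absurd rfl hij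
      | simp [adaptedVec, h.isometry, h.inner_self, *]

/-- A vector orthogonal to fewer vectors than the dimension. -/
lemma exists_unit_orthogonal {k : ℕ} (f : Fin k → T) (hk : k < Module.finrank ℝ T) :
    ∃ v : T, ‖v‖ = 1 ∧ ∀ i, (inner ℝ (f i) v : ℝ) = 0 := by
  have hlt : Module.finrank ℝ (Submodule.span ℝ (Set.range f)) < Module.finrank ℝ T :=
    lt_of_le_of_lt ((finrank_range_le_card f).trans (by simp)) hk
  have hne : (Submodule.span ℝ (Set.range f))ᗮ ≠ ⊥ := by
    intro h0
    have := Submodule.finrank_add_finrank_orthogonal (Submodule.span ℝ (Set.range f))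
    rw [h0, finrank_bot] at this
    omega
  obtain ⟨v, hv, hv0⟩ := Submodule.exists_mem_ne_zero_of_ne_bot hne
  refine ⟨(‖v‖⁻¹ : ℝ) • v, ?_, fun i => ?_⟩
  · rw [norm_smul, norm_inv, norm_norm, inv_mul_cancel₀ (norm_ne_zero_iff.2 hv0)]
  · rw [inner_smul_right, hv _ (Submodule.subset_span ⟨i, rfl⟩), mul_zero]

/-- The real part of a complex volume form: orthogonal complex structures `J` for which the
endomorphisms `σ_X` are antilinear. -/
structure IsCompatible (σ : T [⋀^Fin 3]→ₗ[ℝ] ℝ) (J : T →ₗ[ℝ] T) : Prop extends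
    IsOrthComplex J where
  anti : ∀ X Y, contract σ X (J Y) = -J (contract σ X Y)

namespace IsCompatible

variable {σ : T [⋀^Fin 3]→ₗ[ℝ] ℝ} {J : T →ₗ[ℝ] T}

lemma anti_left (h : IsCompatible σ J) (X Y : T) : contract σ (J X) Y = -J (contract σ X Y) := by
  rw [contract_swap σ Y (J X), h.anti, contract_swap σ X Y, map_neg, neg_neg]

lemma contract_J_self (h : IsCompatible σ J) (X : T) : contract σ X (J X) = 0 := by
  rw [h.anti, contract_self, map_zero, neg_zero]

lemma inner_contract_left (h : IsCompatible σ J) (X Y : T) :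
    (inner ℝ X (contract σ X Y) : ℝ) = 0 ∧ (inner ℝ (J X) (contract σ X Y) : ℝ) = 0 := by
  constructor
  · rw [real_inner_comm, inner_contract_skew, contract_self, inner_zero_right, neg_zero]
  · rw [real_inner_comm, inner_contract_skew, h.contract_J_self, inner_zero_right, neg_zero]

lemma inner_contract_right (h : IsCompatible σ J) (X Y : T) :
    (inner ℝ Y (contract σ X Y) : ℝ) = 0 ∧ (inner ℝ (J Y) (contract σ X Y) : ℝ) = 0 := by
  have := h.inner_contract_left Y X
  rw [contract_swap σ X Y, inner_neg_right, inner_neg_right] at this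
  exact ⟨neg_eq_zero.1 this.1, neg_eq_zero.1 this.2⟩

/-- By antilinearity `σ_x y` is orthogonal to `x, Jx, y, Jy`, which leaves only the complex line of
the third vector. Alternation and moving `J` between slots express all three products through `α =
σ(u,v,w)` and `β = σ(u,v,Jw)`. -/
lemma contract_table (h : IsCompatible σ J) (b : OrthonormalBasis (Fin 6) ℝ T) {u v w : T}
    (hb : ⇑b = adaptedVec J u v w) :
    ∃ α β : ℝ, contract σ u v = α • w + β • J w ∧ contract σ u w = -(α • v + β • J v) ∧
      contract σ v w = α • u + β • J u := by
  have key : ∀ x, (inner ℝ u x : ℝ) • u + (inner ℝ (J u) x : ℝ) • J u + (inner ℝ v x : ℝ) • v +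
      (inner ℝ (J v) x : ℝ) • J v + (inner ℝ w x : ℝ) • w + (inner ℝ (J w) x : ℝ) • J w = x := by
    intro x
    have := b.sum_repr' x
    simpa [hb, Fin.sum_univ_six, adaptedVec] using this
  have k1 := key (contract σ u v)
  have k2 := key (contract σ u w)
  have k3 := key (contract σ v w)
  rw [(h.inner_contract_left u v).1, (h.inner_contract_left u v).2,
    (h.inner_contract_right u v).1, (h.inner_contract_right u v).2] at k1
  rw [(h.inner_contract_left u w).1, (h.inner_contract_left u w).2,
    (h.inner_contract_right u w).1, (h.inner_contract_right u w).2] at k2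
  rw [(h.inner_contract_left v w).1, (h.inner_contract_left v w).2,
    (h.inner_contract_right v w).1, (h.inner_contract_right v w).2] at k3
  have s1 : ∀ x y z : T, (inner ℝ x (contract σ y z) : ℝ) = σ ![y, z, x] := fun x y z => by
    rw [real_inner_comm, inner_contract]
  have m : ∀ x y z, σ ![x, J y, z] = σ ![x, y, J z] := fun x y z => by
    rw [← inner_contract, ← inner_contract, h.anti, inner_neg_left, h.inner_left, neg_neg]
  refine ⟨σ ![u, v, w], σ ![u, v, J w], ?_, ?_, ?_⟩
  · rw [← k1]
    simp [s1]
  · rw [← k2]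
    simp only [s1]
    rw [alternating_swap_right σ u v w, alternating_swap_right σ u (J v) w, m u v w]
    module
  · rw [← k3]
    simp only [s1]
    rw [alternating_rotate σ u v w, alternating_rotate σ (J u) v w, alternating_swap_left σ v (J u),
      m v u w, alternating_swap_left σ u v]
    module

/-- This is the Lagrange identity for the cross product on `ℂ³`: the last two squares add up to the
squared modulus of the Hermitian product of `X` and `Y`. -/
lemma norm_contract_sq_of_basis (h : IsCompatible σ J) (b : OrthonormalBasis (Fin 6) ℝ T) {u v w : T}
    (hb : ⇑b = adaptedVec J u v w) {α β : ℝ} (h1 : contract σ u v = α • w + β • J w)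
    (h2 : contract σ u w = -(α • v + β • J v)) (h3 : contract σ v w = α • u + β • J u) (X Y : T) :
    ‖contract σ X Y‖ ^ 2 = (α ^ 2 + β ^ 2) *
      (‖X‖ ^ 2 * ‖Y‖ ^ 2 - (inner ℝ X Y : ℝ) ^ 2 - (inner ℝ (J X) Y : ℝ) ^ 2) := by
  obtain ⟨x, hx⟩ : ∃ x : Fin 6 → ℝ, ∑ i, x i • b i = X := ⟨_, b.sum_repr' X⟩
  obtain ⟨y, hy⟩ : ∃ y : Fin 6 → ℝ, ∑ i, y i • b i = Y := ⟨_, b.sum_repr' Y⟩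
  have hJ : J X = ∑ i, (![-x 1, x 0, -x 3, x 2, -x 5, x 4] : Fin 6 → ℝ) i • b i := by
    rw [← hx]
    simp only [hb, adaptedVec, Fin.sum_univ_six, map_add, map_smul, h.sq, Matrix.cons_val]
    module
  -- With complex coordinates `x₀ + i x₁, x₂ + i x₃, x₄ + i x₅`, the entries are those of `(α + iβ)`
  -- times the conjugate of the complex cross product.
  have hc : contract σ X Y = ∑ i, (![
      α * (x 2 * y 4 - x 4 * y 2 - x 3 * y 5 + x 5 * y 3)
        + β * (x 2 * y 5 - x 5 * y 2 + x 3 * y 4 - x 4 * y 3),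
      β * (x 2 * y 4 - x 4 * y 2 - x 3 * y 5 + x 5 * y 3)
        - α * (x 2 * y 5 - x 5 * y 2 + x 3 * y 4 - x 4 * y 3),
      α * (x 4 * y 0 - x 0 * y 4 - x 5 * y 1 + x 1 * y 5)
        + β * (x 4 * y 1 - x 1 * y 4 + x 5 * y 0 - x 0 * y 5),
      β * (x 4 * y 0 - x 0 * y 4 - x 5 * y 1 + x 1 * y 5)
        - α * (x 4 * y 1 - x 1 * y 4 + x 5 * y 0 - x 0 * y 5),
      α * (x 0 * y 2 - x 2 * y 0 - x 1 * y 3 + x 3 * y 1)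
        + β * (x 0 * y 3 - x 3 * y 0 + x 1 * y 2 - x 2 * y 1),
      β * (x 0 * y 2 - x 2 * y 0 - x 1 * y 3 + x 3 * y 1)
        - α * (x 0 * y 3 - x 3 * y 0 + x 1 * y 2 - x 2 * y 1)] : Fin 6 → ℝ) i • b i := by
    rw [← hx, ← hy]
    simp only [hb, adaptedVec, Fin.sum_univ_six, map_add, map_smul, h.sq, Matrix.cons_val,
      contract_add_left, contract_smul_left, h.anti, h.anti_left, contract_self,
      contract_swap σ u v, contract_swap σ u w, contract_swap σ v w, h1, h2, h3, map_neg,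
      map_zero]
    module
  rw [← real_inner_self_eq_norm_sq, ← real_inner_self_eq_norm_sq, ← real_inner_self_eq_norm_sq,
    hc, hJ, ← hx, ← hy]
  simp only [inner_fin_six b.orthonormal]
  simp only [Fin.sum_univ_six, Matrix.cons_val]
  ring

variable [Fact (Module.finrank ℝ T = 6)]

lemma exists_adapted_basis {J : T →ₗ[ℝ] T} (h : IsOrthComplex J) {u v w : T} (hu : ‖u‖ = 1)
    (hv : ‖v‖ = 1) (hw : ‖w‖ = 1) (huv : (inner ℝ u v : ℝ) = 0) (hJuv : (inner ℝ (J u) v : ℝ) = 0)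
    (huw : (inner ℝ u w : ℝ) = 0) (hJuw : (inner ℝ (J u) w : ℝ) = 0)
    (hvw : (inner ℝ v w : ℝ) = 0) (hJvw : (inner ℝ (J v) w : ℝ) = 0) :
    ∃ b : OrthonormalBasis (Fin 6) ℝ T, ⇑b = adaptedVec J u v w := by
  have ho := orthonormal_adaptedVec h hu hv hw huv hJuv huw hJuw hvw hJvw
  have hcard : Fintype.card (Fin 6) = Module.finrank ℝ T := by
    simp [(Fact.out : Module.finrank ℝ T = 6)]
  refine ⟨OrthonormalBasis.mk ho ?_, OrthonormalBasis.coe_mk _ _⟩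
  exact (LinearIndependent.span_eq_top_of_card_eq_finrank' ho.linearIndependent hcard).ge

lemma exists_adapted_basis' {J : T →ₗ[ℝ] T} (h : IsOrthComplex J) :
    ∃ (b : OrthonormalBasis (Fin 6) ℝ T) (u v w : T), ⇑b = adaptedVec J u v w := by
  have h6 : Module.finrank ℝ T = 6 := Fact.out
  obtain ⟨u, hu, -⟩ := exists_unit_orthogonal (T := T) (k := 0) ![] (by omega)
  obtain ⟨v, hv, hv'⟩ := exists_unit_orthogonal ![u, J u] (by omega)
  obtain ⟨w, hw, hw'⟩ := exists_unit_orthogonal ![u, J u, v, J v] (by omega)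
  obtain ⟨b, hb⟩ := exists_adapted_basis h hu hv hw (hv' 0) (hv' 1) (hw' 0) (hw' 1) (hw' 2) (hw' 3)
  exact ⟨b, u, v, w, hb⟩

/-- The norm of `σ_X Y` for a form of type `(3, 0) + (0, 3)`. -/
theorem exists_norm_contract_sq (h : IsCompatible σ J) :
    ∃ p : ℝ, 0 ≤ p ∧ ∀ X Y, ‖contract σ X Y‖ ^ 2 =
      p * (‖X‖ ^ 2 * ‖Y‖ ^ 2 - (inner ℝ X Y : ℝ) ^ 2 - (inner ℝ (J X) Y : ℝ) ^ 2) := by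
  obtain ⟨b, u, v, w, hb⟩ := exists_adapted_basis' h.toIsOrthComplex
  obtain ⟨α, β, h1, h2, h3⟩ := h.contract_table b hb
  exact ⟨α ^ 2 + β ^ 2, by positivity, fun X Y => h.norm_contract_sq_of_basis b hb h1 h2 h3 X Y⟩

/-- The scale of a compatible form. -/
def scale (h : IsCompatible σ J) : ℝ := h.exists_norm_contract_sq.choose

lemma scale_nonneg (h : IsCompatible σ J) : 0 ≤ h.scale := h.exists_norm_contract_sq.choose_spec.1

lemma norm_contract_sq (h : IsCompatible σ J) (X Y : T) : ‖contract σ X Y‖ ^ 2 = h.scale *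
    (‖X‖ ^ 2 * ‖Y‖ ^ 2 - (inner ℝ X Y : ℝ) ^ 2 - (inner ℝ (J X) Y : ℝ) ^ 2) :=
  h.exists_norm_contract_sq.choose_spec.2 X Y

lemma scale_pos (h : IsCompatible σ J) (h0 : σ ≠ 0) : 0 < h.scale := by
  refine h.scale_nonneg.lt_of_ne fun hs => ?_
  obtain ⟨X, Y, hXY⟩ := exists_contract_ne_zero h0
  have := h.norm_contract_sq X Y
  rw [← hs, zero_mul] at this
  exact hXY (norm_eq_zero.1 (pow_eq_zero_iff two_ne_zero |>.1 this))

/-- The polarisation of `norm_contract_sq` in the second variable. -/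
lemma inner_contract_contract (h : IsCompatible σ J) (X Y Z : T) :
    (inner ℝ (contract σ X Y) (contract σ X Z) : ℝ) = h.scale *
      (‖X‖ ^ 2 * inner ℝ Y Z - inner ℝ X Y * inner ℝ X Z - inner ℝ (J X) Y * inner ℝ (J X) Z) := by
  have e1 := h.norm_contract_sq X (Y + Z)
  have e2 := h.norm_contract_sq X Y
  have e3 := h.norm_contract_sq X Z
  rw [map_add, norm_add_sq_real, norm_add_sq_real, inner_add_right, inner_add_right, e2, e3] at e1
  linear_combination e1 / 2

/-- The square of `σ_X`. -/
lemma contract_contract (h : IsCompatible σ J) (X Z : T) :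
    contract σ X (contract σ X Z) = -(h.scale • (‖X‖ ^ 2 • Z - (inner ℝ X Z : ℝ) • X
      - (inner ℝ (J X) Z : ℝ) • J X)) := by
  refine ext_inner_right ℝ fun Y => ?_
  rw [inner_contract_skew, h.inner_contract_contract]
  simp only [inner_neg_left, inner_smul_left, inner_sub_left, conj_trivial]

/-- The kernel of `σ_X` is spanned by `X` and `J X`. -/
lemma ker_contract (h : IsCompatible σ J) (h0 : σ ≠ 0) {X Z : T} (hXZ : contract σ X Z = 0) :
    ‖X‖ ^ 2 • Z = (inner ℝ X Z : ℝ) • X + (inner ℝ (J X) Z : ℝ) • J X := by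
  have e := h.contract_contract X Z
  rw [hXZ, map_zero, zero_eq_neg, smul_eq_zero] at e
  have := e.resolve_left (h.scale_pos h0).ne'
  rw [sub_sub, sub_eq_zero] at this
  exact this

lemma eq_zero_of_contract_eq_zero (h : IsCompatible σ J) (h0 : σ ≠ 0) {X Z : T}
    (hXZ : contract σ X Z = 0) (hX : X ≠ 0) (h1 : (inner ℝ X Z : ℝ) = 0)
    (h2 : (inner ℝ (J X) Z : ℝ) = 0) : Z = 0 := by
  have := h.ker_contract h0 hXZ
  rw [h1, h2, zero_smul, zero_smul, add_zero, smul_eq_zero] at this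
  exact this.resolve_left (pow_ne_zero 2 (norm_ne_zero_iff.2 hX))

/-- A unit vector extends to a basis in which the form `σ` is in normal form. -/
lemma exists_normal_basis (h : IsCompatible σ J) (h0 : σ ≠ 0) {u : T} (hu : ‖u‖ = 1) :
    ∃ (b : OrthonormalBasis (Fin 6) ℝ T) (v w : T), ⇑b = adaptedVec J u v w ∧
      contract σ u v = √h.scale • w ∧ contract σ u w = -(√h.scale • v) := by
  have h6 : Module.finrank ℝ T = 6 := Fact.out
  have hp := h.scale_pos h0
  have hs : √h.scale ≠ 0 := (Real.sqrt_pos.2 hp).ne'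
  have hs2 : √h.scale * √h.scale = h.scale := Real.mul_self_sqrt hp.le
  obtain ⟨v, hv, hv'⟩ := exists_unit_orthogonal ![u, J u] (by omega)
  have huv : (inner ℝ u v : ℝ) = 0 := hv' 0
  have hJuv : (inner ℝ (J u) v : ℝ) = 0 := hv' 1
  have hn := h.norm_contract_sq u v
  rw [hu, hv, huv, hJuv] at hn
  have hn' : ‖contract σ u v‖ = √h.scale := by
    rw [← Real.sqrt_sq (norm_nonneg _), hn]
    norm_num
  have hl := h.inner_contract_left u v
  have hr := h.inner_contract_right u v
  -- The third vector is `σ_u v` normalised; its norm is `√scale` because `v` is a unit vector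
  -- orthogonal to `u` and `Ju`. The value of `σ_u w` then follows from the formula for `σ_u²`.
  obtain ⟨b, hb⟩ := exists_adapted_basis h.toIsOrthComplex (u := u) (v := v)
    (w := (√h.scale)⁻¹ • contract σ u v) hu hv
    (by rw [norm_smul, hn', norm_inv, Real.norm_of_nonneg (Real.sqrt_nonneg _), inv_mul_cancel₀ hs])
    huv hJuv
    (by rw [inner_smul_right, hl.1, mul_zero]) (by rw [inner_smul_right, hl.2, mul_zero])
    (by rw [inner_smul_right, hr.1, mul_zero]) (by rw [inner_smul_right, hr.2, mul_zero])
  refine ⟨b, v, _, hb, by rw [smul_inv_smul₀ hs], ?_⟩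
  rw [map_smul, h.contract_contract, huv, hJuv, hu, smul_neg, smul_smul]
  congr 1
  simp only [one_pow, one_smul, zero_smul, sub_zero]
  congr 1
  field_simp
  rw [pow_two, hs2]

/-- A nonzero form of type `(3, 0) + (0, 3)` in dimension six is a generalized vector cross
product. -/
theorem isGeneralizedVectorCrossProduct (h : IsCompatible σ J) (h0 : σ ≠ 0) :
    IsGeneralizedVectorCrossProduct σ := by
  refine ⟨h0, fun X Y hX hY => ?_⟩
  obtain ⟨b, v, w, hb, h1, h2⟩ := h.exists_normal_basis h0 hX
  obtain ⟨b', v', w', hb', h1', h2'⟩ := h.exists_normal_basis h0 hY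
  -- In normal bases starting with `X` and with `Y` the two contractions have the same matrix, so
  -- the isometry matching the bases conjugates them.
  refine ⟨b.equiv b' (Equiv.refl _), ?_⟩
  set A := b.equiv b' (Equiv.refl _) with hA
  have hAb : ∀ i, A (b i) = b' i := fun i => by simp [hA]
  have a0 : A X = Y := by simpa [hb, hb', adaptedVec] using hAb 0
  have a1 : A (J X) = J Y := by simpa [hb, hb', adaptedVec] using hAb 1
  have a2 : A v = v' := by simpa [hb, hb', adaptedVec] using hAb 2
  have a3 : A (J v) = J v' := by simpa [hb, hb', adaptedVec] using hAb 3
  have a4 : A w = w' := by simpa [hb, hb', adaptedVec] using hAb 4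
  have a5 : A (J w) = J w' := by simpa [hb, hb', adaptedVec] using hAb 5
  have key : (contract σ Y) ∘ₗ A.toLinearEquiv.toLinearMap =
      A.toLinearEquiv.toLinearMap ∘ₗ contract σ X := by
    refine b.toBasis.ext fun i => ?_
    rw [b.coe_toBasis, hb]
    simp only [LinearMap.comp_apply]
    fin_cases i <;>
      simp [adaptedVec, a0, a1, a2, a3, a4, a5, contract_self, h.contract_J_self, h1, h2, h1', h2',
        h.anti]
  intro x
  have := LinearMap.congr_fun key (A.symm x)
  simpa using this

/-- Compatible complex structures are unique up to sign. -/
theorem eq_or_eq_neg {J' : T →ₗ[ℝ] T} (h : IsCompatible σ J) (h' : IsCompatible σ J')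
    (h0 : σ ≠ 0) : J' = J ∨ J' = -J := by
  have key : ∀ X, J' X = J X ∨ J' X = -J X := by
    intro X
    by_cases hX : X = 0
    · simp [hX]
    -- `J'X` lies in the kernel of `σ_X`, the span of `X` and `JX`. It is orthogonal to `X` and has
    -- the norm of `JX`, so it is `± JX`.
    have e := h.ker_contract h0 (h'.contract_J_self X)
    have hx : (‖X‖ ^ 2 : ℝ) ≠ 0 := pow_ne_zero 2 (norm_ne_zero_iff.2 hX)
    rw [real_inner_comm, h'.inner_self, zero_smul, zero_add] at e
    have e2 := congrArg (fun z => ‖z‖) e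
    simp only [norm_smul, h.norm_eq, h'.norm_eq] at e2
    have e3 : ‖(‖X‖ ^ 2 : ℝ)‖ = ‖(inner ℝ (J X) (J' X) : ℝ)‖ :=
      mul_right_cancel₀ (norm_ne_zero_iff.2 hX) e2
    rw [Real.norm_eq_abs, Real.norm_eq_abs, abs_eq_abs] at e3
    rcases e3 with e3 | e3
    · left
      rw [← e3] at e
      exact smul_right_injective T hx e
    · right
      rw [eq_comm, neg_eq_iff_eq_neg] at e3
      rw [e3, neg_smul, ← smul_neg] at e
      exact smul_right_injective T hx e
  -- The sign cannot vary with the vector: for `x` with sign minus only and `y` with sign plus only,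
  -- either sign at `x + y` contradicts linearity.
  by_contra! hc
  obtain ⟨x, hx⟩ := DFunLike.ne_iff.1 hc.1
  obtain ⟨y, hy⟩ := DFunLike.ne_iff.1 hc.2
  have hx' := (key x).resolve_left hx
  have hy' := (key y).resolve_right hy
  have hj : ∀ z, J z = 0 → z = 0 := fun z hz => by
    have := h.sq z
    rwa [hz, map_zero, eq_comm, neg_eq_zero] at this
  rcases key (x + y) with e | e
  · rw [map_add, map_add, hx', hy', add_left_inj] at e
    exact hx (by rw [hx', e])
  · rw [map_add, map_add, hx', hy', neg_add, add_right_inj] at e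
    exact hy (by rw [hy', e, LinearMap.neg_apply, ← e])

end IsCompatible
end LinearAlgebra

/-! ### Generalized vector cross products in dimension six. -/

section Classification

variable {T : Type*} [NormedAddCommGroup T] [InnerProductSpace ℝ T] [FiniteDimensional ℝ T]
  {σ : T [⋀^Fin 3]→ₗ[ℝ] ℝ}

/-- Skew-symmetry turns the diagonal entries into squared norms. The trace form makes the sum
invariant under conjugation, while the sum form can be computed in a basis. -/
lemma trace_contract_sq (σ : T [⋀^Fin 3]→ₗ[ℝ] ℝ) {ι : Type*} [Fintype ι]
    (b : OrthonormalBasis ι ℝ T) (X : T) :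
    LinearMap.trace ℝ T (contract σ X ∘ₗ contract σ X) = -∑ i, ‖contract σ X (b i)‖ ^ 2 := by
  rw [LinearMap.trace_eq_sum_inner _ b, ← Finset.sum_neg_distrib]
  refine Finset.sum_congr rfl fun i _ => ?_
  rw [LinearMap.comp_apply, real_inner_comm, inner_contract_skew, real_inner_self_eq_norm_sq]

lemma trace_contract_four (σ : T [⋀^Fin 3]→ₗ[ℝ] ℝ) {ι : Type*} [Fintype ι]
    (b : OrthonormalBasis ι ℝ T) (X : T) :
    LinearMap.trace ℝ T ((contract σ X ∘ₗ contract σ X) ∘ₗ (contract σ X ∘ₗ contract σ X)) =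
      ∑ i, ‖contract σ X (contract σ X (b i))‖ ^ 2 := by
  rw [LinearMap.trace_eq_sum_inner _ b]
  refine Finset.sum_congr rfl fun i _ => ?_
  simp only [LinearMap.comp_apply]
  rw [real_inner_comm, inner_contract_skew, inner_contract_skew, neg_neg,
    real_inner_self_eq_norm_sq]

lemma IsGeneralizedVectorCrossProduct.conj (h : IsGeneralizedVectorCrossProduct σ) {X Y : T}
    (hX : ‖X‖ = 1) (hY : ‖Y‖ = 1) :
    ∃ A : T ≃ₗ[ℝ] T, contract σ Y = A.conj (contract σ X) := by
  obtain ⟨A, hA⟩ := h.2 X Y hX hY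
  refine ⟨A.toLinearEquiv, LinearMap.ext fun v => ?_⟩
  rw [hA, LinearEquiv.conj_apply_apply]
  rfl

/-- The traces of `σ_X ^ 2` and `σ_X ^ 4` depend only on the norm of `X`. -/
lemma IsGeneralizedVectorCrossProduct.exists_invariants (h : IsGeneralizedVectorCrossProduct σ)
    {ι : Type*} [Fintype ι] (b : OrthonormalBasis ι ℝ T) :
    ∃ K L : ℝ, ∀ X, ∑ i, ‖contract σ X (b i)‖ ^ 2 = K * ‖X‖ ^ 2 ∧
      ∑ i, ‖contract σ X (contract σ X (b i))‖ ^ 2 = L * ‖X‖ ^ 4 := by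
  by_cases hT : ∃ u : T, ‖u‖ = 1
  · obtain ⟨u, hu⟩ := hT
    refine ⟨∑ i, ‖contract σ u (b i)‖ ^ 2, ∑ i, ‖contract σ u (contract σ u (b i))‖ ^ 2,
      fun X => ?_⟩
    by_cases hX : X = 0
    · subst hX
      simp [contract_zero_left]
    have hX' : ‖X‖ ≠ 0 := norm_ne_zero_iff.2 hX
    obtain ⟨A, hA⟩ := h.conj hu (Y := ‖X‖⁻¹ • X)
      (by rw [norm_smul, norm_inv, norm_norm, inv_mul_cancel₀ hX'])
    set Y := ‖X‖⁻¹ • X with hY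
    have hX2 : ∀ v, contract σ X v = ‖X‖ • contract σ Y v := fun v => by
      rw [hY, contract_smul_left, smul_inv_smul₀ hX']
    have e1 : ∑ i, ‖contract σ Y (b i)‖ ^ 2 = ∑ i, ‖contract σ u (b i)‖ ^ 2 := by
      rw [← neg_inj, ← trace_contract_sq, ← trace_contract_sq, hA, ← LinearEquiv.conj_comp,
        LinearMap.trace_conj']
    have e2 : ∑ i, ‖contract σ Y (contract σ Y (b i))‖ ^ 2 =
        ∑ i, ‖contract σ u (contract σ u (b i))‖ ^ 2 := by
      rw [← trace_contract_four, ← trace_contract_four, hA, ← LinearEquiv.conj_comp,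
        ← LinearEquiv.conj_comp, LinearMap.trace_conj']
    rw [← e1, ← e2, Finset.sum_mul, Finset.sum_mul]
    constructor
    · refine Finset.sum_congr rfl fun i _ => ?_
      rw [hX2, norm_smul, norm_norm]
      ring
    · refine Finset.sum_congr rfl fun i _ => ?_
      rw [hX2, hX2, map_smul, norm_smul, norm_smul, norm_norm]
      ring
  · refine ⟨0, 0, fun X => ?_⟩
    have : X = 0 := by
      by_contra hX
      exact hT ⟨‖X‖⁻¹ • X, by
        rw [norm_smul, norm_inv, norm_norm, inv_mul_cancel₀ (norm_ne_zero_iff.2 hX)]⟩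
    subst this
    simp [contract_zero_left]

/-- The continuous bilinear map `(X, Y) ↦ σ_X Y`. -/
def contractCLM (σ : T [⋀^Fin 3]→ₗ[ℝ] ℝ) : T →L[ℝ] T →L[ℝ] T :=
  (LinearMap.mk₂ ℝ (fun X Y => contract σ X Y) (contract_add_left σ) (contract_smul_left σ)
    (fun _ => map_add _) (fun _ _ => map_smul _ _)).toContinuousBilinearMap

lemma contractCLM_apply (σ : T [⋀^Fin 3]→ₗ[ℝ] ℝ) (X Y : T) :
    contractCLM σ X Y = contract σ X Y := rfl

lemma continuous_alternating_three (σ : T [⋀^Fin 3]→ₗ[ℝ] ℝ) : Continuous σ := by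
  have : (σ : (Fin 3 → T) → ℝ) = fun v => inner ℝ (contractCLM σ (v 0) (v 1)) (v 2) := by
    funext v
    rw [contractCLM_apply, inner_contract]
    congr 1
    funext i
    fin_cases i <;> rfl
  rw [this]
  fun_prop

/-- A nonzero 3-form attains its maximum on unit vectors at vectors on which it restricts to a
multiple of the cross product. -/
lemma exists_max_triple (h : σ ≠ 0) : ∃ (a : ℝ) (e : Fin 3 → T), 0 < a ∧ Orthonormal ℝ e ∧
    contract σ (e 0) (e 1) = a • e 2 ∧ contract σ (e 1) (e 2) = a • e 0 ∧
      contract σ (e 2) (e 0) = a • e 1 := by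
  obtain ⟨X, Y, hXY⟩ := exists_contract_ne_zero h
  have norm1 : ∀ {v : T}, v ≠ 0 → ‖(‖v‖⁻¹ : ℝ) • v‖ = 1 := fun {v} hv => by
    rw [norm_smul, norm_inv, norm_norm, inv_mul_cancel₀ (norm_ne_zero_iff.2 hv)]
  have hX0 : X ≠ 0 := by
    rintro rfl
    exact hXY (contract_zero_left σ Y)
  have hY0 : Y ≠ 0 := by
    rintro rfl
    exact hXY (map_zero _)
  have hK : IsCompact (Set.univ.pi fun _ : Fin 3 => Metric.sphere (0 : T) 1) :=
    isCompact_univ_pi fun _ => isCompact_sphere 0 1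
  -- The maximum is over arbitrary unit triples; orthogonality of the maximiser is derived at the
  -- end.
  obtain ⟨e, he, hmax⟩ := hK.exists_isMaxOn
    ⟨fun _ => (‖X‖⁻¹ : ℝ) • X, fun i _ => by simpa using norm1 hX0⟩
    (continuous_alternating_three σ).continuousOn
  have he1 : ∀ i, ‖e i‖ = 1 := fun i => by simpa using he i trivial
  have hle : ∀ {u v w : T}, ‖u‖ = 1 → ‖v‖ = 1 → ‖w‖ = 1 → σ ![u, v, w] ≤ σ e := by
    intro u v w hu hv hw
    refine hmax fun i _ => ?_
    fin_cases i <;> simp [hu, hv, hw]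
  -- Feeding the normalised vector `σ_u v` into the last slot shows that its norm is a value of `σ`
  -- on unit vectors.
  have hnorm : ∀ {u v : T}, ‖u‖ = 1 → ‖v‖ = 1 → ‖contract σ u v‖ ≤ σ e := by
    intro u v hu hv
    by_cases h0 : contract σ u v = 0
    · rw [h0, norm_zero]
      have h1 := hle hu hv hu
      rwa [← inner_contract, h0, inner_zero_left] at h1
    · have h1 := hle hu hv (norm1 h0)
      rwa [← inner_contract, inner_smul_right, real_inner_self_eq_norm_sq, pow_two,
        inv_mul_cancel_left₀ (norm_ne_zero_iff.2 h0)] at h1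
  have hpos : 0 < σ e := by
    refine lt_of_lt_of_le ?_ (hnorm (norm1 hX0) (norm1 hY0))
    rw [contract_smul_left, map_smul]
    simp [hX0, hY0, hXY]
  have hee : σ ![e 0, e 1, e 2] = σ e := by
    congr 1
    funext i
    fin_cases i <;> rfl
  -- Equality case of Cauchy–Schwarz: with `m = σ e`, expanding `‖σ_u v - m w‖²` gives `‖σ_u v‖² -
  -- m²`, which is at most zero.
  have hvec : ∀ {u v w : T}, ‖u‖ = 1 → ‖v‖ = 1 → ‖w‖ = 1 → σ ![u, v, w] = σ e →
      contract σ u v = σ e • w := by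
    intro u v w hu hv hw huvw
    rw [← sub_eq_zero, ← norm_eq_zero, ← sq_eq_zero_iff]
    refine le_antisymm ?_ (sq_nonneg _)
    rw [norm_sub_sq_real, inner_smul_right, inner_contract, huvw, norm_smul, hw,
      Real.norm_of_nonneg hpos.le]
    have := hnorm hu hv
    nlinarith [norm_nonneg (contract σ u v)]
  have c1 := hvec (he1 0) (he1 1) (he1 2) hee
  have c2 := hvec (he1 1) (he1 2) (he1 0) (by rw [alternating_rotate, hee])
  have c3 := hvec (he1 2) (he1 0) (he1 1) (by rw [alternating_rotate, alternating_rotate, hee])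
  refine ⟨σ e, e, hpos, ⟨he1, ?_⟩, c1, c2, c3⟩
  have o : ∀ {u v w : T}, contract σ u v = σ e • w → (inner ℝ w u : ℝ) = 0 := by
    intro u v w huv
    have h1 : (inner ℝ (contract σ u v) u : ℝ) = 0 := by
      rw [inner_contract_skew, contract_self, inner_zero_right, neg_zero]
    rw [huv, inner_smul_left] at h1
    exact (mul_eq_zero.1 h1).resolve_left hpos.ne'
  have o1 := o c1
  have o2 := o c2
  have o3 := o c3
  intro i j hij
  fin_cases i <;> fin_cases j <;>
    first
    | exact absurd rfl hij
    | assumption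
    | (rw [real_inner_comm]; assumption)

/-- Normal form of a 3-form in dimension six that is compatible with a decomposition into two
subspaces of dimension three. -/
structure IsNormalForm (σ : T [⋀^Fin 3]→ₗ[ℝ] ℝ) (b : OrthonormalBasis (Fin 6) ℝ T)
    (a d c : ℝ) : Prop where
  c01 : contract σ (b 0) (b 1) = a • b 2
  c12 : contract σ (b 1) (b 2) = a • b 0
  c20 : contract σ (b 2) (b 0) = a • b 1
  c03 : contract σ (b 0) (b 3) = 0
  c04 : contract σ (b 0) (b 4) = d • b 5
  c05 : contract σ (b 0) (b 5) = -(d • b 4)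
  c14 : contract σ (b 1) (b 4) = 0
  c15 : contract σ (b 1) (b 5) = d • b 3
  c13 : contract σ (b 1) (b 3) = -(d • b 5)
  c25 : contract σ (b 2) (b 5) = 0
  c23 : contract σ (b 2) (b 3) = d • b 4
  c24 : contract σ (b 2) (b 4) = -(d • b 3)
  c34 : contract σ (b 3) (b 4) = d • b 2 + c • b 5
  c45 : contract σ (b 4) (b 5) = d • b 0 + c • b 3
  c53 : contract σ (b 5) (b 3) = d • b 1 + c • b 4

/-- Here `a`, `d`, `c` are the coefficients of `b₀₁₂`, of `b₀₄₅ + b₁₅₃ + b₂₃₄` and of `b₃₄₅`.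
Comparing `b 0` with `b 3`, the quadratic invariant gives `2a² + 2d² = 4d² + 2c²`, and the quartic
one then gives `c²d² = 0`. The vector `b 0 + b 3` eliminates the spurious solutions. -/
lemma IsNormalForm.params {b : OrthonormalBasis (Fin 6) ℝ T} {a d c : ℝ}
    (h : IsNormalForm σ b a d c) (ha : 0 < a) (hg : IsGeneralizedVectorCrossProduct σ) :
    d = -a ∧ c = 0 := by
  obtain ⟨K, L, hKL⟩ := hg.exists_invariants b
  have hin : ∀ i j, (inner ℝ (b i) (b j) : ℝ) = if i = j then 1 else 0 :=
    orthonormal_iff_ite.1 b.orthonormal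
  obtain ⟨k0, l0⟩ := hKL (b 0)
  obtain ⟨k3, l3⟩ := hKL (b 3)
  obtain ⟨k, l⟩ := hKL (b 0 + b 3)
  have n03 : ‖b 0 + b 3‖ ^ 2 = 2 := by
    rw [← real_inner_self_eq_norm_sq, inner_add_left, inner_add_right, inner_add_right]
    simp only [hin, Fin.reduceEq, if_true, if_false]
    norm_num
  have n034 : ‖b 0 + b 3‖ ^ 4 = 4 := by
    rw [show ‖b 0 + b 3‖ ^ 4 = (‖b 0 + b 3‖ ^ 2) ^ 2 by ring, n03]
    norm_num
  simp only [n03, n034, b.norm_eq_one, one_pow, mul_one] at k0 l0 k3 l3 k l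
  have s10 := contract_swap σ (b 0) (b 1)
  have s21 := contract_swap σ (b 1) (b 2)
  have s02 := contract_swap σ (b 2) (b 0)
  have s30 := contract_swap σ (b 0) (b 3)
  have s40 := contract_swap σ (b 0) (b 4)
  have s50 := contract_swap σ (b 0) (b 5)
  have s41 := contract_swap σ (b 1) (b 4)
  have s51 := contract_swap σ (b 1) (b 5)
  have s31 := contract_swap σ (b 1) (b 3)
  have s52 := contract_swap σ (b 2) (b 5)
  have s32 := contract_swap σ (b 2) (b 3)
  have s42 := contract_swap σ (b 2) (b 4)
  have s43 := contract_swap σ (b 3) (b 4)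
  have s54 := contract_swap σ (b 4) (b 5)
  have s35 := contract_swap σ (b 5) (b 3)
  rw [h.c01] at s10
  rw [h.c12] at s21
  rw [h.c20] at s02
  rw [h.c03] at s30
  rw [h.c04] at s40
  rw [h.c05] at s50
  rw [h.c14] at s41
  rw [h.c15] at s51
  rw [h.c13] at s31
  rw [h.c25] at s52
  rw [h.c23] at s32
  rw [h.c24] at s42
  rw [h.c34] at s43
  rw [h.c45] at s54
  rw [h.c53] at s35
  have z := contract_self σ
  simp only [Fin.sum_univ_six, contract_add_left, map_add, map_smul, map_neg, map_zero, z,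
    h.c01, h.c12, h.c20, h.c03, h.c04, h.c05, h.c14, h.c15, h.c13, h.c25, h.c23, h.c24, h.c34,
    h.c45, h.c53, s10, s21, s02, s30, s40, s50, s41, s51, s31, s52, s32, s42, s43, s54, s35,
    ← real_inner_self_eq_norm_sq, inner_add_left, inner_add_right, inner_neg_left,
    inner_neg_right, inner_smul_left, inner_smul_right, inner_zero_left, inner_zero_right, hin,
    conj_trivial] at k0 l0 k3 l3 k l
  simp only [Fin.reduceEq, if_true, if_false, mul_zero, mul_one, zero_add, add_zero, neg_zero] at k0 l0 k3 l3 k l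
  have hc : c ^ 2 = a ^ 2 - d ^ 2 := by linear_combination (k3 - k0) / 2
  have hcd : c ^ 2 * d ^ 2 = 0 := by
    have h4 : a ^ 4 = (c ^ 2 + d ^ 2) ^ 2 := by
      rw [hc]
      ring
    linear_combination (l3 - l0) / 4 + h4 / 2
  have ha2 : 0 < a ^ 4 := by positivity
  -- Besides `d = -a, c = 0` there remain `d = a, c = 0` and `d = 0, c² = a²`. In both `σ` is a sum
  -- of two decomposable forms, and its quartic trace at `b 0 + b 3` differs from the required `4L`.
  rcases mul_eq_zero.1 hcd with h0 | h0
  · have hc0 : c = 0 := pow_eq_zero_iff two_ne_zero |>.1 h0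
    subst hc0
    have hd : (d - a) * (d + a) = 0 := by linear_combination hc
    rcases mul_eq_zero.1 hd with h1 | h1
    · have hd' : d = a := by linarith
      subst hd'
      ring_nf at l l0
      linarith
    · exact ⟨by linarith, rfl⟩
  · have hd0 : d = 0 := pow_eq_zero_iff two_ne_zero |>.1 h0
    subst hd0
    have h4 : c ^ 4 = a ^ 4 := by
      rw [show c ^ 4 = (c ^ 2) ^ 2 by ring, hc]
      ring
    ring_nf at l l0
    linarith

/-- Since `σ` maps pairs of `e`'s to multiples of `e`'s, all terms with two `e`'s and one `f`
vanish. The hypotheses fix the terms with one `e`, and `σ(f₀, f₁, f₂)` is the remaining coefficient.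
-/
lemma exists_isNormalForm_of_orthonormal [Fact (Module.finrank ℝ T = 6)] {a : ℝ} {e f : Fin 3 → T}
    (ha : 0 < a) (he : Orthonormal ℝ e) (c01 : contract σ (e 0) (e 1) = a • e 2)
    (c12 : contract σ (e 1) (e 2) = a • e 0) (c20 : contract σ (e 2) (e 0) = a • e 1)
    (hf : Orthonormal ℝ f) (hef : ∀ i j, (inner ℝ (e i) (f j) : ℝ) = 0)
    (hii : ∀ i, contract σ (e i) (f i) = 0) (d : ℝ) (d0 : σ ![e 0, f 1, f 2] = d)
    (d1 : σ ![e 1, f 2, f 0] = d) (d2 : σ ![e 2, f 0, f 1] = d) :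
    ∃ (b : OrthonormalBasis (Fin 6) ℝ T) (a d c : ℝ), 0 < a ∧ IsNormalForm σ b a d c := by
  have h6 : Module.finrank ℝ T = Fintype.card (Fin 6) := by
    simp [(Fact.out : Module.finrank ℝ T = 6)]
  have hz : ∀ {u v w x : T}, contract σ u v = a • w → (inner ℝ w x : ℝ) = 0 → σ ![u, v, x] = 0 := by
    intro u v w x h1 h2
    rw [← inner_contract, h1, inner_smul_left, h2, mul_zero]
  have ho : Orthonormal ℝ ![e 0, e 1, e 2, f 0, f 1, f 2] := by
    refine ⟨fun i => ?_, fun i j hij => ?_⟩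
    · fin_cases i <;> simp [he.norm_eq_one, hf.norm_eq_one]
    · have h1 := orthonormal_iff_ite.1 he
      have h2 := orthonormal_iff_ite.1 hf
      have h3 : ∀ i j, (inner ℝ (f i) (e j) : ℝ) = 0 := fun i j => by
        rw [real_inner_comm, hef]
      fin_cases i <;> fin_cases j <;>
        first
        | exact absurd rfl hij
        | simp [h1, h2, h3, hef]
  let b : OrthonormalBasis (Fin 6) ℝ T := OrthonormalBasis.mk ho
    (LinearIndependent.span_eq_top_of_card_eq_finrank' ho.linearIndependent h6.symm).ge
  have hb : ⇑b = ![e 0, e 1, e 2, f 0, f 1, f 2] := OrthonormalBasis.coe_mk _ _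
  have hsum : ∀ x y, contract σ x y = σ ![x, y, e 0] • e 0 + σ ![x, y, e 1] • e 1 +
      σ ![x, y, e 2] • e 2 + σ ![x, y, f 0] • f 0 + σ ![x, y, f 1] • f 1 +
      σ ![x, y, f 2] • f 2 := by
    intro x y
    rw [← b.sum_repr' (contract σ x y)]
    simp only [inner_contract', Fin.sum_univ_six, hb, Matrix.cons_val]
  have r1 := alternating_self_right σ
  have r2 := alternating_self_outer σ
  have E0 : ∀ i, σ ![e 0, f i, e 1] = 0 ∧ σ ![e 0, f i, e 2] = 0 := fun i => by
    constructor
    · rw [alternating_swap_right, hz c01 (hef _ _), neg_zero]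
    · rw [alternating_rotate, hz c20 (hef _ _)]
  have E1 : ∀ i, σ ![e 1, f i, e 0] = 0 ∧ σ ![e 1, f i, e 2] = 0 := fun i => by
    constructor
    · rw [alternating_rotate, hz c01 (hef _ _)]
    · rw [alternating_swap_right, hz c12 (hef _ _), neg_zero]
  have E2 : ∀ i, σ ![e 2, f i, e 0] = 0 ∧ σ ![e 2, f i, e 1] = 0 := fun i => by
    constructor
    · rw [alternating_swap_right, hz c20 (hef _ _), neg_zero]
    · rw [alternating_rotate, hz c12 (hef _ _)]
  have I : ∀ i x, σ ![e i, x, f i] = 0 := fun i x => by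
    rw [alternating_swap_right, ← inner_contract, hii, inner_zero_left, neg_zero]
  have I' : ∀ i x, σ ![e i, f i, x] = 0 := fun i x => by
    rw [← inner_contract, hii, inner_zero_left]
  have d0' : σ ![e 0, f 2, f 1] = -d := by rw [alternating_swap_right, d0]
  have d1' : σ ![e 1, f 0, f 2] = -d := by rw [alternating_swap_right, d1]
  have d2' : σ ![e 2, f 1, f 0] = -d := by rw [alternating_swap_right, d2]
  have g : ∀ i j k, σ ![f j, f k, e i] = σ ![e i, f j, f k] := fun i j k => by
    rw [alternating_rotate]
  have g1 : σ ![f 1, f 2, f 0] = σ ![f 0, f 1, f 2] := by rw [alternating_rotate]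
  have g2 : σ ![f 2, f 0, f 1] = σ ![f 0, f 1, f 2] := by
    rw [alternating_rotate, alternating_rotate]
  refine ⟨b, a, d, σ ![f 0, f 1, f 2], ha, ?_⟩
  constructor <;> simp only [hb, Matrix.cons_val, c01, c12, c20, hii] <;> rw [hsum] <;>
    simp [r1, r2, E0, E1, E2, I, I', d0, d1, d2, d0', d1', d2', g, g1, g2]

/-- In dimension six a generalized vector cross product has a normal form. -/
lemma exists_isNormalForm [Fact (Module.finrank ℝ T = 6)]
    (hg : IsGeneralizedVectorCrossProduct σ) :
    ∃ (b : OrthonormalBasis (Fin 6) ℝ T) (a d c : ℝ), 0 < a ∧ IsNormalForm σ b a d c := by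
  have h6 : Module.finrank ℝ T = Fintype.card (Fin 6) := by
    simp [(Fact.out : Module.finrank ℝ T = 6)]
  obtain ⟨a, e, ha, he, c01, c12, c20⟩ := exists_max_triple hg.1
  -- The zeros are placeholders at the indices outside `{0, 1, 2}`, where nothing is prescribed.
  obtain ⟨b, hb⟩ := (Orthonormal.exists_orthonormalBasis_extension_of_card_eq h6
    (v := ![e 0, e 1, e 2, 0, 0, 0]) (s := {0, 1, 2}) (by
      have : Orthonormal ℝ (e ∘ fun i : ({0, 1, 2} : Set (Fin 6)) =>
          (if (i : Fin 6) = 0 then 0 else if (i : Fin 6) = 1 then 1 else 2 : Fin 3)) := by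
        refine he.comp _ ?_
        rintro ⟨i, hi⟩ ⟨j, hj⟩ hij
        simp only [Set.mem_insert_iff, Set.mem_singleton_iff] at hi hj
        rcases hi with rfl | rfl | rfl <;> rcases hj with rfl | rfl | rfl <;> simp_all
      convert this using 1
      funext ⟨i, hi⟩
      simp only [Set.mem_insert_iff, Set.mem_singleton_iff] at hi
      rcases hi with rfl | rfl | rfl <;> simp))
  have b0 : b 0 = e 0 := by simpa using hb 0 (by simp)
  have b1 : b 1 = e 1 := by simpa using hb 1 (by simp)
  have b2 : b 2 = e 2 := by simpa using hb 2 (by simp)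
  have hin : ∀ i j, (inner ℝ (b i) (b j) : ℝ) = if i = j then 1 else 0 :=
    orthonormal_iff_ite.1 b.orthonormal
  have heb : ∀ i, (inner ℝ (e i) (b 3) : ℝ) = 0 ∧ (inner ℝ (e i) (b 4) : ℝ) = 0 ∧
      (inner ℝ (e i) (b 5) : ℝ) = 0 := by
    intro i
    fin_cases i
    · simp [← b0, hin]
    · simp [← b1, hin]
    · simp [← b2, hin]
  -- the action of `e i` on the complement of the span of the `e i`
  obtain ⟨m, hm⟩ : ∃ m : Fin 3 → Fin 3 → ℝ, ∀ i,
      contract σ (e i) (b 3) = m i 2 • b 4 - m i 1 • b 5 ∧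
      contract σ (e i) (b 4) = m i 0 • b 5 - m i 2 • b 3 ∧
      contract σ (e i) (b 5) = m i 1 • b 3 - m i 0 • b 4 := by
    refine ⟨fun i => ![σ ![e i, b 4, b 5], σ ![e i, b 5, b 3], σ ![e i, b 3, b 4]], fun i => ?_⟩
    have hee : ∀ i j (x : T), (∀ k, (inner ℝ (e k) x : ℝ) = 0) → σ ![e i, x, e j] = 0 := by
      intro i j x hx
      rw [alternating_swap_right, neg_eq_zero, ← inner_contract]
      fin_cases i <;> fin_cases j <;>
        simp [contract_self, c01, c12, c20, contract_swap σ (e 0) (e 1),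
          contract_swap σ (e 1) (e 2), contract_swap σ (e 2) (e 0), inner_smul_left, hx]
    have hsum : ∀ x, (∀ k, (inner ℝ (e k) x : ℝ) = 0) → contract σ (e i) x =
        σ ![e i, x, b 3] • b 3 + σ ![e i, x, b 4] • b 4 + σ ![e i, x, b 5] • b 5 := by
      intro x hx
      rw [← b.sum_repr' (contract σ (e i) x)]
      simp only [inner_contract', Fin.sum_univ_six, b0, b1, b2, hee _ _ x hx]
      module
    have r1 := alternating_self_right σ
    refine ⟨?_, ?_, ?_⟩
    · rw [hsum _ fun k => (heb k).1, r1, alternating_swap_right σ (e i) (b 5) (b 3)]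
      simp only [Matrix.cons_val]
      module
    · rw [hsum _ fun k => (heb k).2.1, r1, alternating_swap_right σ (e i) (b 3) (b 4)]
      simp only [Matrix.cons_val]
      module
    · rw [hsum _ fun k => (heb k).2.2, r1, alternating_swap_right σ (e i) (b 4) (b 5)]
      simp only [Matrix.cons_val]
      module
  obtain ⟨K, L, hKL⟩ := hg.exists_invariants b
  -- On the complement `σ_{e i}` is the cross product with the `i`-th row of `m`. The quadratic
  -- invariant at `∑ xᵢ eᵢ` therefore reads `2a²|x|² + 2|mᵀx|² = K|x|²`, so `m mᵀ` is the scalar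
  -- `K/2 - a²`.
  have hmm : ∀ x : Fin 3 → ℝ, 2 * a ^ 2 * (x 0 ^ 2 + x 1 ^ 2 + x 2 ^ 2) +
      2 * ∑ l, (x 0 * m 0 l + x 1 * m 1 l + x 2 * m 2 l) ^ 2 =
      K * (x 0 ^ 2 + x 1 ^ 2 + x 2 ^ 2) := by
    intro x
    obtain ⟨m03, m04, m05⟩ := hm 0
    obtain ⟨m13, m14, m15⟩ := hm 1
    obtain ⟨m23, m24, m25⟩ := hm 2
    have hk := (hKL (x 0 • b 0 + x 1 • b 1 + x 2 • b 2)).1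
    have s10 := contract_swap σ (b 0) (b 1)
    have s21 := contract_swap σ (b 1) (b 2)
    have s02 := contract_swap σ (b 2) (b 0)
    rw [← b0] at m03 m04 m05
    rw [← b1] at m13 m14 m15
    rw [← b2] at m23 m24 m25
    rw [← b0, ← b1, ← b2] at c01 c12 c20
    rw [c01] at s10
    rw [c12] at s21
    rw [c20] at s02
    simp only [Fin.sum_univ_six, contract_add_left, contract_smul_left, contract_self, c01, c12,
      c20, s10, s21, s02, m03, m04, m05, m13, m14, m15, m23, m24, m25, ← real_inner_self_eq_norm_sq,
      inner_add_left, inner_add_right, inner_neg_left, inner_neg_right, inner_smul_left,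
      inner_smul_right, inner_sub_left, inner_sub_right, inner_zero_left, inner_zero_right, hin,
      conj_trivial, Fin.reduceEq, if_true, if_false] at hk
    rw [Fin.sum_univ_three]
    linear_combination hk
  -- the rows of `m` are orthogonal and have the same length
  obtain ⟨B, hB⟩ : ∃ B, B = K / 2 - a ^ 2 := ⟨_, rfl⟩
  have o0 := hmm ![1, 0, 0]
  have o1 := hmm ![0, 1, 0]
  have o2 := hmm ![0, 0, 1]
  have o01 := hmm ![1, 1, 0]
  have o12 := hmm ![0, 1, 1]
  have o02 := hmm ![1, 0, 1]
  simp only [Matrix.cons_val, Fin.sum_univ_three] at o0 o1 o2 o01 o12 o02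
  have q0 : m 0 0 ^ 2 + m 0 1 ^ 2 + m 0 2 ^ 2 = B := by linear_combination o0 / 2 - hB
  have q1 : m 1 0 ^ 2 + m 1 1 ^ 2 + m 1 2 ^ 2 = B := by linear_combination o1 / 2 - hB
  have q2 : m 2 0 ^ 2 + m 2 1 ^ 2 + m 2 2 ^ 2 = B := by linear_combination o2 / 2 - hB
  have q01 : m 0 0 * m 1 0 + m 0 1 * m 1 1 + m 0 2 * m 1 2 = 0 := by
    linear_combination (o01 - o0 - o1) / 4
  have q12 : m 1 0 * m 2 0 + m 1 1 * m 2 1 + m 1 2 * m 2 2 = 0 := by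
    linear_combination (o12 - o1 - o2) / 4
  have q02 : m 0 0 * m 2 0 + m 0 1 * m 2 1 + m 0 2 * m 2 2 = 0 := by
    linear_combination (o02 - o0 - o2) / 4
  have hB0 : 0 ≤ B := by
    rw [← q0]
    positivity
  -- Either `m = 0`, and any orthonormal basis of the complement serves with `d = 0`, or `m` is a
  -- nonzero multiple of an orthogonal matrix.
  rcases hB0.eq_or_lt with hB1 | hB1
  · have z : ∀ i l, m i l = 0 := by
      intro i l
      have : m i 0 ^ 2 + m i 1 ^ 2 + m i 2 ^ 2 = 0 := by
        fin_cases i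
        · simpa [← hB1] using q0
        · simpa [← hB1] using q1
        · simpa [← hB1] using q2
      have h0 := sq_nonneg (m i 0)
      have h1 := sq_nonneg (m i 1)
      have h2 := sq_nonneg (m i 2)
      have e0 : m i 0 = 0 := sq_eq_zero_iff.1 (le_antisymm (by linarith only [this, h1, h2]) h0)
      have e1 : m i 1 = 0 := sq_eq_zero_iff.1 (le_antisymm (by linarith only [this, h0, h2]) h1)
      have e2 : m i 2 = 0 := sq_eq_zero_iff.1 (le_antisymm (by linarith only [this, h0, h1]) h2)
      fin_cases l
      exacts [e0, e1, e2]
    simp only [z, zero_smul, sub_zero] at hm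
    refine exists_isNormalForm_of_orthonormal (f := ![b 3, b 4, b 5]) ha he c01 c12 c20 ⟨fun i => ?_, fun i j hij => ?_⟩ (fun i j => ?_) (fun i => ?_) 0
      ?_ ?_ ?_
    · fin_cases i <;> simp [b.norm_eq_one]
    · fin_cases i <;> fin_cases j <;>
        first
        | exact absurd rfl hij
        | simp [hin]
    · fin_cases j
      · exact (heb i).1
      · exact (heb i).2.1
      · exact (heb i).2.2
    · fin_cases i
      · exact (hm 0).1
      · exact (hm 1).2.1
      · exact (hm 2).2.2
    all_goals
      rw [← inner_contract]
      simp [hm]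
  · obtain ⟨s, hs⟩ : ∃ s : ℝ, s ^ 2 * B = 1 := by
      refine ⟨(√B)⁻¹, ?_⟩
      rw [inv_pow, Real.sq_sqrt hB0, inv_mul_cancel₀ hB1.ne']
    -- The normalised rows of `m` are chosen because `σ_{e i}` acts as the cross product with row
    -- `i` and so kills `f i`. The common mixed coefficient is `s² det m`.
    let f : Fin 3 → T := fun i => s • (m i 0 • b 3 + m i 1 • b 4 + m i 2 • b 5)
    have hff : ∀ i j, (inner ℝ (f i) (f j) : ℝ) =
        s ^ 2 * (m i 0 * m j 0 + m i 1 * m j 1 + m i 2 * m j 2) := by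
      intro i j
      simp only [f, inner_smul_left, inner_smul_right, inner_add_left, inner_add_right, hin,
        conj_trivial, Fin.reduceEq, if_true, if_false]
      ring
    have hcf : ∀ i j, contract σ (e i) (f j) = s • ((m i 1 * m j 2 - m i 2 * m j 1) • b 3 +
        (m i 2 * m j 0 - m i 0 * m j 2) • b 4 + (m i 0 * m j 1 - m i 1 * m j 0) • b 5) := by
      intro i j
      obtain ⟨h1, h2, h3⟩ := hm i
      simp only [f, map_smul, map_add, h1, h2, h3]
      module
    refine exists_isNormalForm_of_orthonormal (f := f) ha he c01 c12 c20 ⟨fun i => ?_, fun i j hij => ?_⟩ (fun i j => ?_) (fun i => ?_)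
      (s ^ 2 * (m 0 0 * (m 1 1 * m 2 2 - m 1 2 * m 2 1) - m 0 1 * (m 1 0 * m 2 2 - m 1 2 * m 2 0)
        + m 0 2 * (m 1 0 * m 2 1 - m 1 1 * m 2 0))) ?_ ?_ ?_
    · rw [← pow_eq_one_iff_of_nonneg (norm_nonneg _) two_ne_zero, ← real_inner_self_eq_norm_sq, hff, ← hs]
      congr 1
      fin_cases i
      · rw [← q0]
        simp
        ring
      · rw [← q1]
        simp
        ring
      · rw [← q2]
        simp
        ring
    · change (inner ℝ (f i) (f j) : ℝ) = 0
      rw [hff, mul_eq_zero]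
      right
      fin_cases i <;> fin_cases j <;>
        first
        | exact absurd rfl hij
        | (simp only [Fin.mk_zero, Fin.mk_one, Fin.zero_eta, Fin.reduceFinMk]; first | linarith only [q01] | linarith only [q02] | linarith only [q12])
    · simp [f, inner_smul_right, inner_add_right, heb]
    · rw [hcf]
      module
    all_goals
      rw [← inner_contract, hcf]
      simp only [f, inner_smul_left, inner_smul_right, inner_add_left, inner_add_right, hin,
        conj_trivial, Fin.reduceEq, if_true, if_false]
      ring

/-- In dimension six a generalized vector cross product is the real part of a complex volume
form. -/
theorem exists_isCompatible [Fact (Module.finrank ℝ T = 6)]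
    (hg : IsGeneralizedVectorCrossProduct σ) : ∃ J : T →ₗ[ℝ] T, IsCompatible σ J := by
  obtain ⟨b, a, d, c, ha, h⟩ := exists_isNormalForm hg
  obtain ⟨rfl, rfl⟩ := h.params ha hg
  -- For `d = -a, c = 0` the form is `a Re((b₀ + i b₃) ∧ (b₁ + i b₄) ∧ (b₂ + i b₅))` in dual
  -- covectors, which suggests pairing `b k` with `b (k + 3)`.
  let J : T →ₗ[ℝ] T := b.toBasis.constr ℝ ![b 3, b 4, b 5, -b 0, -b 1, -b 2]
  have hJ : ∀ i, J (b i) = ![b 3, b 4, b 5, -b 0, -b 1, -b 2] i := fun i => by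
    have := b.toBasis.constr_basis ℝ ![b 3, b 4, b 5, -b 0, -b 1, -b 2] i
    rwa [b.coe_toBasis] at this
  have j0 : J (b 0) = b 3 := hJ 0
  have j1 : J (b 1) = b 4 := hJ 1
  have j2 : J (b 2) = b 5 := hJ 2
  have j3 : J (b 3) = -b 0 := hJ 3
  have j4 : J (b 4) = -b 1 := hJ 4
  have j5 : J (b 5) = -b 2 := hJ 5
  refine ⟨J, ⟨fun v => ?_, fun v w => ?_⟩, fun X Y => ?_⟩
  · have : J ∘ₗ J = -LinearMap.id := by
      refine b.toBasis.ext fun i => ?_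
      rw [b.coe_toBasis]
      fin_cases i <;> simp [j0, j1, j2, j3, j4, j5]
    exact LinearMap.congr_fun this v
  · rw [← b.sum_repr' v, ← b.sum_repr' w]
    have e : ∀ x : Fin 6 → ℝ, J (∑ i, x i • b i) =
        ∑ i, (![-x 3, -x 4, -x 5, x 0, x 1, x 2] : Fin 6 → ℝ) i • b i := by
      intro x
      simp only [Fin.sum_univ_six, map_add, map_smul, j0, j1, j2, j3, j4, j5, Matrix.cons_val]
      module
    rw [e fun i => inner ℝ (b i) v, e fun i => inner ℝ (b i) w, inner_fin_six b.orthonormal,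
      inner_fin_six b.orthonormal]
    simp only [Fin.sum_univ_six, Matrix.cons_val]
    ring
  · have s10 := contract_swap σ (b 0) (b 1)
    have s21 := contract_swap σ (b 1) (b 2)
    have s02 := contract_swap σ (b 2) (b 0)
    have s30 := contract_swap σ (b 0) (b 3)
    have s40 := contract_swap σ (b 0) (b 4)
    have s50 := contract_swap σ (b 0) (b 5)
    have s41 := contract_swap σ (b 1) (b 4)
    have s51 := contract_swap σ (b 1) (b 5)
    have s31 := contract_swap σ (b 1) (b 3)
    have s52 := contract_swap σ (b 2) (b 5)
    have s32 := contract_swap σ (b 2) (b 3)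
    have s42 := contract_swap σ (b 2) (b 4)
    have s43 := contract_swap σ (b 3) (b 4)
    have s54 := contract_swap σ (b 4) (b 5)
    have s35 := contract_swap σ (b 5) (b 3)
    rw [← b.sum_repr' X, ← b.sum_repr' Y]
    simp only [Fin.sum_univ_six, contract_add_left, contract_smul_left, map_add, map_smul, map_neg,
      map_zero, contract_self, h.c01, h.c12, h.c20, h.c03, h.c04, h.c05, h.c14, h.c15, h.c13,
      h.c25, h.c23, h.c24, h.c34, h.c45, h.c53, s10, s21, s02, s30, s40, s50, s41, s51, s31, s52,
      s32, s42, s43, s54, s35, j0, j1, j2, j3, j4, j5]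
    module

end Classification

/-! ### The orientation induced by a complex structure. -/

section LinearOrientation

variable {T : Type*} [AddCommGroup T] [Module ℝ T]

/-- A linear automorphism of a real vector space commuting with a complex structure has
nonnegative determinant. -/
lemma det_nonneg_of_commute {J A : T →ₗ[ℝ] T} (hJ : ∀ v, J (J v) = -v)
    (hA : ∀ v, A (J v) = J (A v)) : 0 ≤ LinearMap.det A := by
  have hJ' : (J : Module.End ℝ T) * J = -1 := LinearMap.ext hJ
  let φ : ℂ →ₐ[ℝ] Module.End ℝ T := Complex.lift ⟨J, hJ'⟩
  have hφ : ∀ z : ℂ, ∀ v : T, φ z v = z.re • v + z.im • J v := fun z v => by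
    simp [φ, Complex.liftAux_apply]
  let _ : Module ℂ T := Module.compHom T φ.toRingHom
  have hsmul : ∀ (z : ℂ) (v : T), z • v = z.re • v + z.im • J v := hφ
  have : IsScalarTower ℝ ℂ T := ⟨fun r z v => by
    rw [hsmul, hsmul]
    simp [smul_add, mul_smul]⟩
  let B : T →ₗ[ℂ] T :=
    { toFun := A
      map_add' := map_add A
      map_smul' := fun z v => by
        rw [RingHom.id_apply, hsmul, hsmul, map_add, map_smul, map_smul, hA] }
  have : A = B.restrictScalars ℝ := rfl
  -- The real determinant of a complex linear map is the squared modulus of its complex determinant.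
  rw [this, LinearMap.det_restrictScalars, Algebra.norm_complex_apply]
  exact Complex.normSq_nonneg _

/-- The basis is of the form `u, J u, v, J v, w, J w`. -/
def IsAdaptedBasis (J : T →ₗ[ℝ] T) (b : Module.Basis (Fin 6) ℝ T) : Prop :=
  b 1 = J (b 0) ∧ b 3 = J (b 2) ∧ b 5 = J (b 4)

/-- All bases adapted to a complex structure induce the same orientation. -/
theorem IsAdaptedBasis.orientation_eq {J : T →ₗ[ℝ] T} (hJ : ∀ v, J (J v) = -v)
    {b b' : Module.Basis (Fin 6) ℝ T} (hb : IsAdaptedBasis J b) (hb' : IsAdaptedBasis J b') :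
    b.orientation = b'.orientation := by
  rw [Module.Basis.orientation_eq_iff_det_pos]
  let A : T →ₗ[ℝ] T := b.constr ℝ b'
  have hAb : ∀ i, A (b i) = b' i := fun i => b.constr_basis ℝ _ i
  have hA : ∀ v, A (J v) = J (A v) := by
    have : A ∘ₗ J = J ∘ₗ A := by
      refine b.ext fun i => ?_
      obtain ⟨h1, h3, h5⟩ := hb
      obtain ⟨h1', h3', h5'⟩ := hb'
      fin_cases i
      · simp [← h1, hAb, ← h1']
      · have e : J (b 1) = -b 0 := by rw [h1, hJ]
        have e' : J (b' 1) = -b' 0 := by rw [h1', hJ]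
        simp [e, e', hAb]
      · simp [← h3, hAb, ← h3']
      · have e : J (b 3) = -b 2 := by rw [h3, hJ]
        have e' : J (b' 3) = -b' 2 := by rw [h3', hJ]
        simp [e, e', hAb]
      · simp [← h5, hAb, ← h5']
      · have e : J (b 5) = -b 4 := by rw [h5, hJ]
        have e' : J (b' 5) = -b' 4 := by rw [h5', hJ]
        simp [e, e', hAb]
    exact LinearMap.congr_fun this
  have h1 : b.det b' = LinearMap.det A := by
    have := b.det_comp A b
    rw [b.det_self, mul_one] at this
    rw [← this]
    congr 1
    funext i
    exact (hAb i).symm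
  exact lt_of_le_of_ne (h1 ▸ det_nonneg_of_commute hJ hA) (b.isUnit_det b').ne_zero.symm

/-- In complex dimension three, `J` and `-J` induce opposite orientations. -/
theorem IsAdaptedBasis.orientation_ne {J : T →ₗ[ℝ] T} (hJ : ∀ v, J (J v) = -v)
    {b b' : Module.Basis (Fin 6) ℝ T} (hb : IsAdaptedBasis J b) (hb' : IsAdaptedBasis (-J) b') :
    b.orientation ≠ b'.orientation := by
  -- Changing the signs of `Ju, Jv, Jw` yields a basis adapted to `-J`; three sign changes reverse
  -- the orientation.
  let c := b.unitsSMul ![1, -1, 1, -1, 1, -1]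
  have hc : IsAdaptedBasis (-J) c := by
    obtain ⟨h1, h3, h5⟩ := hb
    simp [IsAdaptedBasis, c, Module.Basis.unitsSMul_apply, h1, h3, h5]
  rw [← hc.orientation_eq (J := -J) (fun v => by simp [hJ]) hb', b.orientation_unitsSMul]
  have hp : (∏ i, (![1, -1, 1, -1, 1, -1] : Fin 6 → ℝˣ) i)⁻¹ = -1 := by
    simp [Fin.prod_univ_six]
  rw [hp]
  intro h
  rw [Module.Ray.neg_units_smul, one_smul] at h
  exact Module.Ray.ne_neg_self _ h

end LinearOrientation

/-! ### Orientations read off from inner products. -/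

section

variable {T : Type*} [NormedAddCommGroup T] [InnerProductSpace ℝ T] [FiniteDimensional ℝ T]

/-- The matrix of inner products is the Gram matrix times the matrix of coordinates. As Gram
determinants of bases are positive, the sign of `b.det e` becomes visible in quantities that vary
smoothly with the vectors. -/
lemma det_inner_eq {m : ℕ} (b : Module.Basis (Fin m) ℝ T) (e : Fin m → T) :
    (Matrix.of fun i j => (inner ℝ (b i) (e j) : ℝ)).det = (Matrix.gram ℝ b).det * b.det e := by
  have h1 : (Matrix.of fun i j => (inner ℝ (b i) (e j) : ℝ)) =
      Matrix.gram ℝ b * b.toMatrix e := by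
    ext i j
    rw [Matrix.mul_apply]
    conv_lhs => rw [Matrix.of_apply, ← b.sum_repr (e j), inner_sum]
    simp [Matrix.gram, inner_smul_right, Module.Basis.toMatrix_apply, mul_comm]
  rw [h1, Matrix.det_mul, Module.Basis.det_apply]

lemma det_gram_basis_pos {m : ℕ} (b : Module.Basis (Fin m) ℝ T) : 0 < (Matrix.gram ℝ b).det :=
  lt_of_le_of_ne (Matrix.PosSemidef.det_nonneg (Matrix.posSemidef_gram ℝ b))
    (Matrix.det_gram_ne_zero_iff_linearIndependent.2 b.linearIndependent).symm

/-- Whether two bases induce the same orientation can be read off from the matrix of their inner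
products. -/
lemma det_inner_pos_of_orientation_eq {m : ℕ} {b b' : Module.Basis (Fin m) ℝ T}
    (h : b.orientation = b'.orientation) :
    0 < (Matrix.of fun i j => (inner ℝ (b i) (b' j) : ℝ)).det := by
  rw [det_inner_eq, mul_pos_iff_of_pos_left (det_gram_basis_pos b)]
  exact (b.orientation_eq_iff_det_pos b').1 h

/-- Positivity is an open condition, so along smooth fields a positive frame at a point stays a
positive frame nearby. -/
lemma exists_basis_of_det_inner_pos {m : ℕ} (b : Module.Basis (Fin m) ℝ T) {e : Fin m → T}
    (h : 0 < (Matrix.of fun i j => (inner ℝ (b i) (e j) : ℝ)).det) :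
    ∃ b' : Module.Basis (Fin m) ℝ T, ⇑b' = e ∧ b'.orientation = b.orientation := by
  rw [det_inner_eq, mul_pos_iff_of_pos_left (det_gram_basis_pos b)] at h
  obtain ⟨hli, hsp⟩ := (b.is_basis_iff_det (v := e)).2 h.ne'.isUnit
  refine ⟨Module.Basis.mk hli hsp.ge, Module.Basis.coe_mk _ _, ?_⟩
  rw [eq_comm, Module.Basis.orientation_eq_iff_det_pos, Module.Basis.coe_mk]
  exact h

end

/-! ### Global vector fields, tensoriality and smoothness. -/

section Fields

variable {n : ℕ} {M : Type*} [TopologicalSpace M] [ChartedSpace (EuclideanSpace ℝ (Fin n)) M]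
  [IsManifold (𝓡 n) ∞ M]

/-- A real function on a connected manifold whose derivative vanishes is constant. -/
lemma eq_of_mvfderiv_eq_zero [PreconnectedSpace M] {p : M → ℝ}
    (hp : ∀ x, MDifferentiableAt (𝓡 n) 𝓘(ℝ, ℝ) p x) (h0 : ∀ x, mvfderiv (𝓡 n) p x = 0) (x y : M) :
    p x = p y := by
  suffices h : IsLocallyConstant p from h.apply_eq_of_preconnectedSpace x y
  rw [IsLocallyConstant.iff_eventually_eq]
  intro x₀
  have h0' : ∀ x, mfderiv (𝓡 n) 𝓘(ℝ, ℝ) p x = 0 := fun x => by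
    ext v
    exact DFunLike.congr_fun (h0 x) v
  let φ := extChartAt (𝓡 n) x₀
  have hopen : IsOpen φ.target := isOpen_extChartAt_target x₀
  have hd : ∀ z ∈ φ.target, HasFDerivAt (p ∘ φ.symm) (0 : EuclideanSpace ℝ (Fin n) →L[ℝ] ℝ) z := by
    intro z hz
    have h1 : MDifferentiableAt 𝓘(ℝ, EuclideanSpace ℝ (Fin n)) (𝓡 n) φ.symm z :=
      (mdifferentiableOn_extChartAt_symm z hz).mdifferentiableAt (hopen.mem_nhds hz)
    have h2 := (hp (φ.symm z)).hasMFDerivAt.comp z h1.hasMFDerivAt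
    rw [h0', ContinuousLinearMap.zero_comp] at h2
    exact hasMFDerivAt_iff_hasFDerivAt.1 h2
  obtain ⟨r, hr, hball⟩ := Metric.isOpen_iff.1 hopen (φ x₀) (mem_extChartAt_target x₀)
  have hconst : ∀ z ∈ Metric.ball (φ x₀) r, p (φ.symm z) = p x₀ := by
    intro z hz
    have := (convex_ball (φ x₀) r).is_const_of_fderivWithin_eq_zero (𝕜 := ℝ) (f := p ∘ φ.symm)
      (fun w hw => (hd w (hball hw)).differentiableAt.differentiableWithinAt)
      (fun w hw => by
        rw [fderivWithin_of_isOpen Metric.isOpen_ball hw, (hd w (hball hw)).fderiv])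
      hz (Metric.mem_ball_self hr)
    simpa [φ] using this
  filter_upwards [extChartAt_source_mem_nhds (I := 𝓡 n) x₀,
    (continuousAt_extChartAt (I := 𝓡 n) x₀).preimage_mem_nhds (Metric.ball_mem_nhds _ hr)]
    with y hy hy'
  have := hconst (φ y) hy'
  rwa [φ.left_inv hy] at this

variable [T2Space M]

/-- A vector field that is smooth near a point agrees near that point with a global smooth
vector field. -/
lemma exists_vfield_eventuallyEq {Z : Π x : M, TangentSpace (𝓡 n) x} {x : M}
    (h : ∀ᶠ y in 𝓝 x, SmoothAt Z y) : ∃ V : VField n M, ∀ᶠ y in 𝓝 x, V y = Z y := by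
  obtain ⟨u, hu, huo, hxu⟩ := eventually_nhds_iff.1 h
  obtain ⟨f, -, hf⟩ := (SmoothBumpFunction.nhds_basis_tsupport (I := 𝓡 n) x).mem_iff.1
    (huo.mem_nhds hxu)
  refine ⟨⟨(f : M → ℝ) • Z, f.contMDiff.contMDiffOn.smul_section_of_tsupport huo hf
    fun y hy => ContMDiffAt.contMDiffWithinAt (hu y hy)⟩, ?_⟩
  filter_upwards [f.eventuallyEq_one] with y hy
  change f y • Z y = Z y
  rw [hy]
  exact one_smul ℝ _

/-- A tangent vector extends to a global smooth vector field. -/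
lemma exists_vfield_eq (x : M) (v : TangentSpace (𝓡 n) x) : ∃ V : VField n M, V x = v := by
  let t := trivializationAt (EuclideanSpace ℝ (Fin n)) (TangentSpace (𝓡 n) : M → Type _) x
  let b := (EuclideanSpace.basisFun (Fin n) ℝ).toBasis
  have hx : x ∈ t.baseSet := FiberBundle.mem_baseSet_trivializationAt' x
  let c : Fin n → ℝ := fun i => t.localFrameCoeff (𝓡 n) b i x v
  let Z : Π x : M, TangentSpace (𝓡 n) x := fun y => ∑ i, c i • t.localFrame b i y
  have hZ : ∀ᶠ y in 𝓝 x, SmoothAt Z y := by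
    filter_upwards [t.open_baseSet.mem_nhds hx] with y hy
    exact ContMDiffAt.sum_section fun i _ =>
      (contMDiffAt_localFrame_of_mem ∞ t b i hy).const_smul_section
  obtain ⟨V, hV⟩ := exists_vfield_eventuallyEq hZ
  refine ⟨V, ?_⟩
  rw [hV.self_of_nhds]
  classical
  -- The frame expansion applies to sections, so `v` is turned into a possibly discontinuous one by
  -- extending it by zero.
  let W : Π x : M, TangentSpace (𝓡 n) x := Function.update 0 x v
  have := t.eq_sum_localFrameCoeff_smul (I := 𝓡 n) (b := b) (s := W) hx
  simp only [W, Function.update_self] at this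
  exact this.symm

/-- A tangent vector, extended to a global smooth vector field. -/
def extendVec (x : M) (v : TangentSpace (𝓡 n) x) : VField n M := (exists_vfield_eq x v).choose

@[simp]
lemma extendVec_apply (x : M) (v : TangentSpace (𝓡 n) x) : extendVec x v x = v :=
  (exists_vfield_eq x v).choose_spec

/-- A `C^∞(M)`-linear operator on vector fields is tensorial. -/
lemma eq_zero_of_smul_linear {A : Type*} [AddCommGroup A] [Module ℝ A] {x : M}
    (L : VField n M → A) (hadd : ∀ X Y, L (X + Y) = L X + L Y)
    (hsmul : ∀ (f : C^∞⟮𝓡 n, M; ℝ⟯) X, L (fmul f X) = f x • L X) {X : VField n M}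
    (hX : X x = 0) : L X = 0 := by
  let t := trivializationAt (EuclideanSpace ℝ (Fin n)) (TangentSpace (𝓡 n) : M → Type _) x
  let b := (EuclideanSpace.basisFun (Fin n) ℝ).toBasis
  have hx : x ∈ t.baseSet := FiberBundle.mem_baseSet_trivializationAt' x
  obtain ⟨f, -, hf⟩ := (SmoothBumpFunction.nhds_basis_tsupport (I := 𝓡 n) x).mem_iff.1
    (t.open_baseSet.mem_nhds hx)
  let c : Fin n → M → ℝ := fun i y => t.localFrameCoeff (𝓡 n) b i y (X y)
  have hc : ∀ i, ∀ y ∈ t.baseSet, ContMDiffAt (𝓡 n) 𝓘(ℝ, ℝ) ∞ (c i) y := fun i y hy =>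
    contMDiffAt_localFrameCoeff b hy (X.smoothAt y) i
  let C : Fin n → C^∞⟮𝓡 n, M; ℝ⟯ := fun i => ⟨fun y => f y * c i y, by
    refine contMDiff_of_tsupport fun y hy => ?_
    exact f.contMDiffAt.mul (hc i y (hf (closure_mono
      (Function.support_mul_subset_left _ _) hy)))⟩
  let E : Fin n → VField n M := fun i =>
    ⟨(f : M → ℝ) • t.localFrame b i, f.contMDiff.contMDiffOn.smul_section_of_tsupport
      t.open_baseSet hf fun y hy => (contMDiffAt_localFrame_of_mem ∞ t b i hy).contMDiffWithinAt⟩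
  let F : C^∞⟮𝓡 n, M; ℝ⟯ := ⟨f, f.contMDiff⟩
  -- Cutting off both coefficients and frame makes the local expansion global at the cost of a
  -- factor `f²`, which is `1` at `x`. The coefficients vanish at `x` together with `X`.
  have hsum : fmul F (fmul F X) = ∑ i, fmul (C i) (E i) := by
    ext1 y
    have e1 : (∑ i, fmul (C i) (E i) : VField n M) y =
        ∑ i, (f y * c i y) • (f y • t.localFrame b i y) := by
      rw [← ContMDiffSection.coeAddHom_apply, map_sum, Finset.sum_apply]
      rfl
    rw [e1]
    change f y • f y • X y = _
    by_cases hy : y ∈ t.baseSet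
    · have := t.eq_sum_localFrameCoeff_smul (I := 𝓡 n) (b := b) (s := X) hy
      conv_lhs => rw [this]
      rw [Finset.smul_sum, Finset.smul_sum]
      refine Finset.sum_congr rfl fun i _ => ?_
      rw [smul_smul, smul_smul, smul_smul]
      congr 1
      simp only [c]
      ring
    · have : f y = 0 := image_eq_zero_of_notMem_tsupport fun h => hy (hf h)
      simp [this]
  have hLsum : ∀ s : Finset (Fin n), L (∑ i ∈ s, fmul (C i) (E i)) = 0 := by
    intro s
    induction s using Finset.induction_on with
    | empty =>
      have := hadd 0 0
      rw [add_zero] at this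
      rw [Finset.sum_empty]
      exact left_eq_add.1 this
    | insert i s hi ih =>
      rw [Finset.sum_insert hi, hadd, ih, hsmul]
      have : C i x = 0 := by
        change f x * c i x = 0
        simp only [c, hX, map_zero, mul_zero]
      rw [this, zero_smul, zero_add]
  have h1 := hLsum Finset.univ
  rw [← hsum, hsmul, hsmul] at h1
  have hF : F x = 1 := f.eq_one
  rwa [hF, one_smul, one_smul] at h1

/-- A `C^∞(M)`-linear operator on vector fields is determined pointwise. -/
lemma eq_of_smul_linear {A : Type*} [AddCommGroup A] [Module ℝ A] {x : M}
    (L : VField n M → A) (hadd : ∀ X Y, L (X + Y) = L X + L Y)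
    (hsmul : ∀ (f : C^∞⟮𝓡 n, M; ℝ⟯) X, L (fmul f X) = f x • L X) {X Y : VField n M}
    (hXY : X x = Y x) : L X = L Y := by
  have h : L (X - Y) = 0 := eq_zero_of_smul_linear L hadd hsmul (by
    rw [ContMDiffSection.coe_sub, Pi.sub_apply, hXY, sub_self])
  have := hadd (X - Y) Y
  rwa [sub_add_cancel, h, zero_add] at this

/-- A field of endomorphisms is smooth if it maps smooth vector fields to smooth vector fields. -/
lemma contMDiffAt_endomorphism {φ : Π x : M, TangentSpace (𝓡 n) x →L[ℝ] TangentSpace (𝓡 n) x}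
    {x : M} (h : ∀ X : VField n M, SmoothAt (fun y => φ y (X y)) x) :
    ContMDiffAt (𝓡 n) ((𝓡 n).prod 𝓘(ℝ, EuclideanSpace ℝ (Fin n) →L[ℝ] EuclideanSpace ℝ (Fin n))) ∞
      (fun y => TotalSpace.mk' (EuclideanSpace ℝ (Fin n) →L[ℝ] EuclideanSpace ℝ (Fin n))
        (E := fun y : M => TangentSpace (𝓡 n) y →L[ℝ] TangentSpace (𝓡 n) y) y (φ y)) x := by
  rw [contMDiffAt_hom_bundle]
  refine ⟨contMDiffAt_id, ?_⟩
  let t := trivializationAt (EuclideanSpace ℝ (Fin n)) (TangentSpace (𝓡 n) : M → Type _) x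
  let b := (EuclideanSpace.basisFun (Fin n) ℝ).toBasis
  have hx : x ∈ t.baseSet := FiberBundle.mem_baseSet_trivializationAt' x
  let P : Fin n → (EuclideanSpace ℝ (Fin n)) →L[ℝ]
      (EuclideanSpace ℝ (Fin n) →L[ℝ] EuclideanSpace ℝ (Fin n)) := fun i =>
    ContinuousLinearMap.smulRightL ℝ (EuclideanSpace ℝ (Fin n)) (EuclideanSpace ℝ (Fin n))
      (b.coord i).toContinuousLinearMap
  have hs : ∀ i, ContMDiffAt (𝓡 n) 𝓘(ℝ, EuclideanSpace ℝ (Fin n)) ∞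
      (fun y => (t ⟨y, φ y (t.localFrame b i y)⟩).2) x := by
    intro i
    have hZ : ∀ᶠ y in 𝓝 x, SmoothAt (t.localFrame b i) y := by
      filter_upwards [t.open_baseSet.mem_nhds hx] with y hy
      exact contMDiffAt_localFrame_of_mem ∞ t b i hy
    obtain ⟨V, hV⟩ := exists_vfield_eventuallyEq hZ
    have h1 : SmoothAt (fun y => φ y (t.localFrame b i y)) x := by
      refine ContMDiffAt.congr_of_eventuallyEq (h V) ?_
      filter_upwards [hV] with y hy
      rw [hy]
    exact (t.contMDiffAt_section_iff (IB := 𝓡 n) hx).1 h1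
  -- In the trivialization the endomorphism is the sum of the coordinate functionals tensored with
  -- the images of the frame fields, each of which is smooth.
  have key : ContMDiffAt (𝓡 n)
      𝓘(ℝ, EuclideanSpace ℝ (Fin n) →L[ℝ] EuclideanSpace ℝ (Fin n)) ∞
      (fun y => ∑ i, P i ((t ⟨y, φ y (t.localFrame b i y)⟩).2)) x :=
    contMDiffAt_finsetSum fun i _ => (P i).contDiff.contMDiff.contMDiffAt.comp x (hs i)
  refine key.congr_of_eventuallyEq ?_
  filter_upwards [t.open_baseSet.mem_nhds hx] with y hy
  refine ContinuousLinearMap.coe_injective (b.ext fun j => ?_)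
  have hPi : ∀ i v, P i v (b j) = (if j = i then (1 : ℝ) else 0) • v := fun i v => by
    simp [P, Finsupp.single_apply]
  simp only [ContinuousLinearMap.coe_coe, sum_apply, hPi]
  simp only [ite_smul, one_smul, zero_smul, Finset.sum_ite_eq, Finset.mem_univ, if_true]
  rw [ContinuousLinearMap.inCoordinates_eq hy hy]
  simp only [ContinuousLinearMap.comp_apply]
  rw [t.localFrame_apply_of_mem_baseSet b hy]
  have hb : t.basisAt b hy j = (t.linearEquivAt ℝ y hy).symm (b j) := by
    rw [Trivialization.basisAt, Module.Basis.map_apply]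
  rw [hb]
  rfl

end Fields

/-! ### Three-forms from bilinear maps. -/

section AlternatingForm

variable {T : Type*} [NormedAddCommGroup T] [InnerProductSpace ℝ T] [FiniteDimensional ℝ T]

/-- The alternating 3-form `g(B(X, Y), Z)`. -/
def alternatingOfBilin (B : T →ₗ[ℝ] T →ₗ[ℝ] T) (h1 : ∀ X, B X X = 0)
    (h2 : ∀ X Y, (inner ℝ (B X Y) Y : ℝ) = 0) : T [⋀^Fin 3]→ₗ[ℝ] ℝ where
  toFun v := inner ℝ (B (v 0) (v 1)) (v 2)
  map_update_add' {inst} v i x y := by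
    obtain rfl : inst = instDecidableEqFin 3 := Subsingleton.elim _ _
    fin_cases i <;> simp [Function.update, inner_add_left, inner_add_right]
  map_update_smul' {inst} v i c x := by
    obtain rfl : inst = instDecidableEqFin 3 := Subsingleton.elim _ _
    fin_cases i <;> simp [Function.update, inner_smul_left, inner_smul_right]
  map_eq_zero_of_eq' v i j hv hij := by
    have h3 : ∀ X Y, (inner ℝ (B X Y) X : ℝ) = 0 := fun X Y => by
      have e := h1 (X + Y)
      rw [map_add, map_add, LinearMap.add_apply, LinearMap.add_apply, h1, h1, zero_add, add_zero,
        add_comm] at e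
      rw [eq_neg_of_add_eq_zero_left e, inner_neg_left, h2, neg_zero]
    fin_cases i <;> fin_cases j <;> simp at hv hij ⊢ <;> simp [hv, h1, h2, h3]

lemma contract_alternatingOfBilin (B : T →ₗ[ℝ] T →ₗ[ℝ] T) (h1 : ∀ X, B X X = 0)
    (h2 : ∀ X Y, (inner ℝ (B X Y) Y : ℝ) = 0) (X Y : T) :
    contract (alternatingOfBilin B h1 h2) X Y = B X Y := by
  refine ext_inner_right ℝ fun Z => ?_
  rw [inner_contract]
  rfl

end AlternatingForm

/-! ### The torsion form of the canonical connection of a nearly Kähler structure. -/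

section Connections

variable {n : ℕ} {M : Type*} [TopologicalSpace M] [ChartedSpace (EuclideanSpace ℝ (Fin n)) M]
  [IsManifold (𝓡 n) ∞ M]

namespace AffineConnection

lemma zero_right (D : AffineConnection n M) (X : VField n M) : D X 0 = 0 := by
  have := D.add_right X 0 0
  rw [add_zero] at this
  exact left_eq_add.1 this

lemma neg_right (D : AffineConnection n M) (X Y : VField n M) : D X (-Y) = -D X Y := by
  have := D.add_right X Y (-Y)
  rw [add_neg_cancel, D.zero_right] at this
  exact (neg_eq_of_add_eq_zero_right this.symm).symm

@[ext]
lemma ext {D D' : AffineConnection n M} (h : ∀ X Y, D X Y = D' X Y) : D = D' := by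
  cases D
  cases D'
  congr
  funext X Y
  exact h X Y

end AffineConnection

variable [RiemannianBundle (fun x : M => TangentSpace (𝓡 n) x)]
  [IsContMDiffRiemannianBundle (𝓡 n) ∞ (EuclideanSpace ℝ (Fin n))
    (fun x : M => TangentSpace (𝓡 n) x)]

lemma finrank_tangentSpace (x : M) : Module.finrank ℝ (TangentSpace (𝓡 n) x) = n := by
  have : Module.finrank ℝ (EuclideanSpace ℝ (Fin n)) = n := by simp
  exact this

lemma VField.mdiff_inner (X Y : VField n M) (x : M) :
    MDifferentiableAt (𝓡 n) 𝓘(ℝ, ℝ) (fun y => (inner ℝ (X y) (Y y) : ℝ)) x :=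
  RiemGeom.mdiff_inner (X.smoothAt x).mdiff (Y.smoothAt x).mdiff

lemma dirDeriv_congr (W : VField n M) {f g : M → ℝ} (h : ∀ y, f y = g y) (x : M) :
    dirDeriv W f x = dirDeriv W g x := by
  rw [funext h]

lemma dirDeriv_add (W : VField n M) {f g : M → ℝ} {x : M}
    (hf : MDifferentiableAt (𝓡 n) 𝓘(ℝ, ℝ) f x) (hg : MDifferentiableAt (𝓡 n) 𝓘(ℝ, ℝ) g x) :
    dirDeriv W (fun y => f y + g y) x = dirDeriv W f x + dirDeriv W g x := by
  have := mvfderiv_fun_add hf hg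
  rw [dirDeriv, this]
  rfl

lemma dirDeriv_sub (W : VField n M) {f g : M → ℝ} {x : M}
    (hf : MDifferentiableAt (𝓡 n) 𝓘(ℝ, ℝ) f x) (hg : MDifferentiableAt (𝓡 n) 𝓘(ℝ, ℝ) g x) :
    dirDeriv W (fun y => f y - g y) x = dirDeriv W f x - dirDeriv W g x := by
  have := mvfderiv_fun_sub hf hg
  rw [dirDeriv, this]
  rfl

lemma dirDeriv_mul (W : VField n M) {f g : M → ℝ} {x : M}
    (hf : MDifferentiableAt (𝓡 n) 𝓘(ℝ, ℝ) f x) (hg : MDifferentiableAt (𝓡 n) 𝓘(ℝ, ℝ) g x) :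
    dirDeriv W (fun y => f y * g y) x = f x * dirDeriv W g x + g x * dirDeriv W f x := by
  have := mvfderiv_fun_mul hf hg
  rw [dirDeriv, this]
  simp [dirDeriv]

lemma dirDeriv_const (W : VField n M) (c : ℝ) (x : M) : dirDeriv W (fun _ => c) x = 0 := by
  rw [dirDeriv, mvfderiv_const]
  rfl

namespace AlmostHermitian

variable (h : AlmostHermitian n M)

lemma isOrthComplex (x : M) : IsOrthComplex (h.J x : TangentSpace (𝓡 n) x →ₗ[ℝ] _) :=
  ⟨h.sq x, h.isometry x⟩

@[simp]
lemma app_apply (X : VField n M) (x : M) : h.app X x = h.J x (X x) := rfl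

lemma app_app (X : VField n M) : h.app (h.app X) = -X := by
  ext1 x
  exact h.sq x (X x)

lemma inner_app_left (x : M) (v w : TangentSpace (𝓡 n) x) :
    (inner ℝ (h.J x v) w : ℝ) = -inner ℝ v (h.J x w) := (h.isOrthComplex x).inner_left v w

lemma nablaJ_apply (X Y : VField n M) (x : M) :
    h.nablaJ X Y x = leviCivita n M X (h.app Y) x - h.J x (leviCivita n M X Y x) := rfl

lemma canonicalConnection_apply (X Y : VField n M) (x : M) : h.canonicalConnection X Y x =
    leviCivita n M X Y x - (1 / 2 : ℝ) • h.J x (h.nablaJ X Y x) := rfl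

/-- This is `J² = -1` differentiated. -/
lemma nablaJ_app (X Y : VField n M) : h.nablaJ X (h.app Y) = -h.app (h.nablaJ X Y) := by
  ext1 x
  have e : leviCivita n M X (h.app (h.app Y)) x = -leviCivita n M X Y x := by
    rw [h.app_app, AffineConnection.neg_right]
    rfl
  change h.nablaJ X (h.app Y) x = -h.J x (h.nablaJ X Y x)
  rw [h.nablaJ_apply, h.nablaJ_apply, e, map_sub, h.sq]
  module

/-- Each `J` is skew and `∇` is metric, so `∇_X J` is skew. -/
lemma inner_nablaJ (X Y Z : VField n M) (x : M) :
    (inner ℝ (h.nablaJ X Y x) (Z x) : ℝ) = -inner ℝ (Y x) (h.nablaJ X Z x) := by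
  have e1 := leviCivita_isMetric X (h.app Y) Z x
  have e2 := leviCivita_isMetric X Y (h.app Z) x
  have e3 : dirDeriv X (fun y => (inner ℝ (h.app Y y) (Z y) : ℝ)) x +
      dirDeriv X (fun y => (inner ℝ (Y y) (h.app Z y) : ℝ)) x = 0 := by
    rw [← dirDeriv_add X (VField.mdiff_inner _ _ x) (VField.mdiff_inner _ _ x),
      ← dirDeriv_const X 0 x]
    refine dirDeriv_congr X (fun y => ?_) x
    rw [h.app_apply, h.app_apply, h.inner_app_left, neg_add_cancel]
  rw [e1, e2] at e3
  rw [h.nablaJ_apply, h.nablaJ_apply, inner_sub_left, inner_sub_right, h.inner_app_left]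
  rw [h.app_apply, h.app_apply, h.inner_app_left] at e3
  linarith

lemma nablaJ_add_left (X X' Y : VField n M) :
    h.nablaJ (X + X') Y = h.nablaJ X Y + h.nablaJ X' Y := by
  simp only [nablaJ, AffineConnection.add_left, app_add]
  abel

lemma nablaJ_fmul_left (f : C^∞⟮𝓡 n, M; ℝ⟯) (X Y : VField n M) :
    h.nablaJ (fmul f X) Y = fmul f (h.nablaJ X Y) := by
  ext1 x
  simp only [nablaJ, AffineConnection.smul_left, app_fmul]
  exact (smul_sub (f x) (leviCivita n M X (h.app Y) x) (h.app (leviCivita n M X Y) x)).symm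

lemma nablaJ_add_right (X Y Y' : VField n M) :
    h.nablaJ X (Y + Y') = h.nablaJ X Y + h.nablaJ X Y' := by
  simp only [nablaJ, AffineConnection.add_right, app_add]
  abel

lemma nablaJ_fmul_right (f : C^∞⟮𝓡 n, M; ℝ⟯) (X Y : VField n M) :
    h.nablaJ X (fmul f Y) = fmul f (h.nablaJ X Y) := by
  ext1 x
  have h1 := (leviCivita n M).leibniz X f Y x
  have h2 := (leviCivita n M).leibniz X f (h.app Y) x
  change h.nablaJ X (fmul f Y) x = f x • h.nablaJ X Y x
  rw [h.nablaJ_apply, app_fmul, h1, h2, map_add, map_smul, map_smul, h.nablaJ_apply, h.app_apply]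
  module

variable [T2Space M]

/-- `∇J` is `C^∞(M)`-linear in both slots, hence a tensor; this lets it be evaluated on single
tangent vectors. -/
lemma nablaJ_congr {X X' Y Y' : VField n M} {x : M} (hX : X x = X' x) (hY : Y x = Y' x) :
    h.nablaJ X Y x = h.nablaJ X' Y' x := by
  have e1 : h.nablaJ X Y x = h.nablaJ X' Y x :=
    eq_of_smul_linear (fun X => h.nablaJ X Y x)
      (fun X X' => by
        simp only [nablaJ_add_left]
        rfl)
      (fun f X => by
        simp only [nablaJ_fmul_left]
        rfl) hX
  have e2 : h.nablaJ X' Y x = h.nablaJ X' Y' x :=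
    eq_of_smul_linear (fun Y => h.nablaJ X' Y x)
      (fun X X' => by
        simp only [nablaJ_add_right]
        rfl)
      (fun f X => by
        simp only [nablaJ_fmul_right]
        rfl) hY
  rw [e1, e2]

lemma fmul_const_apply (c : ℝ) (X : VField n M) (x : M) :
    fmul (ContMDiffMap.const c) X x = c • X x := rfl

/-- The bilinear map `(X, Y) ↦ -J (∇_X J) Y` on the tangent space at `x`. -/
def torsionBilin (x : M) : TangentSpace (𝓡 n) x →ₗ[ℝ] TangentSpace (𝓡 n) x →ₗ[ℝ]
    TangentSpace (𝓡 n) x :=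
  LinearMap.mk₂ ℝ (fun v w => -h.J x (h.nablaJ (extendVec x v) (extendVec x w) x))
    (fun v v' w => by
      rw [h.nablaJ_congr (X := extendVec x (v + v')) (X' := extendVec x v + extendVec x v')
        (Y' := extendVec x w) (by simp) rfl, nablaJ_add_left, ← neg_add, ← map_add]
      rfl)
    (fun c v w => by
      rw [h.nablaJ_congr (X := extendVec x (c • v)) (X' := fmul (ContMDiffMap.const c) (extendVec x v)) (Y' := extendVec x w)
        (by rw [fmul_const_apply, extendVec_apply, extendVec_apply]) rfl, nablaJ_fmul_left,
        fmul_const_apply, map_smul, smul_neg])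
    (fun v w w' => by
      rw [h.nablaJ_congr (Y := extendVec x (w + w')) (Y' := extendVec x w + extendVec x w')
        (X' := extendVec x v) rfl (by simp), nablaJ_add_right, ← neg_add, ← map_add]
      rfl)
    (fun c v w => by
      rw [h.nablaJ_congr (Y := extendVec x (c • w)) (Y' := fmul (ContMDiffMap.const c) (extendVec x w)) (X' := extendVec x v) rfl
        (by rw [fmul_const_apply, extendVec_apply, extendVec_apply]), nablaJ_fmul_right,
        fmul_const_apply, map_smul, smul_neg])

lemma torsionBilin_apply (X Y : VField n M) (x : M) :
    h.torsionBilin x (X x) (Y x) = -h.J x (h.nablaJ X Y x) := by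
  change -h.J x (h.nablaJ (extendVec x (X x)) (extendVec x (Y x)) x) = _
  rw [h.nablaJ_congr (X' := X) (Y' := Y) (by simp) (by simp)]

/-- `J` and `∇_X J` are skew and anticommute, so their product is skew. Together with the nearly
Kähler identity this makes the trilinear form alternating. -/
lemma inner_torsionBilin_self (x : M) (v w : TangentSpace (𝓡 n) x) :
    (inner ℝ (h.torsionBilin x v w) w : ℝ) = 0 := by
  obtain ⟨X, rfl⟩ := exists_vfield_eq x v
  obtain ⟨Y, rfl⟩ := exists_vfield_eq x w
  rw [torsionBilin_apply, inner_neg_left, h.inner_app_left, neg_neg]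
  have e1 := h.inner_nablaJ X Y (h.app Y) x
  rw [nablaJ_app] at e1
  change (inner ℝ (h.nablaJ X Y x) (h.J x (Y x)) : ℝ) =
    -inner ℝ (Y x) (-h.J x (h.nablaJ X Y x)) at e1
  have e2 : (inner ℝ (Y x) (h.J x (h.nablaJ X Y x)) : ℝ) =
      -inner ℝ (h.nablaJ X Y x) (h.J x (Y x)) := by
    rw [real_inner_comm, h.inner_app_left]
  rw [inner_neg_right, neg_neg, e2] at e1
  linarith

variable {h} in
lemma IsNearlyKaehler.torsionBilin_self (hk : h.IsNearlyKaehler) (x : M)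
    (v : TangentSpace (𝓡 n) x) : h.torsionBilin x v v = 0 := by
  obtain ⟨X, rfl⟩ := exists_vfield_eq x v
  have e : (2 : ℝ) • h.nablaJ X X x = 0 := by
    rw [two_smul]
    conv_lhs => lhs; rw [hk X X]
    exact neg_add_cancel (h.nablaJ X X x)
  rw [torsionBilin_apply, (smul_eq_zero.1 e).resolve_left two_ne_zero, map_zero, neg_zero]

variable {h} in
/-- The torsion form of the canonical connection of a nearly Kähler manifold. -/
def IsNearlyKaehler.form (hk : h.IsNearlyKaehler) (x : M) :
    TangentSpace (𝓡 n) x [⋀^Fin 3]→ₗ[ℝ] ℝ :=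
  alternatingOfBilin (h.torsionBilin x) (hk.torsionBilin_self x) (h.inner_torsionBilin_self x)

variable {h} in
lemma IsNearlyKaehler.contract_form (hk : h.IsNearlyKaehler) (X Y : VField n M) (x : M) :
    contract (hk.form x) (X x) (Y x) = -h.J x (h.nablaJ X Y x) := by
  rw [IsNearlyKaehler.form, contract_alternatingOfBilin, torsionBilin_apply]

variable {h} in
lemma IsNearlyKaehler.isTorsionForm (hk : h.IsNearlyKaehler) :
    h.canonicalConnection.IsTorsionForm hk.form := by
  intro X Y Z x
  rw [← inner_contract, hk.contract_form, h.canonicalConnection_apply, inner_sub_left,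
    inner_smul_left, inner_neg_left, conj_trivial]
  ring

-- Antilinearity of `-J∘∇_X J` is inherited from the anticommutation of `∇_X J` with `J`.
variable {h} in
lemma IsNearlyKaehler.isCompatible (hk : h.IsNearlyKaehler) (x : M) :
    IsCompatible (hk.form x) (h.J x : TangentSpace (𝓡 n) x →ₗ[ℝ] _) := by
  refine ⟨h.isOrthComplex x, fun v w => ?_⟩
  obtain ⟨X, rfl⟩ := exists_vfield_eq x v
  obtain ⟨Y, rfl⟩ := exists_vfield_eq x w
  have e := hk.contract_form X (h.app Y) x
  rw [nablaJ_app] at e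
  change contract (hk.form x) (X x) (h.J x (Y x)) = -h.J x (contract (hk.form x) (X x) (Y x))
  rw [hk.contract_form]
  refine e.trans ?_
  change -h.J x (-h.J x (h.nablaJ X Y x)) = _
  rfl

end AlmostHermitian

end Connections

/-! ### Torsion of a naturally reductive connection. -/

section Parallel

variable {n : ℕ} {M : Type*} [TopologicalSpace M] [ChartedSpace (EuclideanSpace ℝ (Fin n)) M]
  [IsManifold (𝓡 n) ∞ M] [RiemannianBundle (fun x : M => TangentSpace (𝓡 n) x)]
  [IsContMDiffRiemannianBundle (𝓡 n) ∞ (EuclideanSpace ℝ (Fin n))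
    (fun x : M => TangentSpace (𝓡 n) x)] [T2Space M]
  {D : AffineConnection n M} {τ : Π x : M, TangentSpace (𝓡 n) x [⋀^Fin 3]→ₗ[ℝ] ℝ}

lemma AffineConnection.IsTorsionForm.apply (h : D.IsTorsionForm τ) (X Y : VField n M) (x : M) :
    D X Y x = leviCivita n M X Y x + (1 / 2 : ℝ) • contract (τ x) (X x) (Y x) := by
  refine ext_inner_right ℝ fun v => ?_
  obtain ⟨Z, rfl⟩ := exists_vfield_eq x v
  rw [h X Y Z x, inner_add_left, inner_smul_left, inner_contract, conj_trivial]
  ring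

/-- Levi-Civita contributes no torsion and the two halves of `τ` add up. Thus `τ_X Y` is a smooth
vector field, although no smoothness of `τ` is assumed. -/
lemma AffineConnection.IsTorsionForm.torsion_apply (h : D.IsTorsionForm τ) (X Y : VField n M)
    (x : M) : D.torsion X Y x = contract (τ x) (X x) (Y x) := by
  have e : leviCivita n M X Y x - leviCivita n M Y X x - bracket X Y x = 0 :=
    congrArg (fun V : VField n M => V x) (leviCivita_torsion X Y)
  change D X Y x - D Y X x - bracket X Y x = _
  rw [h.apply, h.apply, contract_swap (τ x) (X x) (Y x)]
  rw [sub_sub, sub_eq_zero] at e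
  rw [e]
  module

/-- The torsion form is parallel. -/
lemma IsNaturallyReductive.parallel (h : IsNaturallyReductive D τ) (W X Y : VField n M) (x : M) :
    D W (D.torsion X Y) x = contract (τ x) (D W X x) (Y x) + contract (τ x) (X x) (D W Y x) := by
  have e := congrArg (fun V : VField n M => V x) (h.1.parallel_torsion W X Y)
  change D W (D.torsion X Y) x - D.torsion (D W X) Y x - D.torsion X (D W Y) x = 0 at e
  rw [h.2.torsion_apply, h.2.torsion_apply, sub_sub, sub_eq_zero] at e
  exact e

lemma AffineConnection.IsMetric.inner_eq (h : D.IsMetric) (W X Y : VField n M) (x : M) :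
    dirDeriv W (fun y => inner ℝ (X y) (Y y)) x =
      inner ℝ (D W X x) (Y x) + inner ℝ (X x) (D W Y x) := h W X Y x

end Parallel

/-! ### Compatible structures are parallel, and the scale is constant. -/

section SixDim

variable {M : Type*} [TopologicalSpace M] [ChartedSpace (EuclideanSpace ℝ (Fin 6)) M]
  [IsManifold (𝓡 6) ∞ M] [RiemannianBundle (fun x : M => TangentSpace (𝓡 6) x)]
  [IsContMDiffRiemannianBundle (𝓡 6) ∞ (EuclideanSpace ℝ (Fin 6))
    (fun x : M => TangentSpace (𝓡 6) x)]

instance fact_finrank_tangentSpace (x : M) :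
    Fact (Module.finrank ℝ (TangentSpace (𝓡 6) x) = 6) := ⟨finrank_tangentSpace x⟩

variable [T2Space M] {D : AffineConnection 6 M}
  {τ : Π x : M, TangentSpace (𝓡 6) x [⋀^Fin 3]→ₗ[ℝ] ℝ} {h : AlmostHermitian 6 M}

/-- A compatible almost complex structure is parallel. -/
lemma IsNaturallyReductive.app_parallel (hD : IsNaturallyReductive D τ)
    (hc : ∀ x, IsCompatible (τ x) (h.J x : TangentSpace (𝓡 6) x →ₗ[ℝ] _)) (h0 : ∀ x, τ x ≠ 0)
    (W X : VField 6 M) : D W (h.app X) = h.app (D W X) := by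
  -- the case of a vector field that does not vanish at the point
  have key : ∀ (X : VField 6 M) (x : M), X x ≠ 0 → D W (h.app X) x = h.J x (D W X x) := by
    intro X x hX
    have hself : ∀ y (v : TangentSpace (𝓡 6) y), contract (τ y) v (h.J y v) = 0 := fun y =>
      (hc y).contract_J_self
    -- Differentiating `T(X, JX) = 0` with parallel torsion gives `τ(D_W X, JX) + τ(X, D_W(JX)) = 0`
    -- as vectors.
    have hT : D.torsion X (h.app X) = 0 := by
      ext1 y
      rw [hD.2.torsion_apply]
      exact hself y (X y)
    have e1 := hD.parallel W X (h.app X) x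
    rw [hT, D.zero_right] at e1
    change 0 = contract (τ x) (D W X x) (h.J x (X x)) + contract (τ x) (X x) (D W (h.app X) x) at e1
    -- Polarising `τ_v(Jv) = 0` identifies the first term with `-τ_X(J D_W X)`, so `D_W(JX) - J D_W
    -- X` lies in the kernel of `τ_X`.
    have e2 := hself x (X x + D W X x)
    rw [map_add, map_add, contract_add_left, contract_add_left, hself, hself, zero_add,
      add_zero] at e2
    have e3 : contract (τ x) (X x) (D W (h.app X) x - h.J x (D W X x)) = 0 := by
      have e4 : contract (τ x) (X x) (D W (h.app X) x) =
          -contract (τ x) (D W X x) (h.J x (X x)) := eq_neg_of_add_eq_zero_right e1.symm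
      have e5 : contract (τ x) (X x) (h.J x (D W X x)) =
          -contract (τ x) (D W X x) (h.J x (X x)) :=
        by first | exact eq_neg_of_add_eq_zero_left e2 | exact eq_neg_of_add_eq_zero_right e2
      rw [map_sub, e4, e5, sub_self]
    -- Differentiating `⟨JX, X⟩ = 0` and `|JX|² = |X|²` shows that this difference is orthogonal to
    -- `X` and `JX`, which span the kernel.
    have m1 := hD.1.isMetric.inner_eq W (h.app X) X x
    have m1' : dirDeriv W (fun y => (inner ℝ (h.app X y) (X y) : ℝ)) x = 0 :=
      (dirDeriv_congr W (fun y => (h.isOrthComplex y).inner_self (X y)) x).trans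
        (dirDeriv_const W 0 x)
    have m2 := hD.1.isMetric.inner_eq W (h.app X) (h.app X) x
    have m2' : dirDeriv W (fun y => (inner ℝ (h.app X y) (h.app X y) : ℝ)) x =
        dirDeriv W (fun y => (inner ℝ (X y) (X y) : ℝ)) x :=
      dirDeriv_congr W (fun y => h.isometry y (X y) (X y)) x
    rw [m1', h.app_apply, h.inner_app_left] at m1
    rw [m2', hD.1.isMetric.inner_eq, real_inner_comm (X x) (D W X x),
      real_inner_comm (h.app X x) (D W (h.app X) x), h.app_apply] at m2
    refine sub_eq_zero.1 ((hc x).eq_zero_of_contract_eq_zero (h0 x) e3 hX ?_ ?_)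
    · rw [inner_sub_right, real_inner_comm]
      linarith
    · change (inner ℝ (h.J x (X x)) (D W (h.app X) x - h.J x (D W X x)) : ℝ) = 0
      rw [inner_sub_right, h.isometry]
      linarith
  ext1 x
  rw [h.app_apply]
  by_cases hX : X x = 0
  -- At a zero of `X` the claim follows by additivity from the fields `U` and `X + U`, which do not
  -- vanish there.
  · obtain ⟨u, hu, -⟩ := exists_unit_orthogonal (T := TangentSpace (𝓡 6) x) (k := 0) ![]
      (by rw [finrank_tangentSpace]; omega)
    obtain ⟨U, rfl⟩ := exists_vfield_eq x u
    have hU : U x ≠ 0 := by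
      rw [← norm_ne_zero_iff, hu]
      exact one_ne_zero
    have k1 := key U x hU
    have k2 := key (X + U) x (by
      rw [ContMDiffSection.coe_add, Pi.add_apply, hX, zero_add]
      exact hU)
    rw [h.app_add, D.add_right, D.add_right, ContMDiffSection.coe_add, ContMDiffSection.coe_add,
      Pi.add_apply, Pi.add_apply, map_add, k1, add_left_inj] at k2
    exact k2
  · exact key X x hX

/-- The covariant derivative of a compatible almost complex structure. -/
lemma IsNaturallyReductive.nablaJ_apply (hD : IsNaturallyReductive D τ)
    (hc : ∀ x, IsCompatible (τ x) (h.J x : TangentSpace (𝓡 6) x →ₗ[ℝ] _)) (h0 : ∀ x, τ x ≠ 0)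
    (X Y : VField 6 M) (x : M) : h.nablaJ X Y x = h.J x (contract (τ x) (X x) (Y x)) := by
  have e := congrArg (fun V : VField 6 M => V x) (hD.app_parallel hc h0 X Y)
  change D X (h.app Y) x = h.J x (D X Y x) at e
  have ha : contract (τ x) (X x) (h.app Y x) = -h.J x (contract (τ x) (X x) (Y x)) :=
    (hc x).anti (X x) (Y x)
  rw [hD.2.apply, hD.2.apply, ha, map_add, map_smul] at e
  rw [AlmostHermitian.nablaJ_apply, sub_eq_iff_eq_add]
  rw [← eq_sub_iff_add_eq] at e
  rw [e]
  module

/-- From `∇J = J∘τ` the correction term `-½ J∘∇J` equals `½ τ`. -/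
theorem IsNaturallyReductive.canonicalConnection_eq (hD : IsNaturallyReductive D τ)
    (hc : ∀ x, IsCompatible (τ x) (h.J x : TangentSpace (𝓡 6) x →ₗ[ℝ] _)) (h0 : ∀ x, τ x ≠ 0) :
    h.canonicalConnection = D := by
  ext X Y : 3
  rename_i x
  rw [h.canonicalConnection_apply, hD.nablaJ_apply hc h0, h.sq, hD.2.apply]
  module

theorem IsNaturallyReductive.isNaturallyReductiveStrictNK [Nonempty M]
    (hD : IsNaturallyReductive D τ)
    (hc : ∀ x, IsCompatible (τ x) (h.J x : TangentSpace (𝓡 6) x →ₗ[ℝ] _)) (h0 : ∀ x, τ x ≠ 0) :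
    h.IsNaturallyReductiveStrictNK where
  nearlyKaehler X Y := by
    ext1 x
    change h.nablaJ X Y x = -h.nablaJ Y X x
    rw [hD.nablaJ_apply hc h0, hD.nablaJ_apply hc h0, contract_swap (τ x) (X x) (Y x), map_neg,
      neg_neg]
  strict := by
    obtain ⟨x⟩ := ‹Nonempty M›
    obtain ⟨v, w, hvw⟩ := exists_contract_ne_zero (h0 x)
    refine ⟨extendVec x v, extendVec x w, fun e => hvw ?_⟩
    have e1 := congrArg (fun V : VField 6 M => V x) e
    change h.nablaJ _ _ x = 0 at e1
    rw [hD.nablaJ_apply hc h0, extendVec_apply, extendVec_apply] at e1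
    rw [← neg_eq_zero, ← h.sq, e1, map_zero]
  ambroseSinger := by
    rw [hD.canonicalConnection_eq hc h0]
    exact hD.1

/-- The scale of a parallel form of type `(3, 0) + (0, 3)` is constant. -/
lemma IsNaturallyReductive.scale_eq [PreconnectedSpace M] (hD : IsNaturallyReductive D τ)
    (hc : ∀ x, IsCompatible (τ x) (h.J x : TangentSpace (𝓡 6) x →ₗ[ℝ] _)) (x y : M) :
    (hc x).scale = (hc y).scale := by
  have main : ∀ x, MDifferentiableAt (𝓡 6) 𝓘(ℝ, ℝ) (fun y => (hc y).scale) x ∧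
      ∀ W : VField 6 M, dirDeriv W (fun y => (hc y).scale) x = 0 := by
    intro x
    obtain ⟨u, hu, -⟩ := exists_unit_orthogonal (T := TangentSpace (𝓡 6) x) (k := 0) ![]
      (by rw [finrank_tangentSpace]; omega)
    obtain ⟨v, hv, huv⟩ := exists_unit_orthogonal ![u, h.J x u]
      (by rw [finrank_tangentSpace]; omega)
    obtain ⟨X, rfl⟩ := exists_vfield_eq x u
    obtain ⟨Y, rfl⟩ := exists_vfield_eq x v
    have hXY : (inner ℝ (X x) (Y x) : ℝ) = 0 := huv 0
    have hJXY : (inner ℝ (h.app X x) (Y x) : ℝ) = 0 := huv 1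
    -- The norm identity reads `F = scale · Q`, with `Q x = 1` by the choice of `X` and `Y`. Hence
    -- the scale is `F / Q` near `x`, and is differentiable there.
    let F : M → ℝ := fun y => inner ℝ (D.torsion X Y y) (D.torsion X Y y)
    let Q : M → ℝ := fun y => (inner ℝ (X y) (X y) : ℝ) * inner ℝ (Y y) (Y y)
      - (inner ℝ (X y) (Y y) : ℝ) * inner ℝ (X y) (Y y)
      - (inner ℝ (h.app X y) (Y y) : ℝ) * inner ℝ (h.app X y) (Y y)
    have hF : MDifferentiableAt (𝓡 6) 𝓘(ℝ, ℝ) F x := VField.mdiff_inner _ _ x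
    have d1 : MDifferentiableAt (𝓡 6) 𝓘(ℝ, ℝ)
        (fun y => (inner ℝ (X y) (X y) : ℝ) * inner ℝ (Y y) (Y y)) x := (VField.mdiff_inner X X x).mul (VField.mdiff_inner Y Y x)
    have d2 : MDifferentiableAt (𝓡 6) 𝓘(ℝ, ℝ)
        (fun y => (inner ℝ (X y) (Y y) : ℝ) * inner ℝ (X y) (Y y)) x := (VField.mdiff_inner X Y x).mul (VField.mdiff_inner X Y x)
    have d3 : MDifferentiableAt (𝓡 6) 𝓘(ℝ, ℝ)
        (fun y => (inner ℝ (h.app X y) (Y y) : ℝ) * inner ℝ (h.app X y) (Y y)) x := (VField.mdiff_inner (h.app X) Y x).mul (VField.mdiff_inner (h.app X) Y x)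
    have d12 : MDifferentiableAt (𝓡 6) 𝓘(ℝ, ℝ)
        (fun y => (inner ℝ (X y) (X y) : ℝ) * inner ℝ (Y y) (Y y)
          - (inner ℝ (X y) (Y y) : ℝ) * inner ℝ (X y) (Y y)) x := d1.sub d2
    have hQ : MDifferentiableAt (𝓡 6) 𝓘(ℝ, ℝ) Q x := d12.sub d3
    have hQx : Q x = 1 := by
      simp only [Q, hXY, hJXY, real_inner_self_eq_norm_sq, hu, hv]
      norm_num
    have hFQ : ∀ y, F y = (hc y).scale * Q y := by
      intro y
      have := (hc y).norm_contract_sq (X y) (Y y)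
      rw [← hD.2.torsion_apply, ← real_inner_self_eq_norm_sq, ← real_inner_self_eq_norm_sq,
        ← real_inner_self_eq_norm_sq, pow_two, pow_two] at this
      exact this
    have hp : MDifferentiableAt (𝓡 6) 𝓘(ℝ, ℝ) (fun y => (hc y).scale) x := by
      have hdiv : MDifferentiableAt (𝓡 6) 𝓘(ℝ, ℝ) (fun y => F y * (Q y)⁻¹) x :=
        hF.mul ((differentiableAt_inv (by rw [hQx]; exact one_ne_zero)).mdifferentiableAt.comp x hQ)
      refine hdiv.congr_of_eventuallyEq ?_
      have hne : ∀ᶠ y in 𝓝 x, Q y ≠ 0 :=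
        hQ.continuousAt.eventually_ne (by rw [hQx]; exact one_ne_zero)
      filter_upwards [hne] with y hy
      rw [hFQ, mul_inv_cancel_right₀ hy]
    refine ⟨hp, fun W => ?_⟩
    have e := dirDeriv_congr W hFQ x
    rw [dirDeriv_mul W hp hQ, hQx, one_mul] at e
    -- Parallel torsion differentiates `F` through `D_W X` and `D_W Y` only; the polarised norm
    -- identity turns this into `scale · W Q`. The product rule then leaves no room for a derivative
    -- of the scale.
    have eF : dirDeriv W F x = 2 * (hc x).scale * (inner ℝ (X x) (D W X x)
        + inner ℝ (Y x) (D W Y x)) := by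
      have e1 := hD.1.isMetric.inner_eq W (D.torsion X Y) (D.torsion X Y) x
      rw [real_inner_comm (D.torsion X Y x), hD.parallel, hD.2.torsion_apply, inner_add_right] at e1
      have p1 := (hc x).inner_contract_contract (X x) (Y x) (D W Y x)
      have p2 := (hc x).inner_contract_contract (Y x) (X x) (D W X x)
      have hJYX : (inner ℝ (h.J x (Y x)) (X x) : ℝ) = 0 := by
        rw [h.inner_app_left, real_inner_comm, ← h.app_apply, hJXY, neg_zero]
      rw [h.app_apply] at hJXY
      simp only [ContinuousLinearMap.coe_coe, hXY, hJXY, hJYX, real_inner_comm (X x) (Y x), hu, hv]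
        at p1 p2
      rw [contract_swap (τ x) (X x) (Y x), contract_swap (τ x) (D W X x) (Y x), inner_neg_neg] at p2
      refine e1.trans ?_
      linarith
    have eQ : dirDeriv W Q x = 2 * (inner ℝ (X x) (D W X x) + inner ℝ (Y x) (D W Y x)) := by
      rw [dirDeriv_sub W d12 d3, dirDeriv_sub W d1 d2,
        dirDeriv_mul W (VField.mdiff_inner X X x) (VField.mdiff_inner Y Y x),
        dirDeriv_mul W (VField.mdiff_inner X Y x) (VField.mdiff_inner X Y x),
        dirDeriv_mul W (VField.mdiff_inner (h.app X) Y x) (VField.mdiff_inner (h.app X) Y x),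
        hXY, hJXY, hD.1.isMetric.inner_eq, hD.1.isMetric.inner_eq,
        real_inner_self_eq_norm_sq, real_inner_self_eq_norm_sq, hu, hv,
        real_inner_comm (X x), real_inner_comm (Y x)]
      ring
    rw [eF, eQ] at e
    linarith
  refine eq_of_mvfderiv_eq_zero (n := 6) (fun x => (main x).1) (fun x => ?_) x y
  ext v
  have := (main x).2 (extendVec x v)
  rwa [dirDeriv, extendVec_apply] at this

end SixDim

/-! ### Choosing the sign of a compatible structure. -/

section

variable {T : Type*} [NormedAddCommGroup T] [InnerProductSpace ℝ T] [FiniteDimensional ℝ T]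
  {σ : T [⋀^Fin 3]→ₗ[ℝ] ℝ} {J : T →ₗ[ℝ] T}

lemma IsCompatible.neg (h : IsCompatible σ J) : IsCompatible σ (-J) where
  sq v := by simp [h.sq]
  isometry v w := by simp [h.isometry]
  anti X Y := by simp [h.anti]

variable [Fact (Module.finrank ℝ T = 6)]

lemma IsOrthComplex.exists_isAdaptedBasis (h : IsOrthComplex J) :
    ∃ b : Module.Basis (Fin 6) ℝ T, IsAdaptedBasis J b := by
  obtain ⟨b, u, v, w, hb⟩ := IsCompatible.exists_adapted_basis' h
  refine ⟨b.toBasis, ?_⟩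
  simp [IsAdaptedBasis, hb, adaptedVec]

/-- The norm identity involves the complex structure only through a square, so it does not see the
sign. -/
lemma IsCompatible.scale_eq_of_eq_or_eq_neg {J' : T →ₗ[ℝ] T} (h : IsCompatible σ J)
    (h' : IsCompatible σ J') (hJ : J' = J ∨ J' = -J) : h'.scale = h.scale := by
  have hfin : Module.finrank ℝ T = 6 := Fact.out
  obtain ⟨u, hu, -⟩ := exists_unit_orthogonal (T := T) (k := 0) ![] (by omega)
  obtain ⟨v, hv, huv⟩ := exists_unit_orthogonal ![u, J u] (by omega)
  have h1 : (inner ℝ u v : ℝ) = 0 := huv 0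
  have h2 : (inner ℝ (J u) v : ℝ) = 0 := huv 1
  have h3 : (inner ℝ (J' u) v : ℝ) = 0 := by
    rcases hJ with rfl | rfl
    · exact h2
    · rw [LinearMap.neg_apply, inner_neg_left, h2, neg_zero]
  have e := h.norm_contract_sq u v
  rw [h'.norm_contract_sq u v, h1, h2, h3, hu, hv] at e
  simpa using e

/-- `J` and `-J` are both compatible and induce opposite orientations, so one of them induces `o`.
-/
lemma exists_isCompatible_oriented (hg : IsGeneralizedVectorCrossProduct σ)
    (o : Orientation ℝ T (Fin 6)) : ∃ J : T →ₗ[ℝ] T, IsCompatible σ J ∧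
      ∃ b : Module.Basis (Fin 6) ℝ T, IsAdaptedBasis J b ∧ b.orientation = o := by
  obtain ⟨J, hJ⟩ := exists_isCompatible hg
  obtain ⟨b, hb⟩ := hJ.toIsOrthComplex.exists_isAdaptedBasis
  obtain ⟨b', hb'⟩ := hJ.neg.toIsOrthComplex.exists_isAdaptedBasis
  by_cases h : b.orientation = o
  · exact ⟨J, hJ, b, hb, h⟩
  · refine ⟨-J, hJ.neg, b', hb', ?_⟩
    have e1 := (b.orientation.eq_or_eq_neg o (by simp [(Fact.out : Module.finrank ℝ T = 6)])).resolve_left h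
    have e2 := (b.orientation.eq_or_eq_neg b'.orientation
      (by simp [(Fact.out : Module.finrank ℝ T = 6)])).resolve_left (hb.orientation_ne hJ.sq hb')
    rw [e1] at e2
    exact (neg_injective e2).symm

end

/-! ### Smoothness of the oriented compatible structure. -/

section SixDim

variable {M : Type*} [TopologicalSpace M] [ChartedSpace (EuclideanSpace ℝ (Fin 6)) M]
  [IsManifold (𝓡 6) ∞ M] [RiemannianBundle (fun x : M => TangentSpace (𝓡 6) x)]
  [IsContMDiffRiemannianBundle (𝓡 6) ∞ (EuclideanSpace ℝ (Fin 6))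
    (fun x : M => TangentSpace (𝓡 6) x)] [T2Space M] {D : AffineConnection 6 M}
  {τ : Π x : M, TangentSpace (𝓡 6) x [⋀^Fin 3]→ₗ[ℝ] ℝ}
  {J : Π x : M, TangentSpace (𝓡 6) x →ₗ[ℝ] TangentSpace (𝓡 6) x}

/-- `J` is not known to be smooth here. The vector `W = τ_X Y` is orthogonal to `X` and `JX`, so the
norm identity for `X` and `W` contains no `J` and expresses the scale as a quotient of smooth
functions. -/
lemma contMDiffAt_scale (hτ : D.IsTorsionForm τ) (hc : ∀ x, IsCompatible (τ x) (J x))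
    (h0 : ∀ x, τ x ≠ 0) (x : M) :
    ContMDiffAt (𝓡 6) 𝓘(ℝ, ℝ) ∞ (fun y => (hc y).scale) x := by
  obtain ⟨v, w, hvw⟩ := exists_contract_ne_zero (h0 x)
  obtain ⟨X, rfl⟩ := exists_vfield_eq x v
  obtain ⟨Y, rfl⟩ := exists_vfield_eq x w
  let W := D.torsion X Y
  have hW : ∀ y, W y = contract (τ y) (X y) (Y y) := hτ.torsion_apply X Y
  let G : M → ℝ := fun y => inner ℝ (D.torsion X W y) (D.torsion X W y)
  let H : M → ℝ := fun y => (inner ℝ (X y) (X y) : ℝ) * inner ℝ (W y) (W y)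
  have hG : ContMDiffAt (𝓡 6) 𝓘(ℝ, ℝ) ∞ G x :=
    ((D.torsion X W).smoothAt x).inner ((D.torsion X W).smoothAt x)
  have hH : ContMDiffAt (𝓡 6) 𝓘(ℝ, ℝ) ∞ H x :=
    ((X.smoothAt x).inner (X.smoothAt x)).mul ((W.smoothAt x).inner (W.smoothAt x))
  have hGH : ∀ y, G y = (hc y).scale * H y := by
    intro y
    have e := (hc y).norm_contract_sq (X y) (W y)
    have e1 : (inner ℝ (X y) (W y) : ℝ) = 0 := by
      rw [hW, real_inner_comm, inner_contract, alternating_self_outer]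
    have e2 : (inner ℝ (J y (X y)) (W y) : ℝ) = 0 := by
      rw [hW, real_inner_comm, inner_contract_skew, (hc y).contract_J_self, inner_zero_right,
        neg_zero]
    rw [e1, e2, ← hτ.torsion_apply, ← real_inner_self_eq_norm_sq, ← real_inner_self_eq_norm_sq,
      ← real_inner_self_eq_norm_sq] at e
    refine e.trans ?_
    simp only [H]
    ring
  have hHx : H x ≠ 0 := by
    refine mul_ne_zero (inner_self_ne_zero.2 fun h => hvw ?_) (inner_self_ne_zero.2 ?_)
    · rw [h, contract_zero_left]
    · rw [hW]
      exact hvw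
  refine (hG.mul (hH.inv₀ hHx)).congr_of_eventuallyEq ?_
  filter_upwards [hH.continuousAt.eventually_ne hHx] with y hy
  change _ = G y * (H y)⁻¹
  rw [hGH, mul_inv_cancel_right₀ hy]

/-- Up to sign, a compatible almost complex structure is smooth near every point. -/
lemma exists_smooth_sign (hτ : D.IsTorsionForm τ) (hc : ∀ x, IsCompatible (τ x) (J x))
    (h0 : ∀ x, τ x ≠ 0) (x : M) :
    ∃ J' : Π y : M, TangentSpace (𝓡 6) y →ₗ[ℝ] TangentSpace (𝓡 6) y, J' x = J x ∧
      (∀ y, J' y = J y ∨ J' y = -J y) ∧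
      ∀ Y : VField 6 M, ∃ V : VField 6 M, ∀ᶠ y in 𝓝 x, V y = J' y (Y y) := by
  obtain ⟨u, hu, -⟩ := exists_unit_orthogonal (T := TangentSpace (𝓡 6) x) (k := 0) ![]
    (by rw [finrank_tangentSpace]; omega)
  obtain ⟨X, rfl⟩ := exists_vfield_eq x u
  obtain ⟨Z, hZ⟩ := exists_vfield_eq x (J x (X x))
  let c : M → ℝ := fun y => inner ℝ (J y (X y)) (Z y)
  have hXx : (inner ℝ (X x) (X x) : ℝ) = 1 := by
    rw [real_inner_self_eq_norm_sq, hu, one_pow]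
  have hcx : c x = 1 := by
    simp only [c]
    rw [hZ, (hc x).isometry, hXx]
  let p : C^∞⟮𝓡 6, M; ℝ⟯ := ⟨fun y => (hc y).scale, contMDiffAt_scale hτ hc h0⟩
  have hp : ∀ y, 0 < p y := fun y => (hc y).scale_pos (h0 y)
  let a (X Y : VField 6 M) : C^∞⟮𝓡 6, M; ℝ⟯ :=
    ⟨fun y => inner ℝ (X y) (Y y), fun y => (X.smoothAt y).inner (Y.smoothAt y)⟩
  -- The formula for `τ_X²` solved for its last term: the expression is visibly smooth and equals `p
  -- ⟨JX, Z⟩ JX`.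
  let V : VField 6 M := fmul p (fmul (a X X) Z - fmul (a X Z) X) + D.torsion X (D.torsion X Z)
  have hV : ∀ y, V y = (p y * c y) • J y (X y) := by
    intro y
    change p y • ((inner ℝ (X y) (X y) : ℝ) • Z y - (inner ℝ (X y) (Z y) : ℝ) • X y)
      + D.torsion X (D.torsion X Z) y = _
    rw [hτ.torsion_apply, hτ.torsion_apply, (hc y).contract_contract, real_inner_self_eq_norm_sq]
    change p y • _ + -(p y • _) = _
    simp only [c]
    module
  -- The sign makes `⟨J'X, Z⟩` nonnegative, so that `J'X` is `V` divided by `|p c|` near `x`, hence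
  -- smooth.
  let J' : Π y : M, TangentSpace (𝓡 6) y →ₗ[ℝ] TangentSpace (𝓡 6) y := fun y =>
    if 0 ≤ c y then J y else -J y
  have hJ' : ∀ y, J' y = J y ∨ J' y = -J y := fun y => ite_eq_or_eq _ _ _
  have hc' : ∀ y, IsCompatible (τ y) (J' y) := fun y => by
    rcases hJ' y with e | e <;> rw [e]
    exacts [hc y, (hc y).neg]
  -- the smooth function `p ^ 2 * c ^ 2`
  let q : C^∞⟮𝓡 6, M; ℝ⟯ := p * a V Z
  have hq : ∀ y, q y = (p y * c y) ^ 2 := by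
    intro y
    change p y * (inner ℝ (V y) (Z y) : ℝ) = _
    rw [hV, inner_smul_left, conj_trivial]
    simp only [c]
    ring
  have hqx : ∀ᶠ y in 𝓝 x, q y ≠ 0 := by
    refine q.contMDiff.continuous.continuousAt.eventually_ne ?_
    rw [hq, hcx, mul_one]
    exact pow_ne_zero 2 (hp x).ne'
  obtain ⟨X', hX'⟩ : ∃ X' : VField 6 M, ∀ᶠ y in 𝓝 x, X' y = J' y (X y) := by
    obtain ⟨X', hX'⟩ := exists_vfield_eventuallyEq (x := x)
      (Z := fun y => (Real.sqrt (q y))⁻¹ • V y) (by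
        filter_upwards [hqx] with y hy
        have h1 : ContMDiffAt (𝓡 6) 𝓘(ℝ, ℝ) ∞ (fun z => Real.sqrt (q z)) y :=
          (Real.contDiffAt_sqrt hy).contMDiffAt.comp y q.contMDiff.contMDiffAt
        have h2 : Real.sqrt (q y) ≠ 0 := by
          rw [hq] at hy ⊢
          rw [Real.sqrt_sq_eq_abs]
          exact abs_ne_zero.2 (pow_ne_zero_iff two_ne_zero |>.1 hy)
        exact (h1.inv₀ h2).smul_section (V.smoothAt y))
    refine ⟨X', ?_⟩
    filter_upwards [hX', hqx] with y hy hqy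
    rw [hq] at hqy
    have hcy : c y ≠ 0 := right_ne_zero_of_mul (pow_ne_zero_iff two_ne_zero |>.1 hqy)
    have hpy := hp y
    rw [hy, hq, Real.sqrt_sq_eq_abs, hV, smul_smul, abs_mul, abs_of_pos hpy]
    by_cases h : 0 ≤ c y
    · simp only [J', if_pos h, abs_of_nonneg h]
      rw [inv_mul_cancel₀ (mul_ne_zero hpy.ne' hcy), one_smul]
    · simp only [J', if_neg h, abs_of_neg (not_le.1 h)]
      rw [mul_neg, inv_neg, neg_mul, inv_mul_cancel₀ (mul_ne_zero hpy.ne' hcy), neg_one_smul,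
        LinearMap.neg_apply]
  refine ⟨J', ?_, hJ', fun Y => ?_⟩
  · simp only [J', hcx, if_pos zero_le_one]
  have hne : ∀ᶠ y in 𝓝 x, (p * a X X) y ≠ 0 := by
    refine (p * a X X).contMDiff.continuous.continuousAt.eventually_ne ?_
    change p x * (inner ℝ (X x) (X x) : ℝ) ≠ 0
    rw [hXx, mul_one]
    exact (hp x).ne'
  -- With `X' = J'X` one has `τ_{X'} τ_X Y = -J' τ_X² Y`. Expanding `τ_X²` and removing the terms in
  -- `X` and `X'` leaves `p |X|² J'Y`.
  let N : VField 6 M := fmul p (fmul (a X Y) X' - fmul (a X' Y) X) + D.torsion X' (D.torsion X Y)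
  obtain ⟨V', hV'⟩ := exists_vfield_eventuallyEq (x := x)
    (Z := fun y => ((p * a X X) y)⁻¹ • N y) (by
      filter_upwards [hne] with y hy
      exact (ContMDiffAt.inv₀ (p * a X X).contMDiff.contMDiffAt hy).smul_section (N.smoothAt y))
  refine ⟨V', ?_⟩
  filter_upwards [hV', hne, hX'] with y hy hney hXy
  rw [hy, inv_smul_eq_iff₀ hney]
  change p y • ((inner ℝ (X y) (Y y) : ℝ) • X' y - (inner ℝ (X' y) (Y y) : ℝ) • X y)
      + D.torsion X' (D.torsion X Y) y = (p y * (inner ℝ (X y) (X y) : ℝ)) • _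
  have hscale : (hc' y).scale = p y := by
    exact (hc y).scale_eq_of_eq_or_eq_neg (hc' y) (hJ' y)
  rw [hτ.torsion_apply, hτ.torsion_apply, hXy, (hc' y).anti_left, (hc' y).contract_contract,
    real_inner_self_eq_norm_sq, map_neg, neg_neg, map_smul, map_sub, map_sub, map_smul, map_smul,
    map_smul, (hc' y).sq, hscale]
  module

/-- A compatible almost complex structure that induces a given orientation is smooth. -/
lemma smoothAt_of_oriented (hτ : D.IsTorsionForm τ) (hc : ∀ x, IsCompatible (τ x) (J x))
    (h0 : ∀ x, τ x ≠ 0) (o : ManifoldOrientation 6 M)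
    (ho : ∀ x, ∃ b : Module.Basis (Fin 6) ℝ (TangentSpace (𝓡 6) x),
      IsAdaptedBasis (J x) b ∧ b.orientation = o.orientation x) (Y : VField 6 M) (x : M) :
    SmoothAt (fun y => J y (Y y)) x := by
  obtain ⟨J', hJx, hJ', hsmooth⟩ := exists_smooth_sign hτ hc h0 x
  obtain ⟨b, hb, hbo⟩ := ho x
  obtain ⟨U, hU⟩ := exists_vfield_eq x (b 0)
  obtain ⟨V, hV⟩ := exists_vfield_eq x (b 2)
  obtain ⟨W, hW⟩ := exists_vfield_eq x (b 4)
  obtain ⟨U', hU'⟩ := hsmooth U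
  obtain ⟨V', hV'⟩ := hsmooth V
  obtain ⟨W', hW'⟩ := hsmooth W
  -- A smooth frame equal to `b` at `x` and adapted to `J'` at all nearby points.
  let e : Fin 6 → VField 6 M := ![U, U', V, V', W, W']
  have hex : (fun i => e i x) = b := by
    obtain ⟨h1, h3, h5⟩ := hb
    funext i
    fin_cases i
    · exact hU
    · exact hU'.self_of_nhds.trans (by rw [hU, hJx, ← h1]; rfl)
    · exact hV
    · exact hV'.self_of_nhds.trans (by rw [hV, hJx, ← h3]; rfl)
    · exact hW
    · exact hW'.self_of_nhds.trans (by rw [hW, hJx, ← h5]; rfl)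
  obtain ⟨s, hs⟩ := o.exists_frame x
  have hdet : ContMDiffAt (𝓡 6) 𝓘(ℝ, ℝ) ∞
      (fun y => (Matrix.of fun i j => (inner ℝ (s i y) (e j y) : ℝ)).det) x :=
    contMDiffAt_det fun i j => ((s i).smoothAt x).inner ((e j).smoothAt x)
  have hpos : 0 < (Matrix.of fun i j => (inner ℝ (s i x) (e j x) : ℝ)).det := by
    obtain ⟨t, ht, hto⟩ := hs.self_of_nhds
    have := det_inner_pos_of_orientation_eq (hto.trans hbo.symm)
    rw [← hex] at this
    simpa only [ht] using this
  -- By continuity `e` stays positive for `o`. Where `J' = -J` it would be adapted to `-J`, hence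
  -- negative.
  have key : ∀ᶠ y in 𝓝 x, J' y = J y := by
    filter_upwards [hs, hdet.continuousAt.eventually_const_lt hpos, hU', hV', hW']
      with y hsy hy hUy hVy hWy
    refine (hJ' y).resolve_right fun hneg => ?_
    obtain ⟨t, ht, hto⟩ := hsy
    simp only [← ht] at hy
    obtain ⟨b', hb', hbo'⟩ := exists_basis_of_det_inner_pos t hy
    obtain ⟨b₀, hb₀, hbo₀⟩ := ho y
    refine hb₀.orientation_ne (hc y).sq (b' := b') ?_ (hbo₀.trans (hbo'.trans hto).symm)
    rw [← hneg]
    simp only [IsAdaptedBasis, hb']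
    exact ⟨hUy, hVy, hWy⟩
  obtain ⟨V₁, hV₁⟩ := hsmooth Y
  refine ContMDiffAt.congr_of_eventuallyEq (V₁.smoothAt x) ?_
  filter_upwards [key, hV₁] with y h1 h2
  rw [h2, h1]

/-- The almost Hermitian structure defined by the torsion form and an orientation. -/
theorem exists_almostHermitian (hτ : D.IsTorsionForm τ)
    (hg : ∀ x, IsGeneralizedVectorCrossProduct (τ x)) (o : ManifoldOrientation 6 M) :
    ∃ h : AlmostHermitian 6 M,
      (∀ x, IsCompatible (τ x) (h.J x : TangentSpace (𝓡 6) x →ₗ[ℝ] _)) ∧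
      ∀ x, ∃ b : Module.Basis (Fin 6) ℝ (TangentSpace (𝓡 6) x),
        IsAdaptedBasis (h.J x : TangentSpace (𝓡 6) x →ₗ[ℝ] _) b ∧
          b.orientation = o.orientation x := by
  choose J hc ho using fun x => exists_isCompatible_oriented (hg x) (o.orientation x)
  refine ⟨⟨⟨fun x => (J x).toContinuousLinearMap, fun x => contMDiffAt_endomorphism fun X =>
    smoothAt_of_oriented hτ hc (fun x => (hg x).1) o ho X x⟩, fun x => (hc x).sq,
    fun x => (hc x).isometry⟩, hc, ho⟩

end SixDim

/-! ### The bijection. -/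

section SixDim

variable {M : Type*} [TopologicalSpace M] [ChartedSpace (EuclideanSpace ℝ (Fin 6)) M]
  [IsManifold (𝓡 6) ∞ M] [RiemannianBundle (fun x : M => TangentSpace (𝓡 6) x)]

@[ext]
lemma ManifoldOrientation.ext {n : ℕ} {M : Type*} [TopologicalSpace M]
    [ChartedSpace (EuclideanSpace ℝ (Fin n)) M] [IsManifold (𝓡 n) ∞ M]
    {o o' : ManifoldOrientation n M} (h : ∀ x, o.orientation x = o'.orientation x) : o = o' := by
  cases o
  cases o'
  congr
  funext x
  exact h x

namespace AlmostHermitian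

variable [IsContMDiffRiemannianBundle (𝓡 6) ∞ (EuclideanSpace ℝ (Fin 6))
    (fun x : M => TangentSpace (𝓡 6) x)] (h : AlmostHermitian 6 M)

lemma exists_isAdaptedBasis (x : M) : ∃ b : Module.Basis (Fin 6) ℝ (TangentSpace (𝓡 6) x),
    IsAdaptedBasis (h.J x : TangentSpace (𝓡 6) x →ₗ[ℝ] _) b :=
  (h.isOrthComplex x).exists_isAdaptedBasis

variable {h} in
@[ext]
lemma ext {h' : AlmostHermitian 6 M} (e : ∀ x v, h.J x v = h'.J x v) : h = h' := by
  have : h.J = h'.J := by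
    ext x v
    exact e x v
  cases h
  cases h'
  congr

variable [T2Space M]

/-- The orientation induced by an almost complex structure. -/
def inducedOrientation : ManifoldOrientation 6 M where
  orientation x := (h.exists_isAdaptedBasis x).choose.orientation
  exists_frame x := by
    obtain ⟨b, hb1, hb3, hb5⟩ := h.exists_isAdaptedBasis x
    obtain ⟨U, hU⟩ := exists_vfield_eq x (b 0)
    obtain ⟨V, hV⟩ := exists_vfield_eq x (b 2)
    obtain ⟨W, hW⟩ := exists_vfield_eq x (b 4)
    let e : Fin 6 → VField 6 M := ![U, h.app U, V, h.app V, W, h.app W]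
    have hex : (fun i => e i x) = b := by
      funext i
      fin_cases i
      · exact hU
      · exact (h.app_apply U x).trans (by rw [hU]; exact hb1.symm)
      · exact hV
      · exact (h.app_apply V x).trans (by rw [hV]; exact hb3.symm)
      · exact hW
      · exact (h.app_apply W x).trans (by rw [hW]; exact hb5.symm)
    have hdet : ContMDiffAt (𝓡 6) 𝓘(ℝ, ℝ) ∞
        (fun y => (Matrix.gram ℝ fun i => e i y).det) x :=
      contMDiffAt_det fun i j => ((e i).smoothAt x).inner ((e j).smoothAt x)
    have hne : (Matrix.gram ℝ fun i => e i x).det ≠ 0 := by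
      rw [hex]
      exact (det_gram_basis_pos b).ne'
    refine ⟨e, ?_⟩
    filter_upwards [hdet.continuousAt.eventually_ne hne] with y hy
    have hli : LinearIndependent ℝ fun i => e i y :=
      Matrix.det_gram_ne_zero_iff_linearIndependent.1 hy
    let b' := basisOfLinearIndependentOfCardEqFinrank hli (by
      rw [finrank_tangentSpace, Fintype.card_fin])
    have hb' : ∀ i, b' i = e i y := fun i => by
      simp only [b', coe_basisOfLinearIndependentOfCardEqFinrank]
    refine ⟨b', hb', ?_⟩
    refine IsAdaptedBasis.orientation_eq (h.sq y) ?_ (h.exists_isAdaptedBasis y).choose_spec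
    simp only [IsAdaptedBasis, hb']
    exact ⟨rfl, rfl, rfl⟩

lemma inducesOrientation_inducedOrientation : h.InducesOrientation h.inducedOrientation :=
  fun x _ h1 h3 h5 => IsAdaptedBasis.orientation_eq (h.sq x) ⟨h1, h3, h5⟩
    (h.exists_isAdaptedBasis x).choose_spec

variable {h}

lemma IsNaturallyReductiveStrictNK.isNaturallyReductive (hk : h.IsNaturallyReductiveStrictNK) :
    IsNaturallyReductive h.canonicalConnection hk.nearlyKaehler.form :=
  ⟨hk.ambroseSinger, hk.nearlyKaehler.isTorsionForm⟩

/-- Strictness only gives one point where `∇J` is nonzero. If `τ` vanished at `x`, the scale would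
vanish at `x`, hence everywhere since it is constant, and `∇J` would be identically zero. -/
lemma IsNaturallyReductiveStrictNK.form_ne_zero [PreconnectedSpace M]
    (hk : h.IsNaturallyReductiveStrictNK) (x : M) : hk.nearlyKaehler.form x ≠ 0 := by
  intro h0
  obtain ⟨X, Y, hXY⟩ := hk.strict
  have hs : ∀ y, (hk.nearlyKaehler.isCompatible y).scale = 0 := fun y => by
    rw [hk.isNaturallyReductive.scale_eq hk.nearlyKaehler.isCompatible y x]
    by_contra hne
    obtain ⟨u, hu, -⟩ := exists_unit_orthogonal (T := TangentSpace (𝓡 6) x) (k := 0) ![]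
      (by rw [finrank_tangentSpace]; omega)
    obtain ⟨v, hv, huv⟩ := exists_unit_orthogonal ![u, h.J x u]
      (by rw [finrank_tangentSpace]; omega)
    have e := (hk.nearlyKaehler.isCompatible x).norm_contract_sq u v
    have h1 : (inner ℝ u v : ℝ) = 0 := huv 0
    have h2 : (inner ℝ (h.J x u) v : ℝ) = 0 := huv 1
    have h3 : contract (hk.nearlyKaehler.form x) u v = 0 := by
      refine ext_inner_right ℝ fun w => ?_
      rw [inner_contract, h0, inner_zero_left]
      rfl
    rw [h3, ContinuousLinearMap.coe_coe, h1, h2, hu, hv] at e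
    simp at e
    exact hne e.symm
  refine hXY ?_
  ext1 y
  have e := (hk.nearlyKaehler.isCompatible y).norm_contract_sq (X y) (Y y)
  rw [hs, zero_mul, sq_eq_zero_iff, norm_eq_zero, hk.nearlyKaehler.contract_form, neg_eq_zero] at e
  change h.nablaJ X Y y = 0
  rw [← neg_eq_zero, ← h.sq, e, map_zero]

lemma IsNaturallyReductiveStrictNK.isNaturallyReductiveGVCP [PreconnectedSpace M]
    (hk : h.IsNaturallyReductiveStrictNK) : IsNaturallyReductiveGVCP h.canonicalConnection :=
  ⟨_, hk.isNaturallyReductive, fun x =>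
    (hk.nearlyKaehler.isCompatible x).isGeneralizedVectorCrossProduct (hk.form_ne_zero x)⟩

/-- A naturally reductive strict nearly Kähler structure is determined by its orientation and its
canonical connection. -/
theorem IsNaturallyReductiveStrictNK.eq [PreconnectedSpace M] {h' : AlmostHermitian 6 M}
    (hk : h.IsNaturallyReductiveStrictNK) (hk' : h'.IsNaturallyReductiveStrictNK)
    (ho : h.inducedOrientation = h'.inducedOrientation)
    (hD : h.canonicalConnection = h'.canonicalConnection) : h = h' := by
  ext x v
  -- Both forms are the torsion of the same connection.
  have hτ : hk.nearlyKaehler.form x = hk'.nearlyKaehler.form x := by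
    ext w
    have e : ∀ X Y : VField 6 M, contract (hk.nearlyKaehler.form x) (X x) (Y x) =
        contract (hk'.nearlyKaehler.form x) (X x) (Y x) := fun X Y => by
      rw [← hk.isNaturallyReductive.2.torsion_apply, ← hk'.isNaturallyReductive.2.torsion_apply, hD]
    have e1 := e (extendVec x (w 0)) (extendVec x (w 1))
    have hw : w = ![w 0, w 1, w 2] := by
      funext i
      fin_cases i <;> rfl
    rw [extendVec_apply, extendVec_apply] at e1
    rw [hw, ← inner_contract, ← inner_contract, e1]
  have hc' := hk'.nearlyKaehler.isCompatible x
  rw [← hτ] at hc'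
  rcases (hk.nearlyKaehler.isCompatible x).eq_or_eq_neg hc' (hk.form_ne_zero x) with e | e
  · exact (LinearMap.congr_fun e v).symm
  -- Opposite structures would induce opposite orientations, against `ho`.
  · obtain ⟨b, hb⟩ := h.exists_isAdaptedBasis x
    obtain ⟨b', hb'⟩ := h'.exists_isAdaptedBasis x
    have e1 := h.inducesOrientation_inducedOrientation x b hb.1 hb.2.1 hb.2.2
    have e2 := h'.inducesOrientation_inducedOrientation x b' hb'.1 hb'.2.1 hb'.2.2
    rw [e] at hb'
    exact absurd (e1.trans (ho ▸ e2.symm)) (hb.orientation_ne (h.sq x) hb')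

/-- The orientation and the connection of a naturally reductive strict nearly Kähler structure. -/
def orientationConnection [PreconnectedSpace M]
    (h : {h : AlmostHermitian 6 M // h.IsNaturallyReductiveStrictNK}) :
    {p : ManifoldOrientation 6 M × AffineConnection 6 M // IsNaturallyReductiveGVCP p.2} :=
  ⟨(h.1.inducedOrientation, h.1.canonicalConnection), h.2.isNaturallyReductiveGVCP⟩

theorem orientationConnection_bijective [ConnectedSpace M] :
    Function.Bijective (orientationConnection (M := M)) := by
  refine ⟨fun h h' e => Subtype.ext ?_, fun ⟨⟨o, D⟩, τ, hD, hg⟩ => ?_⟩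
  · have e1 := congrArg Subtype.val e
    exact h.2.eq h'.2 (congrArg Prod.fst e1) (congrArg Prod.snd e1)
  · obtain ⟨h, hc, ho⟩ := exists_almostHermitian hD.2 hg o
    refine ⟨⟨h, hD.isNaturallyReductiveStrictNK hc fun x => (hg x).1⟩, Subtype.ext (Prod.ext ?_
      (hD.canonicalConnection_eq hc fun x => (hg x).1))⟩
    ext x
    obtain ⟨b, hb, hbo⟩ := ho x
    exact (h.inducesOrientation_inducedOrientation x b hb.1 hb.2.1 hb.2.2).symm.trans hbo

end AlmostHermitian

end SixDim

end RiemGeom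

end
theorem proposition4p4 {M : Type*} [EMetricSpace M] [ChartedSpace (EuclideanSpace ℝ (Fin 6)) M]
    [IsManifold (𝓡 6) ∞ M] [RiemannianBundle (fun x : M => TangentSpace (𝓡 6) x)]
    [IsContMDiffRiemannianBundle (𝓡 6) ∞ (EuclideanSpace ℝ (Fin 6))
      (fun x : M => TangentSpace (𝓡 6) x)]
    [IsRiemannianManifold (𝓡 6) M] [CompleteSpace M] [ConnectedSpace M] :
    ∃ Φ : {h : RiemGeom.AlmostHermitian 6 M // h.IsNaturallyReductiveStrictNK} ≃
        {p : RiemGeom.ManifoldOrientation 6 M × RiemGeom.AffineConnection 6 M //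
          RiemGeom.IsNaturallyReductiveGVCP p.2},
      ∀ h, h.1.InducesOrientation (Φ h).1.1 ∧ (Φ h).1.2 = h.1.canonicalConnection := by
  exact ⟨Equiv.ofBijective _ RiemGeom.AlmostHermitian.orientationConnection_bijective, fun h =>
    ⟨h.1.inducesOrientation_inducedOrientation, rfl⟩⟩
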